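/- Let $V$ be a Hausdorff smooth real $4$-manifold with a smooth metric $g$ of signature $(+,-,-,-)$, Levi-Civita connection $\nabla$, and a spin structure, given by smooth $g$-orthonormal tetrads on the members of an open cover and a smooth $SL(2,\mathbb C)$-valued cocycle covering the changes of tetrads; write $t^{AA'}$ for the Hermitian matrix of a tangent vector $t$, so that $g=\varepsilon_{AB}\varepsilon_{A'B'}$. A nonlinear connection with splitting $2+2$ is a smooth field of projections $\mathbf N$ of $TV$ onto an integrable rank-two subbundle $vV$; put $hV=\ker\mathbf N$, so $TV=hV\oplus vV$, and assume $hV\perp_g vV$. The canonical d-connection $\mathbf D$ of $(g,\mathbf N)$ is the smooth linear connection which preserves this splitting, satisfies $\mathbf Dg=0$, and has torsion $\mathcal T$ with $h\mathcal T(hX,hY)=0$, $v\mathcal T(vX,vY)=0$, and with $hX\mapsto h\mathcal T(hX,vA)$ and $vA\mapsto v\mathcal T(vA,hX)$ $g$-symmetric. For a metric connection $D$ on $TV$ (such as $\mathbf D$ or $\nabla$), use the same symbol for the induced derivative of spinors. Let $P_{\alpha\beta}=\tfrac12\big(\mathrm{Ric}_{\alpha\beta}-\tfrac16\,s\,g_{\alpha\beta}\big)$,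 where $\mathrm{Ric}(e_\alpha,e_\beta)$ is the trace of $X\mapsto R(X,e_\beta)e_\alpha$ with $R(X,Y)=D_XD_Y-D_YD_X-D_{[X,Y]}$, and $s$ is the scalar curvature. A local twistor at $u$ is a pair $Z=(\omega^A,\pi_{A'})$ of spinors at $u$; these form a complex vector space of dimension $4$. For a field $Z$ of local twistors put $${}_tD Z=\big(t^{AA'}D_{AA'}\omega^B+i\,t^{BA'}\pi_{A'},\ \ t^{AA'}D_{AA'}\pi_{B'}+i\,t^{AA'}P_{AA'BB'}\omega^B\big).$$ The local twistor curvature $K^{\beta}{}_{\alpha\mu\nu}$ of $D$ is defined by $i({}_tD\,{}_vD-{}_vD\,{}_tD-{}_{[t,v]}D)Z$, and the d-commutator is $\Delta_{\alpha\beta}=D_\alpha D_\beta-D_\beta D_\alpha$, acting on scalar functions. **Theorem.** Suppose that there is such an $\mathbf N$ for which the canonical d-connection $\mathbf D$ has $K^{\beta}{}_{\alpha\mu\nu}=0$ and $\Delta_{\alpha\beta}=0$. Then the local twistors of $\nabla$ globalize: 1. $\mathbf D=\nabla$ on differentiable vector fields. 2. Let $U\subseteq V$ be open and simply connected (for instance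 $U=V$, if $V$ is simply connected). For a smooth field $Z=(\omega^A,\pi_{A'})$ of local twistors on $U$ the following are equivalent: (a) $\mathbf D_{A'}^{(A}\omega^{B)}=0$ and $\pi_{A'}=\tfrac12 i\,\mathbf D_{AA'}\omega^A$ on $U$; (b) ${}_t\mathbf D Z=0$ for all tangent vectors $t$ at points of $U$; (c) and (d): the same as (a), respectively (b), with $\nabla$ in place of $\mathbf D$. These fields form a complex vector space $\mathbb T(U)$ of dimension $4$, and for every $u\in U$ evaluation at $u$ is a bijection from $\mathbb T(U)$ onto the local twistors at $u$; that is, every local twistor at $u$ extends uniquely to a global solution on $U$. -/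

import Mathlib

open scoped Manifold ContDiff Matrix
open TopologicalSpace

noncomputable section

namespace NTwistor

/-- The model space of four dimensional real manifolds. -/
abbrev E4 := EuclideanSpace ℝ (Fin 4)

section Geometry

variable (V : Type*) [TopologicalSpace V] [ChartedSpace E4 V]

/-- Vector fields on `V` (no regularity is imposed). -/
abbrev VField := ∀ u : V, TangentSpace 𝓘(ℝ, E4) u

/-- Linear connections on `V`. For `D : LinConn V`, the vector `D Y u t` is `(D_t Y)(u)`. -/
abbrev LinConn [IsManifold 𝓘(ℝ, E4) ∞ V] :=
  CovariantDerivative 𝓘(ℝ, E4) E4 (fun u : V ↦ TangentSpace 𝓘(ℝ, E4) u)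

/-- Smooth pseudo-Riemannian metrics. The Lorentz signature `(+,-,-,-)` is imposed below, by the
orthonormal tetrads of a spin structure. -/
structure Metric [IsManifold 𝓘(ℝ, E4) ∞ V] where
  val (u : V) : TangentSpace 𝓘(ℝ, E4) u →L[ℝ] TangentSpace 𝓘(ℝ, E4) u →L[ℝ] ℝ
  symm (u : V) (x y : TangentSpace 𝓘(ℝ, E4) u) : val u x y = val u y x
  nondegenerate (u : V) (x : TangentSpace 𝓘(ℝ, E4) u) : (∀ y, val u x y = 0) → x = 0
  smooth : ContMDiff 𝓘(ℝ, E4) (𝓘(ℝ, E4).prod 𝓘(ℝ, E4 →L[ℝ] E4 →L[ℝ] ℝ)) ∞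
    (fun u ↦ Bundle.TotalSpace.mk' (E4 →L[ℝ] E4 →L[ℝ] ℝ)
      (E := fun u : V ↦ TangentSpace 𝓘(ℝ, E4) u →L[ℝ] TangentSpace 𝓘(ℝ, E4) u →L[ℝ] ℝ) u (val u))

variable {V} [IsManifold 𝓘(ℝ, E4) ∞ V]

/-- The vector field `X` is smooth on the set `s`. -/
def SmoothFieldOn (X : VField V) (s : Set V) : Prop :=
  ContMDiffOn 𝓘(ℝ, E4) 𝓘(ℝ, E4).tangent ∞ (fun u ↦ (⟨u, X u⟩ : TangentBundle 𝓘(ℝ, E4) V)) s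

/-- The vector field `X` is smooth on `V`. -/
def SmoothField (X : VField V) : Prop := SmoothFieldOn X Set.univ

variable (V) in
/-- A nonlinear connection with splitting `2+2`: a smooth field of projections `N` of `TV` onto a
rank two subbundle `vV`, which is the vertical bundle of (local) fibrations, i.e. integrable.
The horizontal bundle is `hV = ker N`, so that `TV = hV ⊕ vV`; `hV` need not be integrable. -/
structure NConnection where
  proj (u : V) : TangentSpace 𝓘(ℝ, E4) u →L[ℝ] TangentSpace 𝓘(ℝ, E4) u
  idem (u : V) (x : TangentSpace 𝓘(ℝ, E4) u) : proj u (proj u x) = proj u x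
  rank_two (u : V) : Module.finrank ℝ (LinearMap.range (proj u).toLinearMap) = 2
  smooth : ContMDiff 𝓘(ℝ, E4) (𝓘(ℝ, E4).prod 𝓘(ℝ, E4 →L[ℝ] E4)) ∞
    (fun u ↦ Bundle.TotalSpace.mk' (E4 →L[ℝ] E4)
      (E := fun u : V ↦ TangentSpace 𝓘(ℝ, E4) u →L[ℝ] TangentSpace 𝓘(ℝ, E4) u) u (proj u))
  vertical_integrable (X Y : VField V) (hX : SmoothField X) (hY : SmoothField Y)
    (vX : ∀ u, proj u (X u) = X u) (vY : ∀ u, proj u (Y u) = Y u) (u : V) :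
    proj u (VectorField.mlieBracket 𝓘(ℝ, E4) X Y u) = VectorField.mlieBracket 𝓘(ℝ, E4) X Y u

/-- The vertical part `vx` of a tangent vector. -/
def NConnection.ver (N : NConnection V) {u : V} (x : TangentSpace 𝓘(ℝ, E4) u) :
    TangentSpace 𝓘(ℝ, E4) u := N.proj u x

/-- The horizontal part `hx` of a tangent vector. -/
def NConnection.hor (N : NConnection V) {u : V} (x : TangentSpace 𝓘(ℝ, E4) u) :
    TangentSpace 𝓘(ℝ, E4) u := x - N.proj u x

/-- `g` is a d-metric for `N`: `g = hg + vg`, i.e. `hV` and `vV` are `g`-orthogonal. -/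
def IsDMetric (g : Metric V) (N : NConnection V) : Prop :=
  ∀ (u : V) (x y : TangentSpace 𝓘(ℝ, E4) u), g.val u (N.hor x) (N.ver y) = 0

/-- `D g = 0`. -/
def IsMetricCompatible (g : Metric V) (D : LinConn V) : Prop :=
  ∀ Y Z : VField V, SmoothField Y → SmoothField Z → ∀ (u : V) (t : TangentSpace 𝓘(ℝ, E4) u),
    mvfderiv 𝓘(ℝ, E4) (fun v ↦ g.val v (Y v) (Z v)) u t =
      g.val u (D Y u t) (Z u) + g.val u (Y u) (D Z u t)

/-- `D` is the Levi-Civita connection of `g`. -/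
structure IsLeviCivita (g : Metric V) (D : LinConn V) : Prop where
  smooth : CovariantDerivative.ContMDiffCovariantDerivative D ∞
  metric : IsMetricCompatible g D
  torsion_free : D.torsion = 0

/-- `D` is a d-connection: it preserves the splitting `TV = hV ⊕ vV` under parallelism. -/
def IsDConnection (N : NConnection V) (D : LinConn V) : Prop :=
  ∀ Y : VField V, SmoothField Y → ∀ (u : V) (t : TangentSpace 𝓘(ℝ, E4) u),
    D (fun v ↦ N.ver (Y v)) u t = N.ver (D Y u t)

/-- `D` is the canonical d-connection of `(g, N)`: the metric compatible d-connection whose torsion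
`T` has `hT(hX,hY) = 0` and `vT(vX,vY) = 0`, and whose mixed torsions `X ↦ hT(hX,vA)` and
`A ↦ vT(vA,hX)` are `g`-symmetric. The last two conditions fix the coefficients `C^i_{jc}` and
`L^a_{bk}`: in an adapted frame `e_k = ∂_k - N_k^a ∂_a`, `e_b = ∂_b` they say that
`C^i_{jc} = ½ g^{ik} e_c g_{jk}` and that `L^a_{bk} = e_b N^a_k + ½ h^{ac} (e_k h_{bc}
- h_{dc} e_b N^d_k - h_{db} e_c N^d_k)`. -/
structure IsCanonicalDConnection (g : Metric V) (N : NConnection V) (D : LinConn V) : Prop where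
  smooth : CovariantDerivative.ContMDiffCovariantDerivative D ∞
  dconnection : IsDConnection N D
  metric : IsMetricCompatible g D
  torsion_hh (u : V) (x y : TangentSpace 𝓘(ℝ, E4) u) :
    N.hor (D.torsion u (N.hor x) (N.hor y)) = 0
  torsion_vv (u : V) (x y : TangentSpace 𝓘(ℝ, E4) u) :
    N.ver (D.torsion u (N.ver x) (N.ver y)) = 0
  torsion_hv (u : V) (x y a : TangentSpace 𝓘(ℝ, E4) u) :
    g.val u (D.torsion u (N.hor x) (N.ver a)) (N.hor y) =
      g.val u (D.torsion u (N.hor y) (N.ver a)) (N.hor x)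
  torsion_vh (u : V) (a b x : TangentSpace 𝓘(ℝ, E4) u) :
    g.val u (D.torsion u (N.ver a) (N.hor x)) (N.ver b) =
      g.val u (D.torsion u (N.ver b) (N.hor x)) (N.ver a)

/-- The second covariant derivative `X^α Y^β D_α D_β f` of a scalar function. -/
def hess (D : LinConn V) (X Y : VField V) (f : V → ℝ) (u : V) : ℝ :=
  mvfderiv 𝓘(ℝ, E4) (fun v ↦ mvfderiv 𝓘(ℝ, E4) f v (Y v)) u (X u)
    - mvfderiv 𝓘(ℝ, E4) f u (D Y u (X u))

/-- The d-commutator `X^α Y^β Δ_{αβ} f`, where `Δ_{αβ} = D_α D_β - D_β D_α`. -/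
def dCommutator (D : LinConn V) (X Y : VField V) (f : V → ℝ) (u : V) : ℝ :=
  hess D X Y f u - hess D Y X f u

/-- `Δ_{αβ} = 0` on scalar functions. -/
def DCommutatorVanishes (D : LinConn V) : Prop :=
  ∀ (X Y : VField V) (f : V → ℝ), SmoothField X → SmoothField Y →
    ContMDiff 𝓘(ℝ, E4) 𝓘(ℝ, ℝ) ∞ f → ∀ u, dCommutator D X Y f u = 0

/-- The curvature `R(X,Y)Z = D_X D_Y Z - D_Y D_X Z - D_{[X,Y]} Z`. -/
def curv (D : LinConn V) (X Y Z : VField V) : VField V := fun u ↦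
  D (fun v ↦ D Z v (Y v)) u (X u) - D (fun v ↦ D Z v (X v)) u (Y u)
    - D Z u (VectorField.mlieBracket 𝓘(ℝ, E4) X Y u)

end Geometry

/-! ### Spinors -/

/-- Diagonal entries of the Minkowski metric, signature `(+,-,-,-)`. -/
def eta : Fin 4 → ℝ := ![1, -1, -1, -1]

/-- The unit matrix and the Pauli matrices. -/
def pauli : Fin 4 → Matrix (Fin 2) (Fin 2) ℂ :=
  ![1, !![0, 1; 1, 0], !![0, -Complex.I; Complex.I, 0], !![1, 0; 0, -1]]

/-- The normalization factor `1/√2` of the matrices `σ_k^{AA'}`, for which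
`ε_{AB} ε_{A'B'} σ_k^{AA'} σ_l^{BB'} = η_{kl}`. -/
def nrm : ℂ := ((Real.sqrt 2 : ℝ) : ℂ)⁻¹

/-- The antisymmetric spinor `ε^{AB}`. -/
def eps : Matrix (Fin 2) (Fin 2) ℂ := !![0, 1; -1, 0]

/-- Components `(ω^A, π_{A'})` of a local twistor in a spin frame. -/
abbrev TwComp := (Fin 2 → ℂ) × (Fin 2 → ℂ)

section Spin

variable {V : Type*} [TopologicalSpace V] [ChartedSpace E4 V] [IsManifold 𝓘(ℝ, E4) ∞ V]

/-- Hermitian matrix `t^{AA'} = Σ_k t^k σ_k^{AA'}` of a tangent vector `t` with respect to a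
`g`-orthonormal tetrad `e_0, …, e_3`, where `t^k = η_k g(t, e_k)`. -/
def hermOf (g : Metric V) (e : Fin 4 → VField V) (u : V) (t : TangentSpace 𝓘(ℝ, E4) u) :
    Matrix (Fin 2) (Fin 2) ℂ :=
  nrm • ∑ k, ((eta k * g.val u t (e k u) : ℝ) : ℂ) • pauli k

/-- A (Lorentzian) spin structure on `(V, g)`: smooth orthonormal tetrads on the members of an open
cover, together with a smooth `SL(2,ℂ)`-valued cocycle of spin frame changes which covers the
changes of tetrads. -/
structure SpinStructure (g : Metric V) (ι : Type*) where
  dom : ι → Opens V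
  covers (u : V) : ∃ i, u ∈ dom i
  tetrad : ι → Fin 4 → VField V
  tetrad_smooth (i : ι) (k : Fin 4) : SmoothFieldOn (tetrad i k) (dom i)
  orthonormal (i : ι) (u : V) (hu : u ∈ dom i) (k l : Fin 4) :
    g.val u (tetrad i k u) (tetrad i l u) = if k = l then eta k else 0
  trans : ι → ι → V → Matrix (Fin 2) (Fin 2) ℂ
  trans_smooth (i j : ι) (A B : Fin 2) :
    ContMDiffOn 𝓘(ℝ, E4) 𝓘(ℝ, ℂ) ∞ (fun u ↦ trans i j u A B) (dom i ∩ dom j : Set V)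
  trans_det (i j : ι) (u : V) (hi : u ∈ dom i) (hj : u ∈ dom j) : (trans i j u).det = 1
  trans_cocycle (i j k : ι) (u : V) (hi : u ∈ dom i) (hj : u ∈ dom j) (hk : u ∈ dom k) :
    trans i j u * trans j k u = trans i k u
  trans_tetrad (i j : ι) (u : V) (hi : u ∈ dom i) (hj : u ∈ dom j)
    (t : TangentSpace 𝓘(ℝ, E4) u) :
    hermOf g (tetrad i) u t = trans i j u * hermOf g (tetrad j) u t * (trans i j u)ᴴ

variable {g : Metric V} {ι : Type*} (S : SpinStructure g ι) (D : LinConn V)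

namespace SpinStructure

/-- The matrix `t^{AA'}` of `t` in the spin frame `i`. -/
def herm (i : ι) (u : V) (t : TangentSpace 𝓘(ℝ, E4) u) : Matrix (Fin 2) (Fin 2) ℂ :=
  hermOf g (S.tetrad i) u t

/-- The connection matrix `¼ Γ^l_k(t) σ_l σ_k`, with `D_t e_k = Γ^l_k(t) e_l`, of the spin connection
of `D` in the spin frame `i`. For a metric connection it is the only matrix `A` with trace zero such
that `(D_t Y)^{BB'} = t(Y^{BB'}) + A^B_C Y^{CB'} + conj(A^{B'}_{C'}) Y^{BC'}`. -/
def spinConn (i : ι) (u : V) (t : TangentSpace 𝓘(ℝ, E4) u) : Matrix (Fin 2) (Fin 2) ℂ :=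
  (1 / 4 : ℂ) • ∑ k, ∑ l,
    ((eta l * g.val u (D (S.tetrad i k) u t) (S.tetrad i l u) : ℝ) : ℂ) • (pauli l * pauli k)

/-- `D_t ω^B` for an unprimed spinor field with components `w` in the spin frame `i`. -/
def spinD (i : ι) (w : V → Fin 2 → ℂ) (u : V) (t : TangentSpace 𝓘(ℝ, E4) u) : Fin 2 → ℂ :=
  mvfderiv 𝓘(ℝ, E4) w u t + S.spinConn D i u t *ᵥ w u

/-- `D_t π_{B'}` for a primed cospinor field with components `p` in the spin frame `i`. -/
def cospinD (i : ι) (p : V → Fin 2 → ℂ) (u : V) (t : TangentSpace 𝓘(ℝ, E4) u) : Fin 2 → ℂ :=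
  mvfderiv 𝓘(ℝ, E4) p u t - (S.spinConn D i u t)ᴴ *ᵥ p u

/-- `D_{AA'} ω^B`, the derivative along the complex vector
`e_{AA'} = (1/√2) Σ_k (σ_k)_{A'A} e_k`. -/
def spinDAA (i : ι) (w : V → Fin 2 → ℂ) (u : V) (A A' B : Fin 2) : ℂ :=
  nrm * ∑ k, pauli k A' A * S.spinD D i w u (S.tetrad i k u) B

/-- Tetrad components `Ric(e_l, e_m) = Σ_k η_k g(R(e_k, e_m) e_l, e_k)` of the Ricci d-tensor. -/
def ricci (i : ι) (u : V) (l m : Fin 4) : ℝ :=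
  ∑ k, eta k * g.val u (curv D (S.tetrad i k) (S.tetrad i m) (S.tetrad i l) u) (S.tetrad i k u)

/-- The scalar curvature of `D`. -/
def scalarCurv (i : ι) (u : V) : ℝ := ∑ l, eta l * S.ricci D i u l l

/-- Tetrad components of `P = ½ (Ric - (1/6) s g)`. With the opposite sign convention for the
Ricci tensor this is `2 P = (1/6) s g - Ric`. -/
def schouten (i : ι) (u : V) (l m : Fin 4) : ℝ :=
  (1 / 2) * (S.ricci D i u l m
    - (1 / 6) * S.scalarCurv D i u * g.val u (S.tetrad i l u) (S.tetrad i m u))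

/-- The matrix, with row index `B'` and column index `B`, of `t^{AA'} P_{AA'BB'}`. -/
def schoutenSpin (i : ι) (u : V) (t : TangentSpace 𝓘(ℝ, E4) u) : Matrix (Fin 2) (Fin 2) ℂ :=
  nrm • ∑ m, ((∑ l, (eta l * g.val u t (S.tetrad i l u)) * S.schouten D i u l m : ℝ) : ℂ) • pauli m

/-- The local twistor derivative
`_tD Z = (D_t ω^B + i t^{BA'} π_{A'}, D_t π_{B'} + i t^{AA'} P_{AA'BB'} ω^B)`. -/
def twistorD (i : ι) (z : V → TwComp) (u : V) (t : TangentSpace 𝓘(ℝ, E4) u) : TwComp :=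
  (S.spinD D i (fun v ↦ (z v).1) u t + Complex.I • (S.herm i u t *ᵥ (z u).2),
    S.cospinD D i (fun v ↦ (z v).2) u t + Complex.I • (S.schoutenSpin D i u t *ᵥ (z u).1))

/-- `i (_X D _Y D - _Y D _X D - _{[X,Y]} D) Z`, the local twistor curvature applied to `Z`. -/
def twistorK (i : ι) (X Y : VField V) (z : V → TwComp) (u : V) : TwComp :=
  Complex.I • (S.twistorD D i (fun v ↦ S.twistorD D i z v (Y v)) u (X u)
    - S.twistorD D i (fun v ↦ S.twistorD D i z v (X v)) u (Y u)
    - S.twistorD D i z u (VectorField.mlieBracket 𝓘(ℝ, E4) X Y u))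

/-- `K = 0`: the curvature of the local twistor derivative vanishes. -/
def TwistorCurvatureVanishes : Prop :=
  ∀ (i : ι) (X Y : VField V) (z : V → TwComp), SmoothField X → SmoothField Y →
    ContMDiff 𝓘(ℝ, E4) 𝓘(ℝ, TwComp) ∞ z → ∀ u ∈ S.dom i, S.twistorK D i X Y z u = 0

/-- The complex vector space of local twistors at `u`: families of components
`(ω^A, π_{A'})`, one for every spin frame defined at `u`, which transform by
`ω^A ↦ Λ^A_B ω^B` and `π_{B'} = conj(Λ^{A'}_{B'}) π_{A'}`. -/
def LocalTwistor (u : V) : Submodule ℂ ({i : ι // u ∈ S.dom i} → TwComp) where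
  carrier := {z | ∀ i j : {i : ι // u ∈ S.dom i}, (z i).1 = S.trans i j u *ᵥ (z j).1 ∧
    (z j).2 = (S.trans i j u)ᴴ *ᵥ (z i).2}
  add_mem' := by
    intro z w hz hw i j
    refine ⟨?_, ?_⟩
    · simp only [Pi.add_apply, Prod.fst_add, Matrix.mulVec_add, ← (hz i j).1, ← (hw i j).1]
    · simp only [Pi.add_apply, Prod.snd_add, Matrix.mulVec_add, ← (hz i j).2, ← (hw i j).2]
  zero_mem' := by
    intro i j
    simp
  smul_mem' := by
    intro c z hz i j
    refine ⟨?_, ?_⟩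
    · simp only [Pi.smul_apply, Prod.smul_fst, Matrix.mulVec_smul, ← (hz i j).1]
    · simp only [Pi.smul_apply, Prod.smul_snd, Matrix.mulVec_smul, ← (hz i j).2]

/-- Fields of local twistors on the open set `U` (no regularity is imposed). -/
abbrev TwField (U : Opens V) := ∀ u : U, S.LocalTwistor (u : V)

variable {S}

open Classical in
/-- Components of a field of local twistors in the spin frame `i`, extended by zero outside
`U ∩ dom i`. -/
def TwField.comp {U : Opens V} (Z : S.TwField U) (i : ι) : V → TwComp := fun v ↦
  if h : v ∈ U ∧ v ∈ S.dom i then (Z ⟨v, h.1⟩).1 ⟨i, h.2⟩ else 0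

/-- The field of local twistors `Z` is smooth on `U`. -/
def TwField.IsSmooth {U : Opens V} (Z : S.TwField U) : Prop :=
  ∀ i, ContMDiffOn 𝓘(ℝ, E4) 𝓘(ℝ, TwComp) ∞ (Z.comp i) (U ∩ S.dom i : Set V)

/-- `Z` is a smooth solution on `U` of the nonholonomic twistor equations
`D_{A'}^{(A} ω^{B)} = 0`, with `π_{A'} = ½ i D_{AA'} ω^A`. -/
def TwField.IsTwistor {U : Opens V} (Z : S.TwField U) (D : LinConn V) : Prop :=
  Z.IsSmooth ∧ ∀ i, ∀ u ∈ U, u ∈ S.dom i →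
    (∀ A' A B : Fin 2,
      (1 / 2 : ℂ) * ((∑ C, eps A C * S.spinDAA D i (fun v ↦ (Z.comp i v).1) u C A' B)
        + ∑ C, eps B C * S.spinDAA D i (fun v ↦ (Z.comp i v).1) u C A' A) = 0) ∧
    ∀ A' : Fin 2, (Z.comp i u).2 A' =
      (1 / 2 : ℂ) * Complex.I * ∑ A, S.spinDAA D i (fun v ↦ (Z.comp i v).1) u A A' A

/-- `Z` is smooth on `U` and constant, in all directions, under local twistor transport. -/
def TwField.IsParallel {U : Opens V} (Z : S.TwField U) (D : LinConn V) : Prop :=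
  Z.IsSmooth ∧ ∀ i, ∀ u ∈ U, u ∈ S.dom i → ∀ t : TangentSpace 𝓘(ℝ, E4) u,
    S.twistorD D i (Z.comp i) u t = 0

end SpinStructure

end Spin

end NTwistor

end

/-!
The vanishing of the d-commutator on coordinate functions, tested along coordinate fields, says that
the canonical d-connection `D` has no torsion (`torsion_eq_zero_of_dCommutatorVanishes`). As `D` is
metric, it is the Levi-Civita connection (`eq_of_isMetricCompatible_of_torsion_eq_zero`), so that
both connections have the same spinor and local twistor derivatives.

In a spin frame and a chart, local twistor transport is given by a one-form with values in the
endomorphisms of `TwComp`, and the vanishing of the local twistor curvature says that this one-form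
is flat (`flat_coordForm`). A flat one-form is gauged away by radial transport
(`exists_gauge_of_flat`), which gives frames of parallel local twistors near every point
(`exists_parallel_frame`).

The unprimed part of the local twistor derivative of `(ω, π)` vanishes if and only if `ω` solves the
twistor equation and `π` is its divergence (`twistorD_fst_eq_zero_iff`). In that case the primed
part vanishes as well (`IsTwistorNear.isParallelNear`): if `(0, φ_k)` is the derivative along the
tetrad vector `e_k`, then the unprimed part of the curvature is a multiple of `σ_k φ_l - σ_l φ_k`,
and these expressions determine `φ`. So twistors and parallel local twistors are the same.

By the transformation law `dΛ + A_i Λ = Λ A_j` of the spin connection (`dmat_trans`), the unprimed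
part of the derivative is covariant under changes of spin frame, and by the previous remark this is
enough for parallelism to be independent of the frame; the tensor character of the Schouten
components is not needed.

The local parallel frames thus form a locally constant system, i.e. a covering space with the local
twistors as fibres. Over a simply connected open set it has a section through every point
(`exists_locallyConstant_section`), and parallel fields on a connected set are determined by one
value (`TwField.IsParallel.eq_of_apply_eq`).
-/

/-! ### Flat one-forms with values in a Banach algebra -/

section FlatGauge

open Metric Set Filter
open scoped Topology

variable {E A : Type*} [NormedAddCommGroup E] [NormedSpace ℝ E]
  [NormedRing A] [NormedAlgebra ℝ A]

theorem smul_mem_ball_zero_of_mem_Icc {x : E} {r t : ℝ} (hx : x ∈ ball (0 : E) r)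
    (ht : t ∈ Icc (0 : ℝ) 1) : t • x ∈ ball (0 : E) r := by
  rw [mem_ball_zero_iff] at hx ⊢
  rw [norm_smul, Real.norm_of_nonneg ht.1]
  nlinarith [norm_nonneg x, ht.2]

/-- Parallel transport along the segment from `0` to `x`, for the connection form `b`. -/
theorem exists_radial_transport [CompleteSpace A] {b : E → E →L[ℝ] A} {r M : ℝ}
    (hb : ContinuousOn b (ball 0 r)) (hM : ∀ y ∈ ball (0 : E) r, ‖b y‖ ≤ M) (hMr : M * r ≤ 1 / 2)
    {x : E} (hx : x ∈ ball (0 : E) r) :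
    ∃ ζ : ℝ → A, ζ 0 = 1 ∧ ∀ t ∈ Icc (0 : ℝ) 1,
      HasDerivWithinAt ζ (-(b (t • x) x * ζ t)) (Icc 0 1) t := by
  have hbx : ∀ t ∈ Icc (0 : ℝ) 1, ‖b (t • x) x‖ ≤ 1 / 2 := fun t ht ↦ by
    have h1 := hM _ (smul_mem_ball_zero_of_mem_Icc hx ht)
    have h2 : ‖x‖ ≤ r := (mem_ball_zero_iff.1 hx).le
    calc ‖b (t • x) x‖ ≤ ‖b (t • x)‖ * ‖x‖ := (b (t • x)).le_opNorm x
      _ ≤ M * r := mul_le_mul h1 h2 (norm_nonneg _) ((norm_nonneg _).trans h1)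
      _ ≤ 1 / 2 := hMr
  have hPL : IsPicardLindelof (fun t z ↦ -(b (t • x) x * z)) (tmin := 0) (tmax := 1)
      ⟨0, by simp⟩ (1 : A) ‖(1 : A)‖₊ 0 ‖(1 : A)‖₊ 1 := by
    refine ⟨fun t ht ↦ ?_, fun z _ ↦ ?_, fun t ht z hz ↦ ?_, by simp⟩
    · refine LipschitzWith.lipschitzOnWith (LipschitzWith.of_dist_le_mul fun z w ↦ ?_)
      rw [dist_eq_norm, dist_eq_norm, neg_sub_neg, ← mul_sub, ← norm_neg (z - w), neg_sub]
      refine (norm_mul_le _ _).trans ?_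
      have := hbx t ht
      push_cast
      nlinarith [norm_nonneg (w - z)]
    · have h1 : ContinuousOn (fun t : ℝ ↦ b (t • x)) (Icc 0 1) :=
        hb.comp (by fun_prop) fun t ht ↦ smul_mem_ball_zero_of_mem_Icc hx ht
      exact ((h1.clm_apply continuousOn_const).mul continuousOn_const).neg
    · rw [norm_neg]
      refine (norm_mul_le _ _).trans ?_
      have h1 := hbx t ht
      have h2 : ‖z‖ ≤ 2 * ‖(1 : A)‖ := by
        have := norm_le_norm_add_norm_sub (1 : A) z
        rw [mem_closedBall, dist_comm, dist_eq_norm, coe_nnnorm] at hz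
        linarith
      rw [coe_nnnorm]
      nlinarith [norm_nonneg z]
  exact hPL.exists_eq_forall_mem_Icc_hasDerivWithinAt₀

/-- The increment of a `C¹` map differs from its differential by a quadratic term. -/
theorem norm_sub_sub_fderiv_le {F : Type*} [NormedAddCommGroup F] [NormedSpace ℝ F]
    {b : E → F} {r M : ℝ} (hd : ∀ y ∈ ball (0 : E) r, DifferentiableAt ℝ b y)
    (hL : ∀ y ∈ ball (0 : E) r, ∀ z ∈ ball (0 : E) r, ‖fderiv ℝ b y - fderiv ℝ b z‖ ≤ M * ‖y - z‖)
    (hM : 0 ≤ M) {y z : E} (hy : y ∈ ball (0 : E) r) (hz : z ∈ ball (0 : E) r) :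
    ‖b z - b y - fderiv ℝ b y (z - y)‖ ≤ M * ‖z - y‖ * ‖z - y‖ := by
  have hs : segment ℝ y z ⊆ ball (0 : E) r := (convex_ball 0 r).segment_subset hy hz
  refine (convex_segment y z).norm_image_sub_le_of_norm_fderiv_le' (fun w hw ↦ hd w (hs hw))
    (fun w hw ↦ ?_) (left_mem_segment ℝ y z) (right_mem_segment ℝ y z)
  refine (hL w (hs hw) y hy).trans ?_
  gcongr
  obtain ⟨c, hc, rfl⟩ := (segment_eq_image' ℝ y z) ▸ hw
  rw [add_sub_cancel_left, norm_smul, Real.norm_of_nonneg hc.1]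
  nlinarith [norm_nonneg (z - y), hc.2]

theorem HasDerivWithinAt.Ici_of_Icc {f : ℝ → A} {f' : A} {t : ℝ}
    (h : HasDerivWithinAt f f' (Icc 0 1) t) (ht : t ∈ Ico (0 : ℝ) 1) :
    HasDerivWithinAt f f' (Ici t) t :=
  h.mono_of_mem_nhdsWithin <| mem_of_superset (Icc_mem_nhdsGE ht.2) (Icc_subset_Icc_left ht.1)

theorem radial_transport_norm_le {β : ℝ → A} {ζ : ℝ → A}
    (hβ : ∀ t ∈ Icc (0 : ℝ) 1, ‖β t‖ ≤ 1) (h0 : ζ 0 = 1)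
    (hζ : ∀ t ∈ Icc (0 : ℝ) 1, HasDerivWithinAt ζ (-(β t * ζ t)) (Icc 0 1) t)
    {t : ℝ} (ht : t ∈ Icc (0 : ℝ) 1) : ‖ζ t‖ ≤ ‖(1 : A)‖ * Real.exp 1 := by
  have key := norm_le_gronwallBound_of_norm_deriv_right_le (f := ζ) (f' := fun t ↦ -(β t * ζ t))
    (δ := ‖(1 : A)‖) (K := 1) (ε := 0) (a := 0) (b := 1)
    (fun t ht ↦ (hζ t ht).continuousWithinAt)
    (fun t ht ↦ (hζ t (Ico_subset_Icc_self ht)).Ici_of_Icc ht) (by rw [h0])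
    (fun t ht ↦ by
      rw [norm_neg, add_zero, one_mul]
      refine (norm_mul_le _ _).trans ?_
      have := hβ t (Ico_subset_Icc_self ht)
      nlinarith [norm_nonneg (ζ t)]) t ht
  rw [gronwallBound_ε0] at key
  refine key.trans ?_
  gcongr
  rw [one_mul, sub_zero]
  exact ht.2

/-- Radial transport depends on the end point as prescribed by the connection form `b`, up to
a quadratic error. Flatness makes `P s = ζ' s - ζ s + s b(s x)(v) ζ s` satisfy the transport
equation along the displaced ray up to a quadratic error, and Grönwall's inequality applies. -/
theorem radial_transport_increment {b : E → E →L[ℝ] A} {r M : ℝ} (hM0 : 0 ≤ M)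
    (hd : ∀ y ∈ ball (0 : E) r, DifferentiableAt ℝ b y)
    (hM : ∀ y ∈ ball (0 : E) r, ‖b y‖ ≤ M) (hMr : M * r ≤ 1 / 2) (hr : r ≤ 1)
    (hlip : ∀ y ∈ ball (0 : E) r, ∀ z ∈ ball (0 : E) r, ‖b y - b z‖ ≤ M * ‖y - z‖)
    (hL : ∀ y ∈ ball (0 : E) r, ∀ z ∈ ball (0 : E) r, ‖fderiv ℝ b y - fderiv ℝ b z‖ ≤ M * ‖y - z‖)
    (flat : ∀ y ∈ ball (0 : E) r, ∀ v w, fderiv ℝ b y v w - fderiv ℝ b y w v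
      + (b y v * b y w - b y w * b y v) = 0)
    {x v : E} (hx : x ∈ ball (0 : E) r) (hxv : x + v ∈ ball (0 : E) r) {ζ ξ : ℝ → A}
    (hζ0 : ζ 0 = 1) (hξ0 : ξ 0 = 1)
    (hζ : ∀ t ∈ Icc (0 : ℝ) 1, HasDerivWithinAt ζ (-(b (t • x) x * ζ t)) (Icc 0 1) t)
    (hξ : ∀ t ∈ Icc (0 : ℝ) 1,
      HasDerivWithinAt ξ (-(b (t • (x + v)) (x + v) * ξ t)) (Icc 0 1) t) :
    ‖ξ 1 - ζ 1 + b x v * ζ 1‖ ≤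
      (2 * M + 2 * M * M) * (‖(1 : A)‖ * Real.exp 1) * (Real.exp 1 - 1) * ‖v‖ ^ 2 := by
  have hball : ∀ {y : E}, y ∈ ball (0 : E) r → ∀ t ∈ Icc (0 : ℝ) 1, ‖b (t • y) y‖ ≤ 1 :=
    fun {y} hy t ht ↦ by
      have h1 := hM _ (smul_mem_ball_zero_of_mem_Icc hy ht)
      have h2 : ‖y‖ ≤ r := (mem_ball_zero_iff.1 hy).le
      calc ‖b (t • y) y‖ ≤ ‖b (t • y)‖ * ‖y‖ := (b (t • y)).le_opNorm y
        _ ≤ M * r := mul_le_mul h1 h2 (norm_nonneg _) hM0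
        _ ≤ 1 := by linarith
  set Z : ℝ := ‖(1 : A)‖ * Real.exp 1 with hZ
  have hZ0 : 0 ≤ Z := by positivity
  have hζZ : ∀ t ∈ Icc (0 : ℝ) 1, ‖ζ t‖ ≤ Z := fun t ht ↦
    radial_transport_norm_le (hball hx) hζ0 hζ ht
  set P : ℝ → A := fun t ↦ ξ t - ζ t + t • (b (t • x) v * ζ t) with hP
  -- the defect of `P` in the transport equation along the ray through `x + v`
  set R : ℝ → A := fun t ↦
    (b (t • x) (x + v) - b (t • (x + v)) (x + v) + fderiv ℝ b (t • x) (t • v) x) * ζ t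
      + (b (t • (x + v)) (x + v) - b (t • x) x) * (t • b (t • x) v) * ζ t with hR
  have hPd : ∀ t ∈ Icc (0 : ℝ) 1,
      HasDerivWithinAt P (-(b (t • (x + v)) (x + v) * P t) + R t) (Icc 0 1) t := by
    intro t ht
    have hy := smul_mem_ball_zero_of_mem_Icc hx ht
    have h1 : HasDerivWithinAt (fun s : ℝ ↦ b (s • x)) (fderiv ℝ b (t • x) x) (Icc 0 1) t := by
      have hl : HasDerivAt (fun s : ℝ ↦ s • x) x t := by
        simpa using (hasDerivAt_id t).smul_const x
      exact ((hd _ hy).hasFDerivAt.comp_hasDerivAt t hl).hasDerivWithinAt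
    have h2 : HasDerivWithinAt (fun s : ℝ ↦ b (s • x) v) (fderiv ℝ b (t • x) x v) (Icc 0 1) t := by
      simpa using h1.clm_apply (hasDerivWithinAt_const t _ v)
    have h3 := ((hξ t ht).sub (hζ t ht)).add
      ((hasDerivWithinAt_id t _).smul (h2.mul (hζ t ht)))
    refine h3.congr_deriv ?_
    -- flatness exchanges the arguments of `fderiv ℝ b`, at the price of a commutator
    have hf := flat _ hy x v
    have hf' : fderiv ℝ b (t • x) x v = fderiv ℝ b (t • x) v x
        - (b (t • x) x * b (t • x) v - b (t • x) v * b (t • x) x) := by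
      rw [eq_sub_iff_add_eq, ← sub_eq_zero, ← hf]; abel
    simp only [hP, hR, hf', map_add, map_smul, id, _root_.smul_apply, Pi.mul_apply]
    simp only [mul_add, add_mul, sub_mul, mul_sub, smul_mul_assoc, mul_smul_comm, smul_sub,
      smul_add, smul_neg, mul_neg, mul_assoc, one_smul]
    abel
  have hRb : ∀ t ∈ Icc (0 : ℝ) 1, ‖R t‖ ≤ (2 * M + 2 * M * M) * Z * ‖v‖ ^ 2 := by
    intro t ht
    have hy := smul_mem_ball_zero_of_mem_Icc hx ht
    have hz := smul_mem_ball_zero_of_mem_Icc hxv ht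
    have hx1 : ‖x‖ ≤ 1 := (mem_ball_zero_iff.1 hx).le.trans hr
    have hsub : t • (x + v) - t • x = t • v := by rw [smul_add, add_sub_cancel_left]
    have htv : ‖t • v‖ ≤ ‖v‖ := by
      rw [norm_smul, Real.norm_of_nonneg ht.1]
      nlinarith [norm_nonneg v, ht.2]
    have hv0 := norm_nonneg v
    have q1 := norm_sub_sub_fderiv_le hd hL hM0 hy hz
    have q2 := hlip _ hz _ hy
    rw [hsub] at q1 q2
    have q1' : ‖b (t • (x + v)) - b (t • x) - fderiv ℝ b (t • x) (t • v)‖ ≤ M * ‖v‖ * ‖v‖ :=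
      q1.trans (by gcongr)
    have q2' : ‖b (t • (x + v)) - b (t • x)‖ ≤ M * ‖v‖ := q2.trans (by gcongr)
    have e1 : ‖b (t • x) (x + v) - b (t • (x + v)) (x + v) + fderiv ℝ b (t • x) (t • v) x‖
        ≤ 2 * M * ‖v‖ ^ 2 := by
      have : b (t • x) (x + v) - b (t • (x + v)) (x + v) + fderiv ℝ b (t • x) (t • v) x =
          -((b (t • (x + v)) - b (t • x) - fderiv ℝ b (t • x) (t • v)) x
            + (b (t • (x + v)) - b (t • x)) v) := by
        simp only [map_add, _root_.sub_apply]; abel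
      rw [this, norm_neg]
      refine (norm_add_le _ _).trans ?_
      have r1 := ContinuousLinearMap.le_of_opNorm_le _ q1' x
      have r2 := ContinuousLinearMap.le_of_opNorm_le _ q2' v
      nlinarith [mul_nonneg (mul_nonneg hM0 hv0) hv0]
    have e2 : ‖b (t • (x + v)) (x + v) - b (t • x) x‖ ≤ 2 * M * ‖v‖ := by
      have : b (t • (x + v)) (x + v) - b (t • x) x =
          (b (t • (x + v)) - b (t • x)) x + b (t • (x + v)) v := by
        simp only [map_add, _root_.sub_apply]; abel
      rw [this]
      refine (norm_add_le _ _).trans ?_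
      have r1 := ContinuousLinearMap.le_of_opNorm_le _ q2' x
      have r2 := ContinuousLinearMap.le_of_opNorm_le _ (hM _ hz) v
      nlinarith [mul_nonneg hM0 hv0]
    have e3 : ‖t • b (t • x) v‖ ≤ M * ‖v‖ := by
      rw [← map_smul]
      exact (ContinuousLinearMap.le_of_opNorm_le _ (hM _ hy) _).trans (by gcongr)
    have hz1 := hζZ t ht
    calc ‖R t‖ ≤ 2 * M * ‖v‖ ^ 2 * Z + 2 * M * ‖v‖ * (M * ‖v‖) * Z := by
          refine (norm_add_le _ _).trans (add_le_add ?_ ?_)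
          · exact (norm_mul_le _ _).trans (by gcongr)
          · refine (norm_mul_le _ _).trans ?_
            gcongr
            exact (norm_mul_le _ _).trans (by gcongr)
      _ = (2 * M + 2 * M * M) * Z * ‖v‖ ^ 2 := by ring
  have key := norm_le_gronwallBound_of_norm_deriv_right_le (f := P)
    (f' := fun t ↦ -(b (t • (x + v)) (x + v) * P t) + R t)
    (δ := 0) (K := 1) (ε := (2 * M + 2 * M * M) * Z * ‖v‖ ^ 2) (a := 0) (b := 1)
    (fun t ht ↦ (hPd t ht).continuousWithinAt)
    (fun t ht ↦ (hPd t (Ico_subset_Icc_self ht)).Ici_of_Icc ht)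
    (by simp [hP, hζ0, hξ0])
    (fun t ht ↦ by
      have ht' := Ico_subset_Icc_self ht
      refine (norm_add_le _ _).trans (add_le_add ?_ (hRb t ht'))
      rw [norm_neg]
      refine (norm_mul_le _ _).trans ?_
      have := hball hxv t ht'
      gcongr) 1 (by simp)
  rw [gronwallBound_of_K_ne_0 one_ne_zero] at key
  simp only [hP, one_smul, sub_zero, zero_mul, zero_add, div_one, one_mul] at key
  refine key.trans (le_of_eq ?_)
  ring

/-- A flat one-form with values in a Banach algebra is locally pure gauge. The gauge `Φ x` is the
transport along the segment from `x₀` to `x`; its derivative is `-b Φ` because the increments of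
radial transport agree with this up to a quadratic error. -/
theorem exists_gauge_of_flat [CompleteSpace A] {b : E → E →L[ℝ] A} {x₀ : E}
    (hb : ContDiffAt ℝ 2 b x₀)
    (flat : ∀ᶠ y in 𝓝 x₀, ∀ v w, fderiv ℝ b y v w - fderiv ℝ b y w v
      + (b y v * b y w - b y w * b y v) = 0) :
    ∃ Φ : E → A, Φ x₀ = 1 ∧ ∀ᶠ x in 𝓝 x₀, ∃ Φ' : E →L[ℝ] A,
      HasFDerivAt Φ Φ' x ∧ ∀ v, Φ' v = -(b x v * Φ x) := by
  wlog h0 : x₀ = 0 generalizing b x₀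
  · have htr : Tendsto (fun y : E ↦ x₀ + y) (𝓝 0) (𝓝 x₀) := by
      have : Continuous fun y : E ↦ x₀ + y := by fun_prop
      simpa using this.tendsto 0
    have hb' : ContDiffAt ℝ 2 (fun y ↦ b (x₀ + y)) 0 :=
      ContDiffAt.comp (0 : E) (by simpa using hb) (by fun_prop)
    obtain ⟨Φ, h1, h2⟩ := this (b := fun y ↦ b (x₀ + y)) (x₀ := 0) hb'
      (by
        filter_upwards [htr.eventually flat] with y hy
        simpa only [fderiv_comp_add_left] using hy) rfl
    refine ⟨fun y ↦ Φ (y - x₀), by simpa using h1, ?_⟩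
    have htr' : Tendsto (fun y : E ↦ y - x₀) (𝓝 x₀) (𝓝 0) := by
      have : Continuous fun y : E ↦ y - x₀ := by fun_prop
      simpa using this.tendsto x₀
    filter_upwards [htr'.eventually h2] with y hy
    obtain ⟨Φ', h3, h4⟩ := hy
    refine ⟨Φ', ?_, fun v ↦ ?_⟩
    · have h5 := h3.comp y ((hasFDerivAt_id y).sub_const x₀)
      rwa [ContinuousLinearMap.comp_id] at h5
    rw [h4 v, add_sub_cancel]
  subst h0
  have hfd : ContDiffAt ℝ 1 (fderiv ℝ b) 0 := hb.fderiv_right (by norm_num)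
  obtain ⟨K₁, s₁, hs₁, hK₁⟩ := (hb.of_le one_le_two).exists_lipschitzOnWith
  obtain ⟨K₂, s₂, hs₂, hK₂⟩ := hfd.exists_lipschitzOnWith
  have hdiff : ∀ᶠ y in 𝓝 (0 : E), DifferentiableAt ℝ b y := by
    filter_upwards [(hb.of_le one_le_two).eventually (by simp)] with y hy
    exact hy.differentiableAt one_ne_zero
  have hbd : ∀ᶠ y in 𝓝 (0 : E), ‖b y‖ < ‖b 0‖ + 1 :=
    hb.continuousAt.norm.eventually_lt_const (by linarith)
  set M : ℝ := max (max K₁ K₂) (‖b 0‖ + 1) with hMdef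
  have hM1 : ‖b 0‖ + 1 ≤ M := le_max_right _ _
  have hM2 : (K₁ : ℝ) ≤ M := (le_max_left _ _).trans (le_max_left _ _)
  have hM3 : (K₂ : ℝ) ≤ M := (le_max_right _ _).trans (le_max_left _ _)
  have hMpos : 0 < M := by have := norm_nonneg (b 0); linarith
  obtain ⟨r₀, hr₀, hsub⟩ := Metric.eventually_nhds_iff_ball.1
    ((((flat.and hdiff).and hbd).and hs₁).and hs₂)
  -- on a ball of this radius the right-hand side of the transport equation has Lipschitz constant
  -- at most `1 / 2`, and so radial transport exists up to time one
  set r : ℝ := min r₀ (min 1 (1 / (2 * M))) with hr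
  have hrpos : 0 < r := by positivity
  have hr1 : r ≤ 1 := (min_le_right _ _).trans (min_le_left _ _)
  have hMr : M * r ≤ 1 / 2 := by
    have : r ≤ 1 / (2 * M) := (min_le_right _ _).trans (min_le_right _ _)
    calc M * r ≤ M * (1 / (2 * M)) := by gcongr
      _ = 1 / 2 := by field_simp
  have hin : ∀ y ∈ ball (0 : E) r, y ∈ ball (0 : E) r₀ := fun y hy ↦
    ball_subset_ball (min_le_left _ _) hy
  have hd : ∀ y ∈ ball (0 : E) r, DifferentiableAt ℝ b y := fun y hy ↦
    (hsub y (hin y hy)).1.1.1.2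
  have hM : ∀ y ∈ ball (0 : E) r, ‖b y‖ ≤ M := fun y hy ↦
    (hsub y (hin y hy)).1.1.2.le.trans hM1
  have hlip : ∀ y ∈ ball (0 : E) r, ∀ z ∈ ball (0 : E) r, ‖b y - b z‖ ≤ M * ‖y - z‖ := by
    intro y hy z hz
    refine (hK₁.norm_sub_le (hsub y (hin y hy)).1.2 (hsub z (hin z hz)).1.2).trans ?_
    gcongr
  have hL : ∀ y ∈ ball (0 : E) r, ∀ z ∈ ball (0 : E) r,
      ‖fderiv ℝ b y - fderiv ℝ b z‖ ≤ M * ‖y - z‖ := by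
    intro y hy z hz
    refine (hK₂.norm_sub_le (hsub y (hin y hy)).2 (hsub z (hin z hz)).2).trans ?_
    gcongr
  have hcont : ContinuousOn b (ball 0 r) := fun y hy ↦ (hd y hy).continuousAt.continuousWithinAt
  have hex : ∀ x : E, ∃ ζ : ℝ → A, x ∈ ball (0 : E) r → ζ 0 = 1 ∧ ∀ t ∈ Icc (0 : ℝ) 1,
      HasDerivWithinAt ζ (-(b (t • x) x * ζ t)) (Icc 0 1) t := fun x ↦ by
    by_cases hx : x ∈ ball (0 : E) r
    · obtain ⟨ζ, hζ⟩ := exists_radial_transport hcont hM hMr hx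
      exact ⟨ζ, fun _ ↦ hζ⟩
    · exact ⟨0, fun h ↦ absurd h hx⟩
  choose ζ hζ using hex
  refine ⟨fun x ↦ ζ x 1, ?_, ?_⟩
  -- transport along the constant path at the origin
  · have h := hζ 0 (mem_ball_self hrpos)
    refine (constant_of_has_deriv_right_zero (fun t ht ↦ (h.2 t ht).continuousWithinAt)
      (fun t ht ↦ ?_) 1 (by simp)).trans h.1
    simpa using (h.2 t (Ico_subset_Icc_self ht)).Ici_of_Icc ht
  · filter_upwards [ball_mem_nhds (0 : E) hrpos] with x hx
    refine ⟨-(ContinuousLinearMap.mul ℝ A).flip (ζ x 1) ∘L b x, ?_, fun v ↦ by simp⟩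
    rw [hasFDerivAt_iff_isLittleO_nhds_zero]
    have hO : (fun v : E ↦ ζ (x + v) 1 - ζ x 1
        - (-(ContinuousLinearMap.mul ℝ A).flip (ζ x 1) ∘L b x) v) =O[𝓝 0] fun v ↦ ‖v‖ ^ 2 := by
      refine Asymptotics.IsBigO.of_bound
        ((2 * M + 2 * M * M) * (‖(1 : A)‖ * Real.exp 1) * (Real.exp 1 - 1)) ?_
      have hnear : ∀ᶠ v in 𝓝 (0 : E), x + v ∈ ball (0 : E) r := by
        have : Continuous fun v : E ↦ x + v := by fun_prop
        exact this.tendsto' 0 x (by simp) |>.eventually (isOpen_ball.mem_nhds hx)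
      filter_upwards [hnear] with v hv
      have := radial_transport_increment hMpos.le hd hM hMr hr1 hlip hL
        (fun y hy ↦ (hsub y (hin y hy)).1.1.1.1) hx hv (hζ x hx).1 (hζ _ hv).1 (hζ x hx).2
        (hζ _ hv).2
      simpa using this
    exact hO.trans_isLittleO (Asymptotics.isLittleO_norm_pow_id one_lt_two)

end FlatGauge

/-! ### Local systems on simply connected spaces -/

section LocalSystem

open Set Filter
open scoped Topology

/-- A family of sets `E b` with local frames `f k b : X ≃ E b`, whose transition functions are
locally constant, has a locally constant section through every point when the base is simply
connected. The frames make `E` a fiber bundle with discrete fiber `X`, hence a covering, and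
the section is a lift of the identity. -/
theorem exists_locallyConstant_section {B : Type*} [TopologicalSpace B] [SimplyConnectedSpace B]
    [LocallyPathConnectedSpace B] {X κ : Type*} {E : B → Type*} {W : κ → Set B}
    (hW : ∀ k, IsOpen (W k)) (cover : ∀ b, ∃ k, b ∈ W k) {f : ∀ (_ : κ) (b : B), X → E b}
    (hf : ∀ k, ∀ b ∈ W k, Function.Bijective (f k b))
    (loc : ∀ k l b, b ∈ W k → b ∈ W l → ∀ v w, f k b v = f l b w →
      ∀ᶠ b' in 𝓝 b, f k b' v = f l b' w) (b₀ : B) (e₀ : E b₀) :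
    ∃ s : ∀ b, E b, s b₀ = e₀ ∧
      ∀ b k, b ∈ W k → ∃ v, ∀ᶠ b' in 𝓝 b, s b' = f k b' v := by
  classical
  let _ : TopologicalSpace X := ⊥
  have : DiscreteTopology X := ⟨rfl⟩
  choose idx hidx using cover
  let cc : κ → κ → B → X → X := fun k l b v ↦
    if h : b ∈ W l then (Equiv.ofBijective _ (hf l b h)).symm (f k b v) else v
  have hcc : ∀ k l b v, b ∈ W l → f l b (cc k l b v) = f k b v := fun k l b v h ↦ by
    simp only [cc, dif_pos h]
    exact (Equiv.ofBijective _ (hf l b h)).apply_symm_apply _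
  let Z : FiberBundleCore κ B X :=
    { baseSet := W
      isOpen_baseSet := hW
      indexAt := idx
      mem_baseSet_at := hidx
      coordChange := cc
      coordChange_self := fun k b hb v ↦ (hf k b hb).1 (hcc k k b v hb)
      continuousOn_coordChange := by
        rintro k l ⟨b, v⟩ ⟨⟨hbk, hbl⟩, -⟩
        refine ContinuousAt.continuousWithinAt ?_
        have hev : ∀ᶠ p : B × X in 𝓝 (b, v), cc k l p.1 p.2 = cc k l b v := by
          rw [nhds_prod_eq, nhds_discrete X, prod_pure, eventually_map]
          filter_upwards [loc k l b hbk hbl v _ (hcc k l b v hbl).symm,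
            (hW l).mem_nhds hbl] with b' hb' hb'l
          exact (hf l b' hb'l).1 ((hcc k l b' v hb'l).trans hb')
        exact (continuousAt_const (y := cc k l b v)).congr (hev.mono fun _ h ↦ h.symm)
      coordChange_comp := by
        rintro i j k b ⟨⟨hi, hj⟩, hk⟩ v
        exact (hf k b hk).1 (by rw [hcc j k b _ hk, hcc i j b _ hj, hcc i k b _ hk]) }
  have hcov : IsCoveringMap (Bundle.TotalSpace.proj : Bundle.TotalSpace X Z.Fiber → B) :=
    FiberBundle.isCoveringMap
  let x₀ : X := (Equiv.ofBijective _ (hf (idx b₀) b₀ (hidx b₀))).symm e₀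
  have hx₀ : f (idx b₀) b₀ x₀ = e₀ :=
    (Equiv.ofBijective _ (hf (idx b₀) b₀ (hidx b₀))).apply_symm_apply _
  obtain ⟨F, ⟨hF0, hFp⟩, -⟩ := hcov.existsUnique_continuousMap_lifts (ContinuousMap.id B) b₀
    (⟨b₀, x₀⟩ : Bundle.TotalSpace X Z.Fiber) rfl
  have hproj : ∀ b, (F b).1 = b := fun b ↦ congrFun hFp b
  let fib : Bundle.TotalSpace X Z.Fiber → X := fun p ↦ p.2
  refine ⟨fun b ↦ f (idx b) b (fib (F b)), ?_, fun b k hb ↦ ?_⟩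
  · have : fib (F b₀) = x₀ := congrArg fib hF0
    exact (congrArg (f (idx b₀) b₀) this).trans hx₀
  · have hcont : ContinuousAt (fun b' ↦ (Z.localTriv k (F b')).2) b := by
      refine continuousAt_snd.comp (ContinuousAt.comp ?_ F.continuous.continuousAt)
      exact (Z.localTriv k).continuousAt ((Z.mem_localTriv_source k _).2 (by
        change (F b).1 ∈ W k
        rwa [hproj b]))
    refine ⟨(Z.localTriv k (F b)).2, ?_⟩
    have hconst : ∀ᶠ b' in 𝓝 b, (Z.localTriv k (F b')).2 = (Z.localTriv k (F b)).2 :=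
      hcont.eventually (p := fun y ↦ y = (Z.localTriv k (F b)).2)
        (by rw [nhds_discrete]; exact eventually_pure.2 rfl)
    filter_upwards [hconst, (hW k).mem_nhds hb] with b' hb' hbk
    rw [← hb']
    have h1 : (Z.localTriv k (F b')).2 = cc (idx (F b').1) k (F b').1 (fib (F b')) := rfl
    rw [h1, hproj b', hcc _ k b' _ hbk]

end LocalSystem

/-! ### Pauli matrices -/

namespace NTwistor

theorem nrm_ne_zero : nrm ≠ 0 := by
  rw [nrm]
  exact inv_ne_zero (Complex.ofReal_ne_zero.2 (by positivity))

theorem nrm_mul_nrm : nrm * nrm = 1 / 2 := by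
  rw [nrm, ← mul_inv, ← Complex.ofReal_mul, Real.mul_self_sqrt (by norm_num)]
  norm_num

theorem eta_mul_eta (k : Fin 4) : eta k * eta k = 1 := by
  fin_cases k <;> simp [eta]

/-- The completeness relation of the Pauli matrices. -/
theorem sum_pauli_mul_pauli (a b c d : Fin 2) :
    ∑ k, pauli k a b * pauli k c d = if a = d ∧ b = c then 2 else 0 := by
  rw [Fin.sum_univ_four]
  fin_cases a <;> fin_cases b <;> fin_cases c <;> fin_cases d <;> simp [pauli] <;> norm_num

/-- The orthogonality relation of the Pauli matrices. -/
theorem sum_sum_pauli_mul_pauli (k l : Fin 4) :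
    ∑ a, ∑ b, pauli k a b * pauli l b a = if k = l then 2 else 0 := by
  fin_cases k <;> fin_cases l <;> simp [pauli, Fin.sum_univ_two] <;> norm_num

/-- The Lie algebra of `SL(2,ℂ)` acts faithfully on Hermitian matrices. -/
theorem eq_zero_of_pauli_action {B : Matrix (Fin 2) (Fin 2) ℂ} (htr : B.trace = 0)
    (h : ∀ k, B * pauli k + pauli k * Bᴴ = 0) : B = 0 := by
  have h0 := h 0
  have h1 := h 1
  have h3 := h 3
  -- `k = 0` says that `B` is skew-Hermitian, so that `B` commutes with all Pauli matrices
  have hB : Bᴴ = -B := by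
    have : B + Bᴴ = 0 := by simpa [pauli] using h0
    exact (neg_eq_of_add_eq_zero_right this).symm
  rw [hB] at h1 h3
  rw [Matrix.trace_fin_two] at htr
  have a01 := congrFun (congrFun h3 0) 1
  have a10 := congrFun (congrFun h3 1) 0
  have b01 := congrFun (congrFun h1 0) 1
  simp [pauli, Matrix.mul_apply, Matrix.vecMul, dotProduct, Fin.sum_univ_two] at a01 a10 b01
  have e01 : B 0 1 = 0 := a01
  have e10 : B 1 0 = 0 := a10
  have e00 : B 0 0 = 0 := by linear_combination (1 / 2) * (htr + b01)
  have e11 : B 1 1 = 0 := by linear_combination (1 / 2) * (htr - b01)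
  ext i j
  fin_cases i <;> fin_cases j <;> simpa

/-- A spinor-valued covector `c` with `σ_k c_l = σ_l c_k` is zero: `c_k = σ_k c_0`, and the Pauli
matrices do not commute. -/
theorem eq_zero_of_pauli_mulVec_comm {c : Fin 4 → Fin 2 → ℂ}
    (h : ∀ k l, pauli k *ᵥ c l = pauli l *ᵥ c k) : c = 0 := by
  have h1 := h 0 1
  have h2 := h 0 2
  have h12 := h 1 2
  have h3 := h 0 3
  have p0 : pauli 0 = 1 := rfl
  rw [p0, Matrix.one_mulVec] at h1 h2 h3
  rw [h1, h2] at h12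
  have e0 := congrFun h12 0
  have e1 := congrFun h12 1
  simp [pauli, Matrix.mulVec, dotProduct, Fin.sum_univ_two] at e0 e1
  have hI := Complex.I_mul_I
  have c0 : c 0 0 = 0 := by linear_combination (-Complex.I / 2) * e0 + c 0 0 * hI
  have c1 : c 0 1 = 0 := by linear_combination (Complex.I / 2) * e1 + c 0 1 * hI
  have hc : c 0 = 0 := by
    ext i; fin_cases i <;> simpa
  ext k : 1
  have hk := h 0 k
  rwa [p0, Matrix.one_mulVec, hc, Matrix.mulVec_zero] at hk

/-- The matrix of `sl(2,ℂ)` of an infinitesimal Lorentz transformation, given by an antisymmetric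
matrix `G` with lowered indices. -/
noncomputable def spinMatrix (G : Fin 4 → Fin 4 → ℝ) : Matrix (Fin 2) (Fin 2) ℂ :=
  (1 / 4 : ℂ) • ∑ k, ∑ l, ((eta l * G k l : ℝ) : ℂ) • (pauli l * pauli k)

theorem trace_spinMatrix {G : Fin 4 → Fin 4 → ℝ} (hG : ∀ k l, G k l = -G l k) :
    (spinMatrix G).trace = 0 := by
  have d : ∀ k, G k k = 0 := fun k ↦ by linarith [hG k k]
  simp [spinMatrix, Matrix.trace_fin_two, Fin.sum_univ_four, pauli, eta, d]
  ring

theorem spinMatrix_action {G : Fin 4 → Fin 4 → ℝ} (hG : ∀ k l, G k l = -G l k) (m : Fin 4) :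
    spinMatrix G * pauli m + pauli m * (spinMatrix G)ᴴ
      = ∑ l, ((eta l * G m l : ℝ) : ℂ) • pauli l := by
  have d : ∀ k, G k k = 0 := fun k ↦ by linarith [hG k k]
  have h10 := hG 1 0
  have h20 := hG 2 0
  have h30 := hG 3 0
  have h21 := hG 2 1
  have h31 := hG 3 1
  have h32 := hG 3 2
  have hA : spinMatrix G = !![((G 0 3 : ℝ) : ℂ) * (-1 / 2) + Complex.I / 2 * G 1 2,
      -(G 0 1 : ℂ) / 2 + Complex.I / 2 * G 0 2 + (G 1 3 : ℂ) * (-1 / 2) + Complex.I / 2 * G 2 3;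
      -(G 0 1 : ℂ) / 2 - Complex.I / 2 * G 0 2 + (G 1 3 : ℂ) * (1 / 2) + Complex.I / 2 * G 2 3,
      ((G 0 3 : ℝ) : ℂ) * (1 / 2) - Complex.I / 2 * G 1 2] := by
    ext i j
    fin_cases i <;> fin_cases j <;>
      simp [spinMatrix, Fin.sum_univ_four, pauli, eta, d, h10, h20, h30, h21, h31, h32] <;> ring
  rw [hA]
  ext i j
  fin_cases m <;> fin_cases i <;> fin_cases j <;>
    simp [Fin.sum_univ_four, pauli, eta, d, Matrix.vecMul, dotProduct, Fin.sum_univ_two,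
      Complex.conj_ofNat, h10, h20, h30, h21, h31, h32] <;> ring_nf <;> try (simp only [Complex.I_sq]; ring)

end NTwistor

/-! ### Extension of local fields, and coordinate fields -/

namespace NTwistor

open Set Filter
open scoped Topology

section Calculus

variable {V : Type*} [TopologicalSpace V] [ChartedSpace E4 V]

theorem mvfderiv_congr {F : Type*} [NormedAddCommGroup F] [NormedSpace ℝ F] {f g : V → F} {u : V}
    (h : f =ᶠ[𝓝 u] g) : mvfderiv 𝓘(ℝ, E4) f u = mvfderiv 𝓘(ℝ, E4) g u := by
  ext t
  simp only [mvfderiv, h.mfderiv_eq]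
  rfl

theorem mvfderiv_clm_comp {F F' : Type*} [NormedAddCommGroup F] [NormedSpace ℝ F]
    [NormedAddCommGroup F'] [NormedSpace ℝ F'] (L : F →L[ℝ] F') {z : V → F} {u : V}
    (hz : MDifferentiableAt 𝓘(ℝ, E4) 𝓘(ℝ, F) z u) (t : TangentSpace 𝓘(ℝ, E4) u) :
    mvfderiv 𝓘(ℝ, E4) (fun v ↦ L (z v)) u t = L (mvfderiv 𝓘(ℝ, E4) z u t) := by
  have h := (L.hasMFDerivAt (x := z u)).comp u hz.hasMFDerivAt
  exact congrArg (fun A ↦ A t) h.mfderiv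

end Calculus

section Geometry

variable {V : Type*} [TopologicalSpace V] [ChartedSpace E4 V] [IsManifold 𝓘(ℝ, E4) ∞ V]

theorem SmoothFieldOn.mono {X : VField V} {s t : Set V} (h : SmoothFieldOn X t) (hst : s ⊆ t) :
    SmoothFieldOn X s :=
  ContMDiffOn.mono h hst

theorem SmoothFieldOn.contMDiffAt {X : VField V} {s : Set V} (h : SmoothFieldOn X s)
    (hs : IsOpen s) {u : V} (hu : u ∈ s) :
    ContMDiffAt 𝓘(ℝ, E4) 𝓘(ℝ, E4).tangent ∞
      (fun u ↦ (⟨u, X u⟩ : TangentBundle 𝓘(ℝ, E4) V)) u :=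
  ContMDiffOn.contMDiffAt h (hs.mem_nhds hu)

theorem SmoothFieldOn.mdifferentiableAt {X : VField V} {s : Set V} (h : SmoothFieldOn X s)
    (hs : IsOpen s) {u : V} (hu : u ∈ s) :
    MDifferentiableAt 𝓘(ℝ, E4) 𝓘(ℝ, E4).tangent
      (fun u ↦ (⟨u, X u⟩ : TangentBundle 𝓘(ℝ, E4) V)) u :=
  (h.contMDiffAt hs hu).mdifferentiableAt (by simp)

theorem SmoothField.mdifferentiableAt {X : VField V} (h : SmoothField X) (u : V) :
    MDifferentiableAt 𝓘(ℝ, E4) 𝓘(ℝ, E4).tangent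
      (fun u ↦ (⟨u, X u⟩ : TangentBundle 𝓘(ℝ, E4) V)) u :=
  SmoothFieldOn.mdifferentiableAt h isOpen_univ (mem_univ u)

/-- A smooth function on an open set agrees near each of its points with a global one. -/
theorem exists_contMDiff_eventuallyEq [T2Space V] {F : Type*} [NormedAddCommGroup F]
    [NormedSpace ℝ F] {z : V → F} {s : Set V} (hs : IsOpen s)
    (hz : ContMDiffOn 𝓘(ℝ, E4) 𝓘(ℝ, F) ∞ z s) {u : V} (hu : u ∈ s) :
    ∃ z' : V → F, ContMDiff 𝓘(ℝ, E4) 𝓘(ℝ, F) ∞ z' ∧ z' =ᶠ[𝓝 u] z := by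
  obtain ⟨f, hf, -⟩ := (SmoothBumpFunction.nhds_basis_support (I := 𝓘(ℝ, E4))
    (hs.mem_nhds hu)).mem_iff.1 (hs.mem_nhds hu)
  refine ⟨fun v ↦ f v • z v, contMDiff_of_tsupport fun x hx ↦ ?_, ?_⟩
  · have hxs : x ∈ s := hf (closure_mono (Function.support_smul_subset_left _ _) hx)
    exact f.contMDiffAt.smul (hz.contMDiffAt (hs.mem_nhds hxs))
  · filter_upwards [f.eventuallyEq_one] with v hv
    simp [hv]

/-- A smooth vector field on an open set agrees near each of its points with a global one. -/
theorem SmoothFieldOn.exists_smoothField_eventuallyEq [T2Space V] {X : VField V} {s : Set V}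
    (hs : IsOpen s) (hX : SmoothFieldOn X s) {u : V} (hu : u ∈ s) :
    ∃ X' : VField V, SmoothField X' ∧ ∀ᶠ v in 𝓝 u, X' v = X v := by
  obtain ⟨f, hf, -⟩ := (SmoothBumpFunction.nhds_basis_support (I := 𝓘(ℝ, E4))
    (hs.mem_nhds hu)).mem_iff.1 (hs.mem_nhds hu)
  refine ⟨fun v ↦ f v • X v, ?_, ?_⟩
  · have h := ContMDiffOn.smul_section_of_tsupport (f.contMDiff.contMDiffOn (s := s)) hs hf hX
    exact h.contMDiffOn
  · filter_upwards [f.eventuallyEq_one] with v hv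
    simp [hv]

/-- The constant vector field on the model space. -/
noncomputable def constField (c : E4) : ∀ x : E4, TangentSpace 𝓘(ℝ, E4) x := fun _ ↦ c

/-- The field on the domain of the chart at `u₀` with constant coordinates `c`. -/
noncomputable def coordField (u₀ : V) (c : E4) : VField V :=
  VectorField.mpullback 𝓘(ℝ, E4) 𝓘(ℝ, E4) (extChartAt 𝓘(ℝ, E4) u₀) (constField c)

theorem mfderiv_extChartAt_coordField (u₀ : V) (c : E4) {u : V}
    (hu : u ∈ (chartAt E4 u₀).source) :
    mfderiv 𝓘(ℝ, E4) 𝓘(ℝ, E4) (extChartAt 𝓘(ℝ, E4) u₀) u (coordField u₀ c u) = c := by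
  have hinv := isInvertible_mfderiv_extChartAt (I := 𝓘(ℝ, E4)) (x := u₀) (y := u)
    (by rwa [extChartAt_source])
  exact hinv.self_apply_inverse _

theorem coordField_mfderiv_extChartAt (u₀ : V) {u : V} (hu : u ∈ (chartAt E4 u₀).source)
    (x : TangentSpace 𝓘(ℝ, E4) u) :
    coordField u₀ (mfderiv 𝓘(ℝ, E4) 𝓘(ℝ, E4) (extChartAt 𝓘(ℝ, E4) u₀) u x) u = x := by
  have hinv := isInvertible_mfderiv_extChartAt (I := 𝓘(ℝ, E4)) (x := u₀) (y := u)
    (by rwa [extChartAt_source])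
  exact hinv.inverse_apply_self _

theorem contMDiff_constField (c : E4) :
    ContMDiff 𝓘(ℝ, E4) 𝓘(ℝ, E4).tangent ∞
      (fun x : E4 ↦ (⟨x, constField c x⟩ : TangentBundle 𝓘(ℝ, E4) E4)) :=
  contMDiff_vectorSpace_iff_contDiff.2 contDiff_const

theorem smoothFieldOn_coordField (u₀ : V) (c : E4) :
    SmoothFieldOn (coordField u₀ c) (chartAt E4 u₀).source := by
  intro u hu
  refine ContMDiffAt.contMDiffWithinAt ?_
  refine ContMDiffAt.mpullback_vectorField_preimage (n := ∞) ((contMDiff_constField c) _)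
    (contMDiffAt_extChartAt' hu) (isInvertible_mfderiv_extChartAt ?_) (by simp)
  rwa [extChartAt_source]

/-- Coordinate fields commute. -/
theorem mlieBracket_coordField (u₀ : V) (c d : E4) {u : V} (hu : u ∈ (chartAt E4 u₀).source) :
    VectorField.mlieBracket 𝓘(ℝ, E4) (coordField u₀ c) (coordField u₀ d) u = 0 := by
  have hm : IsManifold 𝓘(ℝ, E4) (minSmoothness ℝ 2) V := by
    rw [minSmoothness_of_isRCLikeNormedField]
    exact IsManifold.of_le (n := ∞) ENat.LEInfty.out
  have h := VectorField.mpullback_mlieBracket (I := 𝓘(ℝ, E4)) (I' := 𝓘(ℝ, E4)) (n := ∞)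
    (f := extChartAt 𝓘(ℝ, E4) u₀) (V := constField c) (W := constField d) (x₀ := u)
    ((contMDiff_constField c).mdifferentiable (by simp) _)
    ((contMDiff_constField d).mdifferentiable (by simp) _)
    (contMDiffAt_extChartAt' hu)
    (by rw [minSmoothness_of_isRCLikeNormedField]
        exact ENat.LEInfty.out)
  refine h.symm.trans ?_
  have h0 : VectorField.mlieBracket 𝓘(ℝ, E4) (constField c) (constField d)
      = fun _ ↦ (0 : E4) := by
    ext1 x
    rw [← VectorField.mlieBracketWithin_univ, VectorField.mlieBracketWithin_eq_lieBracketWithin]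
    have hc : constField c = fun _ ↦ c := rfl
    have hd : constField d = fun _ ↦ d := rfl
    rw [hc, hd]
    simp [VectorField.lieBracketWithin]
    rfl
  simp only [VectorField.mpullback, h0]
  exact map_zero _

theorem exists_smoothField_eventuallyEq_coordField [T2Space V] (u₀ : V) (c : E4) {u : V}
    (hu : u ∈ (chartAt E4 u₀).source) :
    ∃ X : VField V, SmoothField X ∧ ∀ᶠ v in 𝓝 u, X v = coordField u₀ c v :=
  (smoothFieldOn_coordField u₀ c).exists_smoothField_eventuallyEq (chartAt E4 u₀).open_source hu

theorem exists_smoothField_eq [T2Space V] {u : V} (x : TangentSpace 𝓘(ℝ, E4) u) :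
    ∃ X : VField V, SmoothField X ∧ X u = x := by
  have hu := mem_chart_source E4 u
  obtain ⟨X, hX, h⟩ := exists_smoothField_eventuallyEq_coordField u
    (mfderiv 𝓘(ℝ, E4) 𝓘(ℝ, E4) (extChartAt 𝓘(ℝ, E4) u) u x) hu
  exact ⟨X, hX, h.self_of_nhds.trans (coordField_mfderiv_extChartAt u hu x)⟩

/-! ### The canonical d-connection is the Levi-Civita connection -/

/-- The torsion is read off on coordinate fields, whose brackets vanish, with coordinate functions
as test functions. -/
theorem torsion_eq_zero_of_dCommutatorVanishes [T2Space V] {D : LinConn V}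
    (h : DCommutatorVanishes D) : D.torsion = 0 := by
  ext u x y
  have hu := mem_chart_source E4 u
  set φ := extChartAt 𝓘(ℝ, E4) u with hφ
  set c := mfderiv 𝓘(ℝ, E4) 𝓘(ℝ, E4) φ u x with hc
  set d := mfderiv 𝓘(ℝ, E4) 𝓘(ℝ, E4) φ u y with hd
  obtain ⟨X, hX, hXc⟩ := exists_smoothField_eventuallyEq_coordField u c hu
  obtain ⟨Y, hY, hYd⟩ := exists_smoothField_eventuallyEq_coordField u d hu
  have hXu : X u = x := hXc.self_of_nhds.trans (coordField_mfderiv_extChartAt u hu x)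
  have hYu : Y u = y := hYd.self_of_nhds.trans (coordField_mfderiv_extChartAt u hu y)
  have key : D Y u x = D X u y := by
    rw [← sub_eq_zero]
    have hinv := isInvertible_mfderiv_extChartAt (I := 𝓘(ℝ, E4)) (x := u) (y := u)
      (mem_extChartAt_source u)
    apply hinv.injective
    rw [map_zero]
    -- it suffices to test with linear functions `L` of the coordinates
    refine SeparatingDual.eq_zero_of_forall_dual_eq_zero (R := ℝ) (V := E4) fun L ↦ ?_
    obtain ⟨f, hf, hfL⟩ := exists_contMDiff_eventuallyEq (z := fun v ↦ L (φ v))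
      (chartAt E4 u).open_source
      (L.contMDiff.comp_contMDiffOn (contMDiffOn_extChartAt (I := 𝓘(ℝ, E4)) (x := u))) hu
    have hdf : ∀ᶠ v in 𝓝 u, ∀ t : TangentSpace 𝓘(ℝ, E4) v,
        mvfderiv 𝓘(ℝ, E4) f v t = L (mfderiv 𝓘(ℝ, E4) 𝓘(ℝ, E4) φ v t) := by
      filter_upwards [hfL.eventuallyEq_nhds, (chartAt E4 u).open_source.mem_nhds hu] with v hv hvu t
      rw [mvfderiv_congr hv]
      exact mvfderiv_clm_comp L (mdifferentiableAt_extChartAt hvu) t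
    -- the second derivatives of a linear function of the coordinates vanish, so that the
    -- d-commutator consists of first-order terms only
    have hconst : ∀ {W : VField V} {e : E4}, (∀ᶠ v in 𝓝 u, W v = coordField u e v) →
        mvfderiv 𝓘(ℝ, E4) (fun v ↦ mvfderiv 𝓘(ℝ, E4) f v (W v)) u = 0 := by
      intro W e hW
      have : (fun v ↦ mvfderiv 𝓘(ℝ, E4) f v (W v)) =ᶠ[𝓝 u] fun _ ↦ L e := by
        filter_upwards [hW, hdf, (chartAt E4 u).open_source.mem_nhds hu] with v hv hv' hvu
        rw [hv, hv']
        exact congrArg L (mfderiv_extChartAt_coordField u e hvu)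
      rw [mvfderiv_congr this, mvfderiv_const]
    have hh := h X Y f hX hY hf u
    rw [dCommutator, hess, hess, hconst hXc, hconst hYd, hXu, hYu, hdf.self_of_nhds,
      hdf.self_of_nhds] at hh
    rw [map_sub]
    have h0 : (0 : TangentSpace 𝓘(ℝ, E4) u →L[ℝ] ℝ) x = 0 := rfl
    have h1 : (0 : TangentSpace 𝓘(ℝ, E4) u →L[ℝ] ℝ) y = 0 := rfl
    rw [h0, h1] at hh
    refine (map_sub L _ _).trans ?_
    linarith
  have := D.torsion_apply (hX.mdifferentiableAt u) (hY.mdifferentiableAt u)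
  rw [hXu, hYu, key, sub_self, zero_sub,
    Filter.EventuallyEq.mlieBracket_vectorField_eq hXc hYd, mlieBracket_coordField u c d hu] at this
  simpa using this

/-- Metric connections with the same torsion agree. -/
theorem eq_of_isMetricCompatible_of_torsion_eq_zero [T2Space V] {g : Metric V} {D D' : LinConn V}
    (hg : IsMetricCompatible g D) (hg' : IsMetricCompatible g D') (ht : D.torsion = 0)
    (ht' : D'.torsion = 0) {Y : VField V} {u : V}
    (hY : MDifferentiableAt 𝓘(ℝ, E4) 𝓘(ℝ, E4).tangent
      (fun v ↦ (⟨v, Y v⟩ : TangentBundle 𝓘(ℝ, E4) V)) u) : D Y u = D' Y u := by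
  set δ := D.difference D' u with hδ
  have hap : ∀ {Z : VField V}, MDifferentiableAt 𝓘(ℝ, E4) 𝓘(ℝ, E4).tangent
      (fun v ↦ (⟨v, Z v⟩ : TangentBundle 𝓘(ℝ, E4) V)) u → δ (Z u) = D Z u - D' Z u := fun hZ ↦
    IsCovariantDerivativeOn.difference_apply D.isCovariantDerivativeOnUniv
      D'.isCovariantDerivativeOnUniv (mem_univ u) hZ
  have symm : ∀ x y, δ x y = δ y x := by
    intro x y
    obtain ⟨X, hX, rfl⟩ := exists_smoothField_eq x
    obtain ⟨Y, hY, rfl⟩ := exists_smoothField_eq y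
    rw [hap (hX.mdifferentiableAt u), hap (hY.mdifferentiableAt u)]
    have h1 := D.torsion_eq_zero_iff.1 ht (hX.mdifferentiableAt u) (hY.mdifferentiableAt u)
    have h2 := D'.torsion_eq_zero_iff.1 ht' (hX.mdifferentiableAt u) (hY.mdifferentiableAt u)
    change D X u (Y u) - D' X u (Y u) = D Y u (X u) - D' Y u (X u)
    have h3 := h1.trans h2.symm
    rw [sub_eq_sub_iff_add_eq_add] at h3 ⊢
    rw [add_comm, ← h3, add_comm]
  -- metric compatibility of both connections makes their difference skew
  have skew : ∀ x y z, g.val u (δ x z) y = - g.val u x (δ y z) := by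
    intro x y z
    obtain ⟨X, hX, rfl⟩ := exists_smoothField_eq x
    obtain ⟨Y, hY, rfl⟩ := exists_smoothField_eq y
    have h1 := hg X Y hX hY u z
    have h2 := hg' X Y hX hY u z
    rw [hap (hX.mdifferentiableAt u), hap (hY.mdifferentiableAt u)]
    change g.val u (D X u z - D' X u z) (Y u) = - g.val u (X u) (D Y u z - D' Y u z)
    rw [map_sub, map_sub]
    change g.val u (D X u z) (Y u) - g.val u (D' X u z) (Y u) = _
    linarith
  have hzero : ∀ x z, δ x z = 0 := by
    intro x z
    refine g.nondegenerate u _ fun y ↦ ?_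
    -- a trilinear form, symmetric in two arguments and skew in two others, vanishes
    have h1 := skew x y z
    have h2 := skew y z x
    have h3 := skew z x y
    rw [g.symm u] at h1 h2 h3
    have e1 := symm x y
    have e2 := symm y z
    have e3 := symm z x
    rw [g.symm u] at h1 h2 h3
    rw [g.symm u x] at h1
    rw [g.symm u y] at h2
    rw [g.symm u z] at h3
    rw [e1] at h3
    rw [e2] at h1
    rw [e3] at h2
    linarith
  have := hap hY
  rw [← sub_eq_zero, ← this]
  ext1 z
  exact hzero _ z

end Geometry

end NTwistor

/-! ### Smoothness of metric products, covariant derivatives and curvature on open sets -/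

namespace NTwistor

open Set Filter
open scoped Topology

section Local

variable {V : Type*} [TopologicalSpace V] [ChartedSpace E4 V] [IsManifold 𝓘(ℝ, E4) ∞ V]
  {s : Set V} {X Y Z : VField V}

theorem SmoothFieldOn.contMDiffOn_metric (g : Metric V) (hX : SmoothFieldOn X s)
    (hY : SmoothFieldOn Y s) :
    ContMDiffOn 𝓘(ℝ, E4) 𝓘(ℝ, ℝ) ∞ (fun v ↦ g.val v (X v) (Y v)) s := by
  intro u hu
  have h : ContMDiffWithinAt 𝓘(ℝ, E4) (𝓘(ℝ, E4).prod 𝓘(ℝ)) ∞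
      (fun v ↦ Bundle.TotalSpace.mk' ℝ (E := Bundle.Trivial V ℝ) v (g.val v (X v) (Y v))) s u := by
    apply ContMDiffWithinAt.clm_bundle_apply₂ (F₁ := E4) (F₂ := E4)
    · exact g.smooth.contMDiffAt.contMDiffWithinAt
    · exact hX u hu
    · exact hY u hu
  simp only [Bundle.contMDiffWithinAt_totalSpace] at h
  exact h.2

theorem SmoothFieldOn.mdifferentiableAt_metric (g : Metric V) (hs : IsOpen s)
    (hX : SmoothFieldOn X s) (hY : SmoothFieldOn Y s) {u : V} (hu : u ∈ s) :
    MDifferentiableAt 𝓘(ℝ, E4) 𝓘(ℝ, ℝ) (fun v ↦ g.val v (X v) (Y v)) u :=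
  ((hX.contMDiffOn_metric g hY).contMDiffAt (hs.mem_nhds hu)).mdifferentiableAt (by simp)

theorem LinConn.congr (D : LinConn V) {u : V}
    (hX : MDifferentiableAt 𝓘(ℝ, E4) 𝓘(ℝ, E4).tangent
      (fun v ↦ (⟨v, X v⟩ : TangentBundle 𝓘(ℝ, E4) V)) u)
    (h : ∀ᶠ v in 𝓝 u, Y v = X v) : D Y u = D X u := by
  refine D.isCovariantDerivativeOnUniv.congr_of_eventuallyEq ?_ hX univ_mem h
  refine hX.congr_of_eventuallyEq ?_
  filter_upwards [h] with v hv
  rw [hv]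

theorem SmoothFieldOn.mlieBracket (hs : IsOpen s) (hX : SmoothFieldOn X s)
    (hY : SmoothFieldOn Y s) :
    SmoothFieldOn (fun v ↦ VectorField.mlieBracket 𝓘(ℝ, E4) X Y v) s := by
  intro u hu
  have : IsManifold 𝓘(ℝ, E4) (((⊤ : ℕ∞) : ℕ∞ω) + 1) V := inferInstanceAs (IsManifold _ ∞ V)
  have : IsManifold 𝓘(ℝ, E4) (minSmoothness ℝ 2) V := by
    rw [minSmoothness_of_isRCLikeNormedField]
    exact IsManifold.of_le (n := ∞) ENat.LEInfty.out
  exact (ContMDiffAt.mlieBracket_vectorField (m := ⊤) (n := ⊤) (hX.contMDiffAt hs hu)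
    (hY.contMDiffAt hs hu)
    (by rw [minSmoothness_of_isRCLikeNormedField]; exact le_refl _)).contMDiffWithinAt

theorem SmoothFieldOn.sub (hX : SmoothFieldOn X s) (hY : SmoothFieldOn Y s) :
    SmoothFieldOn (fun v ↦ X v - Y v) s :=
  ContMDiffOn.sub_section hX hY

variable [T2Space V]

/-- A metric connection satisfies the product rule for fields which are only defined locally. -/
theorem IsMetricCompatible.mvfderiv_metric {g : Metric V} {D : LinConn V}
    (hD : IsMetricCompatible g D) (hs : IsOpen s) (hX : SmoothFieldOn X s)
    (hY : SmoothFieldOn Y s) {u : V} (hu : u ∈ s) (t : TangentSpace 𝓘(ℝ, E4) u) :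
    mvfderiv 𝓘(ℝ, E4) (fun v ↦ g.val v (X v) (Y v)) u t =
      g.val u (D X u t) (Y u) + g.val u (X u) (D Y u t) := by
  obtain ⟨X', hX', hXX'⟩ := hX.exists_smoothField_eventuallyEq hs hu
  obtain ⟨Y', hY', hYY'⟩ := hY.exists_smoothField_eventuallyEq hs hu
  have h := hD X' Y' hX' hY' u t
  rw [LinConn.congr D (hX.mdifferentiableAt hs hu) hXX',
    LinConn.congr D (hY.mdifferentiableAt hs hu) hYY', hXX'.self_of_nhds, hYY'.self_of_nhds] at h
  rw [← h]
  congr 1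
  apply mvfderiv_congr
  filter_upwards [hXX', hYY'] with v hv hv'
  rw [hv, hv']

theorem SmoothFieldOn.covariantDerivative {D : LinConn V}
    (hD : CovariantDerivative.ContMDiffCovariantDerivative D ∞) (hs : IsOpen s)
    (hX : SmoothFieldOn X s) (hY : SmoothFieldOn Y s) :
    SmoothFieldOn (fun v ↦ D Y v (X v)) s := by
  intro u hu
  obtain ⟨Y', hY', hYY'⟩ := hY.exists_smoothField_eventuallyEq hs hu
  have h1 := (hD.contMDiff.contMDiff (σ := Y') hY').contMDiffAt (x := u) univ_mem
  have h2 : ContMDiffAt 𝓘(ℝ, E4) 𝓘(ℝ, E4).tangent ∞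
      (fun v ↦ (⟨v, D Y' v (X v)⟩ : TangentBundle 𝓘(ℝ, E4) V)) u :=
    ContMDiffAt.clm_bundle_apply h1 (hX.contMDiffAt hs hu)
  refine (h2.congr_of_eventuallyEq ?_).contMDiffWithinAt
  filter_upwards [hYY'.eventually_nhds, hs.mem_nhds hu] with v hv hvs
  rw [LinConn.congr D (hY.mdifferentiableAt hs hvs) hv]

theorem SmoothFieldOn.curv {D : LinConn V}
    (hD : CovariantDerivative.ContMDiffCovariantDerivative D ∞) (hs : IsOpen s)
    (hX : SmoothFieldOn X s) (hY : SmoothFieldOn Y s) (hZ : SmoothFieldOn Z s) :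
    SmoothFieldOn (curv D X Y Z) s :=
  ((hX.covariantDerivative hD hs (hY.covariantDerivative hD hs hZ)).sub
    (hY.covariantDerivative hD hs (hX.covariantDerivative hD hs hZ))).sub
    ((hX.mlieBracket hs hY).covariantDerivative hD hs hZ)

/-- Connections which agree on differentiable fields have the same curvature. -/
theorem curv_congr {D D' : LinConn V} (hD : CovariantDerivative.ContMDiffCovariantDerivative D ∞)
    (h : ∀ (Y : VField V) (u : V), MDifferentiableAt 𝓘(ℝ, E4) 𝓘(ℝ, E4).tangent
      (fun v ↦ (⟨v, Y v⟩ : TangentBundle 𝓘(ℝ, E4) V)) u → D Y u = D' Y u)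
    (hs : IsOpen s) (hX : SmoothFieldOn X s) (hY : SmoothFieldOn Y s) (hZ : SmoothFieldOn Z s)
    {u : V} (hu : u ∈ s) : NTwistor.curv D X Y Z u = NTwistor.curv D' X Y Z u := by
  have inner : ∀ {W : VField V}, SmoothFieldOn W s →
      D (fun v ↦ D Z v (W v)) u = D' (fun v ↦ D' Z v (W v)) u := by
    intro W hW
    have hd := (hW.covariantDerivative hD hs hZ).mdifferentiableAt hs hu
    rw [h _ u hd]
    refine (LinConn.congr D' hd ?_).symm
    filter_upwards [hs.mem_nhds hu] with v hv
    rw [h Z v (hZ.mdifferentiableAt hs hv)]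
  rw [NTwistor.curv, NTwistor.curv, inner hX, inner hY, h Z u (hZ.mdifferentiableAt hs hu)]

end Local

end NTwistor

/-! ### Derivatives of vector and matrix valued functions -/

namespace NTwistor

open Set Filter
open scoped Topology

section Calculus

variable {V : Type*} [TopologicalSpace V] [ChartedSpace E4 V]
  {F F' F'' : Type*} [NormedAddCommGroup F] [NormedSpace ℝ F] [NormedAddCommGroup F']
  [NormedSpace ℝ F'] [NormedAddCommGroup F''] [NormedSpace ℝ F''] {u : V}

theorem mvfderiv_bilinear (B : F →L[ℝ] F' →L[ℝ] F'') {z : V → F} {w : V → F'}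
    (hz : MDifferentiableAt 𝓘(ℝ, E4) 𝓘(ℝ, F) z u)
    (hw : MDifferentiableAt 𝓘(ℝ, E4) 𝓘(ℝ, F') w u) (t : TangentSpace 𝓘(ℝ, E4) u) :
    mvfderiv 𝓘(ℝ, E4) (fun v ↦ B (z v) (w v)) u t =
      B (mvfderiv 𝓘(ℝ, E4) z u t) (w u) + B (z u) (mvfderiv 𝓘(ℝ, E4) w u t) := by
  have h1 := (B.isBoundedBilinearMap.hasFDerivAt (z u, w u)).hasMFDerivAt
  have h2 : HasMFDerivAt 𝓘(ℝ, E4) 𝓘(ℝ, F × F') (fun v ↦ (z v, w v)) u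
      ((mvfderiv 𝓘(ℝ, E4) z u).prod (mvfderiv 𝓘(ℝ, E4) w u)) :=
    ⟨hz.hasMFDerivAt.1.prodMk hw.hasMFDerivAt.1, hz.hasMFDerivAt.2.prodMk hw.hasMFDerivAt.2⟩
  refine (congrArg (fun A ↦ A t) (HasMFDerivAt.comp u h1 h2).mfderiv).trans ?_
  exact add_comm (B (z u) (mvfderiv 𝓘(ℝ, E4) w u t)) (B (mvfderiv 𝓘(ℝ, E4) z u t) (w u))

theorem mvfderiv_pi_apply {κ : Type*} [Fintype κ] {z : V → κ → F}
    (hz : MDifferentiableAt 𝓘(ℝ, E4) 𝓘(ℝ, κ → F) z u) (t : TangentSpace 𝓘(ℝ, E4) u) (k : κ) :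
    mvfderiv 𝓘(ℝ, E4) z u t k = mvfderiv 𝓘(ℝ, E4) (fun v ↦ z v k) u t :=
  (mvfderiv_clm_comp (ContinuousLinearMap.proj (R := ℝ) (φ := fun _ : κ ↦ F) k) hz t).symm

theorem mdifferentiableAt_pi_apply {κ : Type*} [Fintype κ] {z : V → κ → F}
    (hz : MDifferentiableAt 𝓘(ℝ, E4) 𝓘(ℝ, κ → F) z u) (k : κ) :
    MDifferentiableAt 𝓘(ℝ, E4) 𝓘(ℝ, F) (fun v ↦ z v k) u :=
  (ContinuousLinearMap.proj (R := ℝ) (φ := fun _ : κ ↦ F) k).mdifferentiableAt.comp u hz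

theorem mdifferentiableAt_pi {κ : Type*} [Fintype κ] {z : V → κ → F}
    (hz : ∀ k, MDifferentiableAt 𝓘(ℝ, E4) 𝓘(ℝ, F) (fun v ↦ z v k) u) :
    MDifferentiableAt 𝓘(ℝ, E4) 𝓘(ℝ, κ → F) z u := by
  exact ⟨continuousWithinAt_pi.2 fun k ↦ (hz k).1, differentiableWithinAt_pi.2 fun k ↦ (hz k).2⟩

/-- The entrywise derivative of a matrix valued function. -/
noncomputable def dmat (M : V → Matrix (Fin 2) (Fin 2) ℂ) (u : V) (t : TangentSpace 𝓘(ℝ, E4) u) :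
    Matrix (Fin 2) (Fin 2) ℂ :=
  Matrix.of fun A B ↦ mvfderiv 𝓘(ℝ, E4) (fun v ↦ M v A B) u t

/-- Entrywise differentiability of a matrix valued function. -/
def MatDiffAt (M : V → Matrix (Fin 2) (Fin 2) ℂ) (u : V) : Prop :=
  ∀ A B, MDifferentiableAt 𝓘(ℝ, E4) 𝓘(ℝ, ℂ) (fun v ↦ M v A B) u

theorem mvfderiv_mul_complex {a b : V → ℂ} (ha : MDifferentiableAt 𝓘(ℝ, E4) 𝓘(ℝ, ℂ) a u)
    (hb : MDifferentiableAt 𝓘(ℝ, E4) 𝓘(ℝ, ℂ) b u) (t : TangentSpace 𝓘(ℝ, E4) u) :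
    mvfderiv 𝓘(ℝ, E4) (fun v ↦ a v * b v) u t =
      mvfderiv 𝓘(ℝ, E4) a u t * b u + a u * mvfderiv 𝓘(ℝ, E4) b u t :=
  mvfderiv_bilinear (ContinuousLinearMap.mul ℝ ℂ) ha hb t

theorem mdifferentiableAt_mul_complex {a b : V → ℂ}
    (ha : MDifferentiableAt 𝓘(ℝ, E4) 𝓘(ℝ, ℂ) a u)
    (hb : MDifferentiableAt 𝓘(ℝ, E4) 𝓘(ℝ, ℂ) b u) :
    MDifferentiableAt 𝓘(ℝ, E4) 𝓘(ℝ, ℂ) (fun v ↦ a v * b v) u :=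
  ha.mul hb

theorem mvfderiv_add_apply {a b : V → F} (ha : MDifferentiableAt 𝓘(ℝ, E4) 𝓘(ℝ, F) a u)
    (hb : MDifferentiableAt 𝓘(ℝ, E4) 𝓘(ℝ, F) b u) (t : TangentSpace 𝓘(ℝ, E4) u) :
    mvfderiv 𝓘(ℝ, E4) (fun v ↦ a v + b v) u t =
      mvfderiv 𝓘(ℝ, E4) a u t + mvfderiv 𝓘(ℝ, E4) b u t := by
  rw [mvfderiv_fun_add ha hb]
  rfl

theorem MatDiffAt.mul {M N : V → Matrix (Fin 2) (Fin 2) ℂ} (hM : MatDiffAt M u)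
    (hN : MatDiffAt N u) : MatDiffAt (fun v ↦ M v * N v) u := by
  intro A B
  simp only [Matrix.mul_apply, Fin.sum_univ_two]
  exact (mdifferentiableAt_mul_complex (hM _ _) (hN _ _)).add
    (mdifferentiableAt_mul_complex (hM _ _) (hN _ _))

theorem MatDiffAt.conjTranspose {M : V → Matrix (Fin 2) (Fin 2) ℂ} (hM : MatDiffAt M u) :
    MatDiffAt (fun v ↦ (M v)ᴴ) u := fun A B ↦
  (Complex.conjCLE.toContinuousLinearMap).mdifferentiableAt.comp u (hM B A)

theorem dmat_mul {M N : V → Matrix (Fin 2) (Fin 2) ℂ} (hM : MatDiffAt M u) (hN : MatDiffAt N u)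
    (t : TangentSpace 𝓘(ℝ, E4) u) :
    dmat (fun v ↦ M v * N v) u t = dmat M u t * N u + M u * dmat N u t := by
  ext A B
  simp only [dmat, Matrix.of_apply, Matrix.mul_apply, Fin.sum_univ_two, Matrix.add_apply]
  rw [mvfderiv_add_apply (mdifferentiableAt_mul_complex (hM _ _) (hN _ _))
    (mdifferentiableAt_mul_complex (hM _ _) (hN _ _)), mvfderiv_mul_complex (hM _ _) (hN _ _),
    mvfderiv_mul_complex (hM _ _) (hN _ _)]
  ring

theorem dmat_conjTranspose {M : V → Matrix (Fin 2) (Fin 2) ℂ} (hM : MatDiffAt M u)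
    (t : TangentSpace 𝓘(ℝ, E4) u) : dmat (fun v ↦ (M v)ᴴ) u t = (dmat M u t)ᴴ := by
  ext A B
  exact mvfderiv_clm_comp Complex.conjCLE.toContinuousLinearMap (hM B A) t

theorem dmat_congr {M N : V → Matrix (Fin 2) (Fin 2) ℂ} (h : M =ᶠ[𝓝 u] N)
    (t : TangentSpace 𝓘(ℝ, E4) u) : dmat M u t = dmat N u t := by
  ext A B
  simp only [dmat, Matrix.of_apply]
  rw [mvfderiv_congr (h.mono fun v hv ↦ by rw [hv])]

theorem MatDiffAt.mulVec {M : V → Matrix (Fin 2) (Fin 2) ℂ} {w : V → Fin 2 → ℂ}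
    (hM : MatDiffAt M u) (hw : MDifferentiableAt 𝓘(ℝ, E4) 𝓘(ℝ, Fin 2 → ℂ) w u) :
    MDifferentiableAt 𝓘(ℝ, E4) 𝓘(ℝ, Fin 2 → ℂ) (fun v ↦ M v *ᵥ w v) u := by
  refine mdifferentiableAt_pi fun A ↦ ?_
  simp only [Matrix.mulVec, dotProduct, Fin.sum_univ_two]
  exact (mdifferentiableAt_mul_complex (hM _ _) (mdifferentiableAt_pi_apply hw _)).add
    (mdifferentiableAt_mul_complex (hM _ _) (mdifferentiableAt_pi_apply hw _))

theorem mvfderiv_mulVec {M : V → Matrix (Fin 2) (Fin 2) ℂ} {w : V → Fin 2 → ℂ}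
    (hM : MatDiffAt M u) (hw : MDifferentiableAt 𝓘(ℝ, E4) 𝓘(ℝ, Fin 2 → ℂ) w u)
    (t : TangentSpace 𝓘(ℝ, E4) u) :
    mvfderiv 𝓘(ℝ, E4) (fun v ↦ M v *ᵥ w v) u t =
      dmat M u t *ᵥ w u + M u *ᵥ mvfderiv 𝓘(ℝ, E4) w u t := by
  ext A
  rw [mvfderiv_pi_apply (hM.mulVec hw)]
  simp only [Matrix.mulVec, dotProduct, Fin.sum_univ_two, dmat, Matrix.of_apply, Pi.add_apply]
  rw [mvfderiv_add_apply (mdifferentiableAt_mul_complex (hM _ _) (mdifferentiableAt_pi_apply hw _))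
    (mdifferentiableAt_mul_complex (hM _ _) (mdifferentiableAt_pi_apply hw _)),
    mvfderiv_mul_complex (hM _ _) (mdifferentiableAt_pi_apply hw _),
    mvfderiv_mul_complex (hM _ _) (mdifferentiableAt_pi_apply hw _),
    mvfderiv_pi_apply hw, mvfderiv_pi_apply hw]
  ring

theorem contMDiffAt_mul_complex {a b : V → ℂ} (ha : ContMDiffAt 𝓘(ℝ, E4) 𝓘(ℝ, ℂ) ∞ a u)
    (hb : ContMDiffAt 𝓘(ℝ, E4) 𝓘(ℝ, ℂ) ∞ b u) :
    ContMDiffAt 𝓘(ℝ, E4) 𝓘(ℝ, ℂ) ∞ (fun v ↦ a v * b v) u :=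
  (contDiff_mul (𝕜 := ℝ) (𝔸 := ℂ)).contMDiff.contMDiffAt.comp u (ha.prodMk_space hb)

theorem contMDiffAt_fst {z : V → TwComp}
    (hz : ContMDiffAt 𝓘(ℝ, E4) 𝓘(ℝ, TwComp) ∞ z u) :
    ContMDiffAt 𝓘(ℝ, E4) 𝓘(ℝ, Fin 2 → ℂ) ∞ (fun v ↦ (z v).1) u :=
  (ContinuousLinearMap.fst ℝ (Fin 2 → ℂ) (Fin 2 → ℂ)).contMDiff.contMDiffAt.comp u hz

theorem contMDiffAt_snd {z : V → TwComp}
    (hz : ContMDiffAt 𝓘(ℝ, E4) 𝓘(ℝ, TwComp) ∞ z u) :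
    ContMDiffAt 𝓘(ℝ, E4) 𝓘(ℝ, Fin 2 → ℂ) ∞ (fun v ↦ (z v).2) u :=
  (ContinuousLinearMap.snd ℝ (Fin 2 → ℂ) (Fin 2 → ℂ)).contMDiff.contMDiffAt.comp u hz

theorem contMDiffAt_matrix_mulVec {M : V → Matrix (Fin 2) (Fin 2) ℂ} {w : V → Fin 2 → ℂ}
    (hM : ∀ A B, ContMDiffAt 𝓘(ℝ, E4) 𝓘(ℝ, ℂ) ∞ (fun v ↦ M v A B) u)
    (hw : ContMDiffAt 𝓘(ℝ, E4) 𝓘(ℝ, Fin 2 → ℂ) ∞ w u) :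
    ContMDiffAt 𝓘(ℝ, E4) 𝓘(ℝ, Fin 2 → ℂ) ∞ (fun v ↦ M v *ᵥ w v) u := by
  refine contMDiffAt_pi_space.2 fun A ↦ ?_
  simp only [Matrix.mulVec, dotProduct, Fin.sum_univ_two]
  have hw' := contMDiffAt_pi_space.1 hw
  exact (contMDiffAt_mul_complex (hM A 0) (hw' 0)).add (contMDiffAt_mul_complex (hM A 1) (hw' 1))

/-- The logarithmic derivative of a family of unimodular matrices is trace free. -/
theorem trace_adjugate_mul_dmat {M : V → Matrix (Fin 2) (Fin 2) ℂ} (hM : MatDiffAt M u)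
    (hdet : ∀ᶠ v in 𝓝 u, (M v).det = 1) (t : TangentSpace 𝓘(ℝ, E4) u) :
    ((M u).adjugate * dmat M u t).trace = 0 := by
  have h1 : mvfderiv 𝓘(ℝ, E4) (fun v ↦ (M v).det) u t = 0 := by
    rw [mvfderiv_congr (g := fun _ ↦ (1 : ℂ)) hdet, mvfderiv_const]
    rfl
  simp only [Matrix.det_fin_two] at h1
  have h2 : mvfderiv 𝓘(ℝ, E4) (fun v ↦ M v 0 0 * M v 1 1 - M v 0 1 * M v 1 0) u t
      = mvfderiv 𝓘(ℝ, E4) (fun v ↦ M v 0 0 * M v 1 1) u t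
        - mvfderiv 𝓘(ℝ, E4) (fun v ↦ M v 0 1 * M v 1 0) u t := by
    rw [mvfderiv_fun_sub (mdifferentiableAt_mul_complex (hM _ _) (hM _ _))
      (mdifferentiableAt_mul_complex (hM _ _) (hM _ _))]
    rfl
  rw [h2, mvfderiv_mul_complex (hM _ _) (hM _ _), mvfderiv_mul_complex (hM _ _) (hM _ _)] at h1
  rw [Matrix.adjugate_fin_two]
  simp only [Matrix.trace, Matrix.diag_apply, Matrix.mul_apply, Fin.sum_univ_two, dmat,
    Matrix.of_apply, Matrix.cons_val', Matrix.cons_val_zero, Matrix.cons_val_one,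
    Matrix.cons_val_fin_one]
  linear_combination h1

end Calculus

end NTwistor

/-! ### Spin connections and changes of spin frame -/

namespace NTwistor

open Set Filter
open scoped Topology

/-- The Hermitian matrix with covariant tetrad components `r`. -/
noncomputable def vecMatrix (r : Fin 4 → ℝ) : Matrix (Fin 2) (Fin 2) ℂ :=
  nrm • ∑ k, ((eta k * r k : ℝ) : ℂ) • pauli k

theorem vecMatrix_add (r r' : Fin 4 → ℝ) : vecMatrix (r + r') = vecMatrix r + vecMatrix r' := by
  simp only [vecMatrix, ← smul_add, ← Finset.sum_add_distrib, ← add_smul, Pi.add_apply]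
  congr 2 with k
  push_cast
  ring_nf

theorem vecMatrix_smul (a : ℝ) (r : Fin 4 → ℝ) : vecMatrix (a • r) = a • vecMatrix r := by
  ext A B
  simp [vecMatrix, Fin.sum_univ_four]
  ring

theorem spinMatrix_mul_vecMatrix {G : Fin 4 → Fin 4 → ℝ} (hG : ∀ k l, G k l = -G l k)
    (r : Fin 4 → ℝ) :
    spinMatrix G * vecMatrix r + vecMatrix r * (spinMatrix G)ᴴ
      = vecMatrix fun l ↦ ∑ m, eta m * r m * G m l := by
  simp only [vecMatrix, mul_smul_comm, smul_mul_assoc, Finset.mul_sum, Finset.sum_mul,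
    ← smul_add, ← Finset.sum_add_distrib, spinMatrix_action hG]
  congr 1
  simp only [Finset.smul_sum]
  rw [Finset.sum_comm]
  refine Finset.sum_congr rfl fun l _ ↦ ?_
  simp only [smul_smul, ← Finset.sum_smul]
  congr 1
  push_cast
  exact Finset.sum_congr rfl fun m _ ↦ by ring

section Calculus

variable {V : Type*} [TopologicalSpace V] [ChartedSpace E4 V] {u : V}

/-- An entry of `vecMatrix`, as a linear form. -/
noncomputable def vecMatrixEntry (A B : Fin 2) : (Fin 4 → ℝ) →L[ℝ] ℂ :=
  LinearMap.toContinuousLinearMap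
    { toFun := fun r ↦ vecMatrix r A B
      map_add' := fun r r' ↦ by rw [vecMatrix_add]; rfl
      map_smul' := fun a r ↦ by rw [vecMatrix_smul]; rfl }

theorem matDiffAt_vecMatrix {r : V → Fin 4 → ℝ}
    (hr : ∀ k, MDifferentiableAt 𝓘(ℝ, E4) 𝓘(ℝ, ℝ) (fun v ↦ r v k) u) :
    MatDiffAt (fun v ↦ vecMatrix (r v)) u := fun A B ↦
  (vecMatrixEntry A B).mdifferentiableAt.comp u (mdifferentiableAt_pi hr)

theorem dmat_vecMatrix {r : V → Fin 4 → ℝ}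
    (hr : ∀ k, MDifferentiableAt 𝓘(ℝ, E4) 𝓘(ℝ, ℝ) (fun v ↦ r v k) u)
    (t : TangentSpace 𝓘(ℝ, E4) u) :
    dmat (fun v ↦ vecMatrix (r v)) u t
      = vecMatrix fun k ↦ mvfderiv 𝓘(ℝ, E4) (fun v ↦ r v k) u t := by
  ext A B
  refine (mvfderiv_clm_comp (vecMatrixEntry A B) (mdifferentiableAt_pi hr) t).trans ?_
  change vecMatrix _ A B = _
  congr 2 with k
  exact mvfderiv_pi_apply (mdifferentiableAt_pi hr) t k

end Calculus

namespace SpinStructure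

variable {V : Type*} [TopologicalSpace V] [ChartedSpace E4 V] [IsManifold 𝓘(ℝ, E4) ∞ V]
  {g : Metric V} {ι : Type*} (S : SpinStructure g ι)

theorem herm_eq_vecMatrix (i : ι) (u : V) (t : TangentSpace 𝓘(ℝ, E4) u) :
    S.herm i u t = vecMatrix fun k ↦ g.val u t (S.tetrad i k u) := rfl

variable {i j : ι} {u : V}

theorem herm_tetrad (hu : u ∈ S.dom i) (k : Fin 4) :
    S.herm i u (S.tetrad i k u) = nrm • pauli k := by
  rw [herm_eq_vecMatrix, vecMatrix]
  congr 1
  rw [Finset.sum_eq_single k]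
  · rw [S.orthonormal i u hu, if_pos rfl, eta_mul_eta, Complex.ofReal_one, one_smul]
  · intro l _ hl
    rw [S.orthonormal i u hu, if_neg hl.symm]
    simp
  · simp

/-- An orthonormal tetrad is a basis of the tangent space. -/
theorem sum_tetrad (hu : u ∈ S.dom i) (t : TangentSpace 𝓘(ℝ, E4) u) :
    ∑ k, (eta k * g.val u t (S.tetrad i k u)) • S.tetrad i k u = t := by
  have coeff : ∀ (c : Fin 4 → ℝ) (l : Fin 4),
      g.val u (∑ k, c k • S.tetrad i k u) (S.tetrad i l u) = c l * eta l := by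
    intro c l
    rw [map_sum, _root_.sum_apply, Finset.sum_eq_single l]
    · rw [map_smul, _root_.smul_apply, S.orthonormal i u hu, if_pos rfl, smul_eq_mul]
    · intro k _ hk
      rw [map_smul, _root_.smul_apply, S.orthonormal i u hu, if_neg hk, smul_zero]
    · simp
  have eta_ne : ∀ l, eta l ≠ 0 := fun l h ↦ by simpa [h] using eta_mul_eta l
  have hli : LinearIndependent ℝ fun k ↦ S.tetrad i k u := by
    rw [Fintype.linearIndependent_iff]
    intro c hc l
    have := coeff c l
    rw [hc, map_zero] at this
    exact (mul_eq_zero.1 this.symm).resolve_right (eta_ne l)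
  have hfin : Module.finrank ℝ (TangentSpace 𝓘(ℝ, E4) u) = 4 := finrank_euclideanSpace_fin
  have : Nonempty (Fin 4) := ⟨0⟩
  let b := basisOfLinearIndependentOfCardEqFinrank hli (by rw [hfin, Fintype.card_fin])
  have hb : ∀ k, b k = S.tetrad i k u := fun k ↦ by simp [b]
  have ht := b.sum_repr t
  simp only [hb] at ht
  have hc : ∀ l, b.repr t l = eta l * g.val u t (S.tetrad i l u) := by
    intro l
    have := coeff (fun k ↦ b.repr t k) l
    rw [ht] at this
    rw [this, mul_comm, mul_assoc, eta_mul_eta, mul_one]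
  simp only [← hc, ht]

theorem metric_eq_sum (hu : u ∈ S.dom i) (x y : TangentSpace 𝓘(ℝ, E4) u) :
    g.val u x y = ∑ k, eta k * g.val u x (S.tetrad i k u) * g.val u y (S.tetrad i k u) := by
  conv_lhs => rw [← S.sum_tetrad hu x, map_sum, _root_.sum_apply]
  refine Finset.sum_congr rfl fun k _ ↦ ?_
  rw [map_smul, _root_.smul_apply, smul_eq_mul, g.symm u (S.tetrad i k u)]

theorem herm_conjugate (hi : u ∈ S.dom i) (hj : u ∈ S.dom j) (t : TangentSpace 𝓘(ℝ, E4) u) :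
    S.herm i u t = S.trans i j u * S.herm j u t * (S.trans i j u)ᴴ :=
  S.trans_tetrad i j u hi hj t

theorem matDiffAt_trans (hi : u ∈ S.dom i) (hj : u ∈ S.dom j) :
    MatDiffAt (S.trans i j) u := fun A B ↦
  ((S.trans_smooth i j A B).contMDiffAt
    (((S.dom i).isOpen.inter (S.dom j).isOpen).mem_nhds ⟨hi, hj⟩)).mdifferentiableAt (by simp)

theorem matDiffAt_herm {Y : VField V} {s : Set V} (hs : IsOpen s) (hY : SmoothFieldOn Y s)
    (hu : u ∈ s) (hi : u ∈ S.dom i) : MatDiffAt (fun v ↦ S.herm i v (Y v)) u :=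
  matDiffAt_vecMatrix fun k ↦
    SmoothFieldOn.mdifferentiableAt_metric g (hs.inter (S.dom i).isOpen)
      (hY.mono inter_subset_left) ((S.tetrad_smooth i k).mono inter_subset_right) ⟨hu, hi⟩

variable (D : LinConn V)

theorem spinConn_eq_spinMatrix (i : ι) (u : V) (t : TangentSpace 𝓘(ℝ, E4) u) :
    S.spinConn D i u t
      = spinMatrix fun k l ↦ g.val u (D (S.tetrad i k) u t) (S.tetrad i l u) := rfl

variable {D} [T2Space V]

theorem metric_tetrad_antisymm (hD : IsMetricCompatible g D) (hu : u ∈ S.dom i)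
    (t : TangentSpace 𝓘(ℝ, E4) u) (k l : Fin 4) :
    g.val u (D (S.tetrad i k) u t) (S.tetrad i l u)
      = -g.val u (D (S.tetrad i l) u t) (S.tetrad i k u) := by
  have h := hD.mvfderiv_metric (S.dom i).isOpen (S.tetrad_smooth i k) (S.tetrad_smooth i l) hu t
  have hc : (fun v ↦ g.val v (S.tetrad i k v) (S.tetrad i l v)) =ᶠ[𝓝 u]
      fun _ ↦ if k = l then eta k else 0 := by
    filter_upwards [(S.dom i).isOpen.mem_nhds hu] with v hv
    exact S.orthonormal i v hv k l
  rw [mvfderiv_congr hc, mvfderiv_const, g.symm u (S.tetrad i k u)] at h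
  have h0 : (0 : TangentSpace 𝓘(ℝ, E4) u →L[ℝ] ℝ) t = 0 := rfl
  rw [h0] at h
  linarith

/-- The spin connection induces the given metric connection on vectors. -/
theorem herm_covariantDerivative (hD : IsMetricCompatible g D) {Y : VField V} {s : Set V}
    (hs : IsOpen s) (hY : SmoothFieldOn Y s) (hu : u ∈ s) (hi : u ∈ S.dom i)
    (t : TangentSpace 𝓘(ℝ, E4) u) :
    dmat (fun v ↦ S.herm i v (Y v)) u t + S.spinConn D i u t * S.herm i u (Y u)
      + S.herm i u (Y u) * (S.spinConn D i u t)ᴴ = S.herm i u (D Y u t) := by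
  have hso := hs.inter (S.dom i).isOpen
  have hY' : SmoothFieldOn Y (s ∩ S.dom i) := hY.mono inter_subset_left
  have he : ∀ k, SmoothFieldOn (S.tetrad i k) (s ∩ S.dom i) := fun k ↦
    (S.tetrad_smooth i k).mono inter_subset_right
  rw [add_assoc]
  simp only [herm_eq_vecMatrix]
  rw [spinConn_eq_spinMatrix, spinMatrix_mul_vecMatrix (S.metric_tetrad_antisymm hD hi t),
    dmat_vecMatrix (fun k ↦ hY'.mdifferentiableAt_metric g hso (he k) ⟨hu, hi⟩), ← vecMatrix_add]
  congr 1
  ext l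
  rw [Pi.add_apply, hD.mvfderiv_metric hso hY' (he l) ⟨hu, hi⟩]
  have h : ∑ m, eta m * g.val u (Y u) (S.tetrad i m u)
      * g.val u (D (S.tetrad i m) u t) (S.tetrad i l u)
      = -g.val u (Y u) (D (S.tetrad i l) u t) := by
    rw [S.metric_eq_sum hi, ← Finset.sum_neg_distrib]
    refine Finset.sum_congr rfl fun m _ ↦ ?_
    rw [S.metric_tetrad_antisymm hD hi t m l]
    ring
  rw [h]
  ring

/-- The transformation law `dΛ + A_i Λ = Λ A_j` of the spin connection. The difference of the two
sides acts trivially on vectors, and it is trace free up to the factor `Λ`. -/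
theorem dmat_trans (hD : IsMetricCompatible g D) (hi : u ∈ S.dom i) (hj : u ∈ S.dom j)
    (t : TangentSpace 𝓘(ℝ, E4) u) :
    dmat (S.trans i j) u t + S.spinConn D i u t * S.trans i j u
      = S.trans i j u * S.spinConn D j u t := by
  have hΛ := S.matDiffAt_trans hi hj
  have hij : (S.dom i ∩ S.dom j : Set V) ∈ 𝓝 u :=
    ((S.dom i).isOpen.inter (S.dom j).isOpen).mem_nhds ⟨hi, hj⟩
  set L := S.trans i j u with hL
  have hdet : L.det = 1 := S.trans_det i j u hi hj
  have hadj : L.adjugate * L = 1 := by rw [Matrix.adjugate_mul, hdet, one_smul]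
  have hadj' : L * L.adjugate = 1 := by rw [Matrix.mul_adjugate, hdet, one_smul]
  -- the defect of the transformation law; the claim is that `L⁻¹ C`, an element of `sl(2,ℂ)`, acts
  -- trivially on Hermitian matrices
  set C := dmat (S.trans i j) u t + S.spinConn D i u t * L - L * S.spinConn D j u t with hC
  have htr : (L.adjugate * C).trace = 0 := by
    have h1 : (L.adjugate * dmat (S.trans i j) u t).trace = 0 :=
      trace_adjugate_mul_dmat hΛ (by
        filter_upwards [hij] with v hv
        exact S.trans_det i j v hv.1 hv.2) t
    have h2 : (L.adjugate * (S.spinConn D i u t * L)).trace = 0 := by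
      rw [Matrix.trace_mul_comm, Matrix.mul_assoc, hadj', Matrix.mul_one, spinConn_eq_spinMatrix,
        trace_spinMatrix (S.metric_tetrad_antisymm hD hi t)]
    have h3 : (L.adjugate * (L * S.spinConn D j u t)).trace = 0 := by
      rw [← Matrix.mul_assoc, hadj, Matrix.one_mul, spinConn_eq_spinMatrix,
        trace_spinMatrix (S.metric_tetrad_antisymm hD hj t)]
    rw [hC, Matrix.mul_sub, Matrix.mul_add, Matrix.trace_sub, Matrix.trace_add, h1, h2, h3]
    simp
  have hact : ∀ k, L.adjugate * C * pauli k + pauli k * (L.adjugate * C)ᴴ = 0 := by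
    intro k
    have hY := S.tetrad_smooth j k
    have e1 := S.herm_covariantDerivative hD (S.dom j).isOpen hY hj hi t
    have e2 := S.herm_covariantDerivative hD (S.dom j).isOpen hY hj hj t
    have hcg : (fun v ↦ S.herm i v (S.tetrad j k v)) =ᶠ[𝓝 u]
        fun v ↦ S.trans i j v * S.herm j v (S.tetrad j k v) * (S.trans i j v)ᴴ := by
      filter_upwards [hij] with v hv
      exact S.herm_conjugate hv.1 hv.2 _
    have hHj := S.matDiffAt_herm (S.dom j).isOpen hY hj hj
    rw [dmat_congr hcg, dmat_mul (hΛ.mul hHj) hΛ.conjTranspose, dmat_mul hΛ hHj,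
      dmat_conjTranspose hΛ, S.herm_conjugate hi hj, S.herm_conjugate hi hj, ← e2,
      S.herm_tetrad hj] at e1
    -- both spin frames compute the covariant derivative of the tetrad vector `e_k` of the frame `j`
    have e3 : C * pauli k * Lᴴ + L * pauli k * Cᴴ = 0 := by
      have e4 : C * (nrm • pauli k) * Lᴴ + L * (nrm • pauli k) * Cᴴ = 0 := by
        rw [hC]
        generalize nrm • pauli k = P at e1 ⊢
        simp only [Matrix.conjTranspose_sub, Matrix.conjTranspose_add, Matrix.conjTranspose_mul]
        rw [← sub_eq_zero] at e1
        rw [← e1]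
        simp only [← hL]
        noncomm_ring
      simp only [mul_smul_comm, smul_mul_assoc, ← smul_add] at e4
      exact (smul_eq_zero.1 e4).resolve_left nrm_ne_zero
    have hadjH : Lᴴ * L.adjugateᴴ = 1 := by
      rw [← Matrix.conjTranspose_mul, hadj, Matrix.conjTranspose_one]
    have e5 : L.adjugate * (C * pauli k * Lᴴ + L * pauli k * Cᴴ) * L.adjugateᴴ = 0 := by
      rw [e3]
      simp
    rw [← e5, Matrix.conjTranspose_mul]
    calc L.adjugate * C * pauli k + pauli k * (Cᴴ * L.adjugateᴴ)
        = L.adjugate * C * pauli k * (Lᴴ * L.adjugateᴴ)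
          + (L.adjugate * L) * pauli k * (Cᴴ * L.adjugateᴴ) := by
          rw [hadjH, hadj, Matrix.mul_one, Matrix.one_mul]
      _ = L.adjugate * (C * pauli k * Lᴴ + L * pauli k * Cᴴ) * L.adjugateᴴ := by noncomm_ring
  have hzero := eq_zero_of_pauli_action htr hact
  have : C = 0 := by
    rw [← Matrix.one_mul C, ← hadj', Matrix.mul_assoc, hzero, Matrix.mul_zero]
  exact sub_eq_zero.1 this

end SpinStructure

end NTwistor

/-! ### The connection form of local twistor transport -/

namespace NTwistor

open Set Filter
open scoped Topology

theorem spinMatrix_add (G G' : Fin 4 → Fin 4 → ℝ) :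
    spinMatrix (G + G') = spinMatrix G + spinMatrix G' := by
  simp only [spinMatrix, ← smul_add, ← Finset.sum_add_distrib, ← add_smul, Pi.add_apply]
  congr 3 with k
  push_cast
  ring_nf

theorem spinMatrix_smul (a : ℝ) (G : Fin 4 → Fin 4 → ℝ) :
    spinMatrix (a • G) = a • spinMatrix G := by
  ext A B
  simp [spinMatrix, Fin.sum_univ_four]
  ring

/-- An entry of `spinMatrix`, as a linear form. -/
noncomputable def spinMatrixEntry (A B : Fin 2) : (Fin 4 → Fin 4 → ℝ) →L[ℝ] ℂ :=
  LinearMap.toContinuousLinearMap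
    { toFun := fun G ↦ spinMatrix G A B
      map_add' := fun G G' ↦ by rw [spinMatrix_add]; rfl
      map_smul' := fun a G ↦ by rw [spinMatrix_smul]; rfl }

namespace SpinStructure

variable {V : Type*} [TopologicalSpace V] [ChartedSpace E4 V] [IsManifold 𝓘(ℝ, E4) ∞ V]
  {g : Metric V} {ι : Type*} (S : SpinStructure g ι) (D : LinConn V)

theorem schoutenSpin_eq_vecMatrix (i : ι) (u : V) (t : TangentSpace 𝓘(ℝ, E4) u) :
    S.schoutenSpin D i u t = vecMatrix fun m ↦
      eta m * ∑ l, (eta l * g.val u t (S.tetrad i l u)) * S.schouten D i u l m := by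
  rw [schoutenSpin, vecMatrix]
  congr 2 with m
  rw [← mul_assoc, eta_mul_eta, one_mul]

theorem herm_add (i : ι) (u : V) (t t' : TangentSpace 𝓘(ℝ, E4) u) :
    S.herm i u (t + t') = S.herm i u t + S.herm i u t' := by
  simp only [herm_eq_vecMatrix, ← vecMatrix_add]
  congr 1 with k
  simp

theorem herm_smul (i : ι) (u : V) (a : ℝ) (t : TangentSpace 𝓘(ℝ, E4) u) :
    S.herm i u (a • t) = a • S.herm i u t := by
  simp only [herm_eq_vecMatrix, ← vecMatrix_smul]
  congr 1 with k
  simp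

theorem spinConn_add (i : ι) (u : V) (t t' : TangentSpace 𝓘(ℝ, E4) u) :
    S.spinConn D i u (t + t') = S.spinConn D i u t + S.spinConn D i u t' := by
  simp only [spinConn_eq_spinMatrix, ← spinMatrix_add]
  congr 1 with k l
  simp

theorem spinConn_smul (i : ι) (u : V) (a : ℝ) (t : TangentSpace 𝓘(ℝ, E4) u) :
    S.spinConn D i u (a • t) = a • S.spinConn D i u t := by
  simp only [spinConn_eq_spinMatrix, ← spinMatrix_smul]
  congr 1 with k l
  simp

theorem schoutenSpin_add (i : ι) (u : V) (t t' : TangentSpace 𝓘(ℝ, E4) u) :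
    S.schoutenSpin D i u (t + t') = S.schoutenSpin D i u t + S.schoutenSpin D i u t' := by
  simp only [schoutenSpin_eq_vecMatrix, ← vecMatrix_add]
  congr 1 with m
  simp only [Pi.add_apply, ← mul_add, ← Finset.sum_add_distrib, ← add_mul]
  simp

theorem schoutenSpin_smul (i : ι) (u : V) (a : ℝ) (t : TangentSpace 𝓘(ℝ, E4) u) :
    S.schoutenSpin D i u (a • t) = a • S.schoutenSpin D i u t := by
  simp only [schoutenSpin_eq_vecMatrix, ← vecMatrix_smul]
  congr 1 with m
  simp only [Pi.smul_apply, smul_eq_mul, map_smul, _root_.smul_apply, Finset.mul_sum]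
  exact Finset.sum_congr rfl fun l _ ↦ by ring

/-- The connection form of the local twistor derivative in the spin frame `i`. -/
noncomputable def twistorForm (i : ι) (u : V) :
    TangentSpace 𝓘(ℝ, E4) u →ₗ[ℝ] TwComp →ₗ[ℝ] TwComp :=
  LinearMap.mk₂ ℝ
    (fun t z ↦ (S.spinConn D i u t *ᵥ z.1 + Complex.I • (S.herm i u t *ᵥ z.2),
      -((S.spinConn D i u t)ᴴ *ᵥ z.2) + Complex.I • (S.schoutenSpin D i u t *ᵥ z.1)))
    (fun t t' z ↦ by
      simp only [spinConn_add, herm_add, schoutenSpin_add, Matrix.conjTranspose_add,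
        Matrix.add_mulVec, smul_add, neg_add, Prod.mk_add_mk]
      congr 1 <;> abel)
    (fun a t z ↦ by
      simp only [spinConn_smul, herm_smul, schoutenSpin_smul, Matrix.conjTranspose_smul,
        Matrix.smul_mulVec, smul_add, Prod.smul_mk, star_trivial, smul_neg]
      rw [smul_comm Complex.I a, smul_comm Complex.I a])
    (fun t z z' ↦ by
      simp only [Prod.fst_add, Prod.snd_add, Matrix.mulVec_add, smul_add, neg_add, Prod.mk_add_mk]
      congr 1 <;> abel)
    (fun a t z ↦ by
      simp only [Prod.smul_fst, Prod.smul_snd, Matrix.mulVec_smul, smul_add, Prod.smul_mk,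
        smul_neg]
      rw [smul_comm Complex.I a, smul_comm Complex.I a])

variable {D} {i j : ι} {u : V} {z z' : V → TwComp}

theorem twistorD_eq (hz : MDifferentiableAt 𝓘(ℝ, E4) 𝓘(ℝ, TwComp) z u)
    (t : TangentSpace 𝓘(ℝ, E4) u) :
    S.twistorD D i z u t = mvfderiv 𝓘(ℝ, E4) z u t + S.twistorForm D i u t (z u) := by
  have h1 := mvfderiv_clm_comp (ContinuousLinearMap.fst ℝ (Fin 2 → ℂ) (Fin 2 → ℂ)) hz t
  have h2 := mvfderiv_clm_comp (ContinuousLinearMap.snd ℝ (Fin 2 → ℂ) (Fin 2 → ℂ)) hz t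
  have e1 : mvfderiv 𝓘(ℝ, E4) (fun v ↦ (z v).1) u t = (mvfderiv 𝓘(ℝ, E4) z u t).1 := h1
  have e2 : mvfderiv 𝓘(ℝ, E4) (fun v ↦ (z v).2) u t = (mvfderiv 𝓘(ℝ, E4) z u t).2 := h2
  rw [twistorD, spinD, cospinD, e1, e2]
  ext1
  · change _ = (mvfderiv 𝓘(ℝ, E4) z u t).1 + (_ + _)
    rw [add_assoc]
  · change _ - _ + _ = (mvfderiv 𝓘(ℝ, E4) z u t).2 + (_ + _)
    rw [sub_eq_add_neg, add_assoc]

theorem twistorD_congr (h : z =ᶠ[𝓝 u] z') (t : TangentSpace 𝓘(ℝ, E4) u) :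
    S.twistorD D i z u t = S.twistorD D i z' u t := by
  rw [twistorD, twistorD, spinD, spinD, cospinD, cospinD, h.self_of_nhds,
    mvfderiv_congr (h.mono fun v hv ↦ congrArg Prod.fst hv : (fun v ↦ (z v).1) =ᶠ[𝓝 u] fun v ↦ (z' v).1),
    mvfderiv_congr (h.mono fun v hv ↦ congrArg Prod.snd hv : (fun v ↦ (z v).2) =ᶠ[𝓝 u] fun v ↦ (z' v).2)]


theorem twistorD_fst_eq_zero (h : ∀ᶠ v in 𝓝 u, (z v).1 = 0) (t : TangentSpace 𝓘(ℝ, E4) u) :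
    (S.twistorD D i z u t).1 = Complex.I • (S.herm i u t *ᵥ (z u).2) := by
  rw [twistorD, spinD, mvfderiv_congr (g := fun _ ↦ (0 : Fin 2 → ℂ)) h, mvfderiv_const,
    h.self_of_nhds, Matrix.mulVec_zero, add_zero]
  change 0 + _ = _
  rw [zero_add]

theorem twistorD_add_smul (a : ℝ) (t t' : TangentSpace 𝓘(ℝ, E4) u)
    (hz : MDifferentiableAt 𝓘(ℝ, E4) 𝓘(ℝ, TwComp) z u) :
    S.twistorD D i z u (a • t + t') = a • S.twistorD D i z u t + S.twistorD D i z u t' := by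
  simp only [S.twistorD_eq hz, map_add, map_smul, LinearMap.add_apply, LinearMap.smul_apply,
    smul_add]
  abel

/-- A twistor derivative which vanishes along the tetrad vanishes. -/
theorem twistorD_eq_zero_of_tetrad (hu : u ∈ S.dom i)
    (hz : MDifferentiableAt 𝓘(ℝ, E4) 𝓘(ℝ, TwComp) z u)
    (h : ∀ k, S.twistorD D i z u (S.tetrad i k u) = 0) (t : TangentSpace 𝓘(ℝ, E4) u) :
    S.twistorD D i z u t = 0 := by
  have h0 : S.twistorD D i z u 0 = 0 := by
    rw [S.twistorD_eq hz]
    simp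
  rw [← S.sum_tetrad hu t]
  refine Finset.sum_induction _ (fun x ↦ S.twistorD D i z u x = 0) (fun x y hx hy ↦ ?_) h0
    fun k _ ↦ ?_
  · have := S.twistorD_add_smul (D := D) (i := i) 1 x y hz
    rwa [one_smul, one_smul, hx, hy, add_zero] at this
  · have := S.twistorD_add_smul (D := D) (i := i)
      (eta k * g.val u t (S.tetrad i k u)) (S.tetrad i k u) 0 hz
    rwa [add_zero, h, h0, smul_zero, add_zero] at this

variable (D i) in
/-- Near `u`, the components `z` in the spin frame `i` are those of a smooth local twistor field
which is constant under local twistor transport. -/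
def IsParallelNear (z : V → TwComp) (u : V) : Prop :=
  ∀ᶠ v in 𝓝 u, v ∈ S.dom i ∧ ContMDiffAt 𝓘(ℝ, E4) 𝓘(ℝ, TwComp) ∞ z v ∧
    ∀ t : TangentSpace 𝓘(ℝ, E4) v, S.twistorD D i z v t = 0

variable (D i) in
/-- Near `u`, the components `z` in the spin frame `i` are smooth, and the unprimed part of their
local twistor derivative vanishes. This is the twistor equation, together with the formula for the
primed part. -/
def IsTwistorNear (z : V → TwComp) (u : V) : Prop :=
  ∀ᶠ v in 𝓝 u, v ∈ S.dom i ∧ ContMDiffAt 𝓘(ℝ, E4) 𝓘(ℝ, TwComp) ∞ z v ∧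
    ∀ t : TangentSpace 𝓘(ℝ, E4) v, (S.twistorD D i z v t).1 = 0

variable {S}

theorem IsParallelNear.isTwistorNear (h : S.IsParallelNear D i z u) : S.IsTwistorNear D i z u :=
  h.mono fun v hv ↦ ⟨hv.1, hv.2.1, fun t ↦ by rw [hv.2.2 t]; rfl⟩

theorem IsTwistorNear.congr (h : S.IsTwistorNear D i z u) (hz : z' =ᶠ[𝓝 u] z) :
    S.IsTwistorNear D i z' u := by
  filter_upwards [h, hz.eventuallyEq_nhds] with v hv hzv
  exact ⟨hv.1, hv.2.1.congr_of_eventuallyEq hzv, fun t ↦ by rw [S.twistorD_congr hzv, hv.2.2 t]⟩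

/-- Where the local twistor curvature vanishes, the twistor equation implies that the primed part of
the local twistor derivative vanishes, too: if `(0, φ_k)` is the derivative along `e_k`, then the
unprimed part of the curvature is `σ_k φ_l - σ_l φ_k`, up to a factor. -/
theorem IsTwistorNear.isParallelNear [T2Space V] (hK : S.TwistorCurvatureVanishes D)
    (h : S.IsTwistorNear D i z u) : S.IsParallelNear D i z u := by
  filter_upwards [eventually_eventually_nhds.2 h] with u h
  obtain ⟨hu, hzu, -⟩ := h.self_of_nhds
  refine ⟨hu, hzu, S.twistorD_eq_zero_of_tetrad hu (hzu.mdifferentiableAt (by simp)) fun l ↦ ?_⟩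
  obtain ⟨s, hs, hso, hus⟩ := eventually_nhds_iff.1 h
  -- the curvature hypothesis concerns global smooth fields, so components and tetrad are extended
  -- from a neighbourhood of `u`
  obtain ⟨z', hz', hzz'⟩ := exists_contMDiff_eventuallyEq hso
    (fun v hv ↦ (hs v hv).2.1.contMDiffWithinAt) hus
  choose e he hee using fun k ↦
    (S.tetrad_smooth i k).exists_smoothField_eventuallyEq (S.dom i).isOpen hu
  have hD : ∀ k, ∀ᶠ v in 𝓝 u, S.twistorD D i z' v (e k v)
      = S.twistorD D i z v (S.tetrad i k v) := by
    intro k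
    filter_upwards [hee k, hzz'.eventuallyEq_nhds] with v hv hzv
    rw [hv, S.twistorD_congr hzv]
  have hD1 : ∀ k, ∀ᶠ v in 𝓝 u, (S.twistorD D i z' v (e k v)).1 = 0 := by
    intro k
    filter_upwards [hD k, hso.mem_nhds hus] with v hv hvs
    rw [hv, (hs v hvs).2.2]
  set c : Fin 4 → Fin 2 → ℂ := fun k ↦ (S.twistorD D i z u (S.tetrad i k u)).2 with hc
  have hcomm : ∀ k l, pauli k *ᵥ c l = pauli l *ᵥ c k := by
    intro k l
    have hKu := hK i (e k) (e l) z' (he k) (he l) hz' u hu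
    rw [twistorK] at hKu
    have h1 := congrArg Prod.fst ((smul_eq_zero.1 hKu).resolve_left Complex.I_ne_zero)
    rw [Prod.fst_sub, Prod.fst_sub, S.twistorD_congr hzz', (hs u hus).2.2, Prod.fst_zero, sub_zero,
      S.twistorD_fst_eq_zero (hD1 l), S.twistorD_fst_eq_zero (hD1 k), (hD l).self_of_nhds,
      (hD k).self_of_nhds, (hee k).self_of_nhds, (hee l).self_of_nhds, S.herm_tetrad hu,
      S.herm_tetrad hu, ← smul_sub, Matrix.smul_mulVec, Matrix.smul_mulVec, ← smul_sub] at h1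
    have h2 := (smul_eq_zero.1 h1).resolve_left Complex.I_ne_zero
    exact sub_eq_zero.1 ((smul_eq_zero.1 h2).resolve_left nrm_ne_zero)
  have hc0 := eq_zero_of_pauli_mulVec_comm hcomm
  ext1
  · exact (hs u hus).2.2 _
  · exact congrFun hc0 l

theorem trans_mul_trans (S : SpinStructure g ι) (hi : u ∈ S.dom i) (hj : u ∈ S.dom j) :
    S.trans i j u * S.trans j i u = 1 := by
  have h := S.trans_cocycle i i i u hi hi hi
  have hdet : IsUnit (S.trans i i u).det := by
    rw [S.trans_det i i u hi hi]
    exact isUnit_one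
  rw [S.trans_cocycle i j i u hi hj hi]
  exact (IsUnit.mul_eq_left ((Matrix.isUnit_iff_isUnit_det _).2 hdet)).1 h

variable (S i j) in
/-- The components in the spin frame `i` of the local twistor at `v` with components `z` in the spin
frame `j`. -/
noncomputable def frameChange (v : V) (z : TwComp) : TwComp :=
  (S.trans i j v *ᵥ z.1, (S.trans j i v)ᴴ *ᵥ z.2)

theorem contMDiffAt_frameChange (hi : u ∈ S.dom i) (hj : u ∈ S.dom j)
    (hz : ContMDiffAt 𝓘(ℝ, E4) 𝓘(ℝ, TwComp) ∞ z u) :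
    ContMDiffAt 𝓘(ℝ, E4) 𝓘(ℝ, TwComp) ∞ (fun v ↦ S.frameChange i j v (z v)) u := by
  have hij := fun A B ↦ (S.trans_smooth i j A B).contMDiffAt
    (((S.dom i).isOpen.inter (S.dom j).isOpen).mem_nhds ⟨hi, hj⟩)
  have hji := fun A B ↦ (S.trans_smooth j i A B).contMDiffAt
    (((S.dom j).isOpen.inter (S.dom i).isOpen).mem_nhds ⟨hj, hi⟩)
  exact (contMDiffAt_matrix_mulVec hij (contMDiffAt_fst hz)).prodMk_space
    (contMDiffAt_matrix_mulVec (fun A B ↦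
      Complex.conjCLE.toContinuousLinearMap.contMDiff.contMDiffAt.comp u (hji B A)) (contMDiffAt_snd hz))

/-- The twistor equation does not depend on the spin frame. -/
theorem IsTwistorNear.frameChange [T2Space V] (hD : IsMetricCompatible g D)
    (h : S.IsTwistorNear D j z u) (hi : u ∈ S.dom i) :
    S.IsTwistorNear D i (fun v ↦ S.frameChange i j v (z v)) u := by
  filter_upwards [h, (S.dom i).isOpen.mem_nhds hi] with u ⟨hj, hz, h⟩ hi
  refine ⟨hi, contMDiffAt_frameChange hi hj hz, fun t ↦ ?_⟩
  have hz1 : MDifferentiableAt 𝓘(ℝ, E4) 𝓘(ℝ, Fin 2 → ℂ) (fun v ↦ (z v).1) u :=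
    (contMDiffAt_fst hz).mdifferentiableAt (by simp)
  have key : (S.twistorD D i (fun v ↦ S.frameChange i j v (z v)) u t).1
      = S.trans i j u *ᵥ (S.twistorD D j z u t).1 := by
    simp only [twistorD, spinD, SpinStructure.frameChange]
    rw [mvfderiv_mulVec (S.matDiffAt_trans hi hj) hz1, S.herm_conjugate hi hj]
    have hinv : (S.trans i j u)ᴴ * (S.trans j i u)ᴴ = 1 := by
      rw [← Matrix.conjTranspose_mul, S.trans_mul_trans hj hi, Matrix.conjTranspose_one]
    simp only [Matrix.mulVec_add, Matrix.mulVec_smul, Matrix.mulVec_mulVec]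
    rw [← S.dmat_trans hD hi hj, Matrix.mul_assoc _ _ (S.trans j i u)ᴴ, hinv, Matrix.mul_one,
      Matrix.add_mulVec]
    abel
  rw [key, h t, Matrix.mulVec_zero]

end SpinStructure

end NTwistor

/-! ### Regularity and uniqueness for total linear differential equations -/

section LinearPDE

open Set Filter
open scoped Topology

variable {E A F : Type*} [NormedAddCommGroup E] [NormedSpace ℝ E]
  [NormedRing A] [NormedAlgebra ℝ A] [NormedAddCommGroup F] [NormedSpace ℝ F]

theorem HasFDerivAt.apply_apply {b : E → E →L[ℝ] F →L[ℝ] F} {b' : E →L[ℝ] E →L[ℝ] F →L[ℝ] F}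
    {x : E} (hb : HasFDerivAt b b' x) (e : E) (z : F) :
    ∃ L : E →L[ℝ] F, HasFDerivAt (fun y ↦ b y e z) L x ∧ ∀ c, L c = b' c e z :=
  ⟨_, (hb.clm_apply (hasFDerivAt_const e x)).clm_apply (hasFDerivAt_const z x), fun c ↦ by simp⟩

theorem contDiffOn_of_hasFDerivAt_mul {b : E → E →L[ℝ] A} {Φ : E → A} {s : Set E} (hs : IsOpen s)
    (hb : ContDiffOn ℝ ∞ b s)
    (hΦ : ∀ x ∈ s, ∃ Φ' : E →L[ℝ] A, HasFDerivAt Φ Φ' x ∧ ∀ v, Φ' v = -(b x v * Φ x)) :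
    ContDiffOn ℝ ∞ Φ s := by
  have hd : ∀ x ∈ s, fderiv ℝ Φ x
      = (-((ContinuousLinearMap.mul ℝ A).flip (Φ x))).comp (b x) := by
    intro x hx
    obtain ⟨Φ', h, h'⟩ := hΦ x hx
    ext v
    rw [h.fderiv, h']
    simp
  rw [contDiffOn_infty]
  intro n
  induction n with
  | zero =>
    rw [Nat.cast_zero, contDiffOn_zero]
    intro x hx
    obtain ⟨Φ', h, -⟩ := hΦ x hx
    exact h.continuousAt.continuousWithinAt
  | succ n ih =>
    have h1 : ContDiffOn ℝ n (fderiv ℝ Φ) s := by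
      refine ContDiffOn.congr ?_ hd
      refine ContDiffOn.clm_comp ?_ (hb.of_le (by exact_mod_cast le_top))
      exact ((ContinuousLinearMap.mul ℝ A).flip.contDiff.comp_contDiffOn ih).neg
    rw [Nat.cast_add, Nat.cast_one, contDiffOn_succ_iff_fderiv_of_isOpen hs]
    refine ⟨fun x hx ↦ ?_, by simp, h1⟩
    obtain ⟨Φ', h, -⟩ := hΦ x hx
    exact h.differentiableAt.differentiableWithinAt

/-- A solution of a total linear differential equation which vanishes at a point vanishes near that
point, by Grönwall's inequality along rays. -/
theorem eventually_eq_zero_of_total_linear {b : E → E →L[ℝ] F →L[ℝ] F} {W : E → F} {x₀ : E}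
    (hb : ContinuousAt b x₀)
    (hW : ∀ᶠ x in 𝓝 x₀, ∃ W' : E →L[ℝ] F, HasFDerivAt W W' x ∧ ∀ v, W' v = -(b x v (W x)))
    (h0 : W x₀ = 0) : ∀ᶠ x in 𝓝 x₀, W x = 0 := by
  have hbd : ∀ᶠ x in 𝓝 x₀, ‖b x‖ < ‖b x₀‖ + 1 := by
    have hc : ContinuousAt (fun x ↦ ‖b x‖) x₀ :=
      (continuous_norm (E := E →L[ℝ] F →L[ℝ] F)).continuousAt.comp hb
    exact hc.eventually (gt_mem_nhds (lt_add_one ‖b x₀‖))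
  obtain ⟨r, hr, h⟩ := Metric.eventually_nhds_iff_ball.1 (hW.and hbd)
  filter_upwards [Metric.ball_mem_nhds x₀ hr] with x hx
  have hseg : ∀ t ∈ Icc (0 : ℝ) 1, x₀ + t • (x - x₀) ∈ Metric.ball x₀ r := by
    intro t ht
    exact (convex_ball x₀ r).add_smul_sub_mem (Metric.mem_ball_self hr) hx ht
  choose! W' hW' hWb using fun y (hy : y ∈ Metric.ball x₀ r) ↦ (h y hy).1
  have hline : ∀ t : ℝ, HasDerivAt (fun t : ℝ ↦ x₀ + t • (x - x₀)) (x - x₀) t := fun t ↦ by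
    simpa using ((hasDerivAt_id t).smul_const (x - x₀)).const_add x₀
  have hder : ∀ t ∈ Icc (0 : ℝ) 1, HasDerivAt (fun t : ℝ ↦ W (x₀ + t • (x - x₀)))
      (W' (x₀ + t • (x - x₀)) (x - x₀)) t := fun t ht ↦
    (hW' _ (hseg t ht)).comp_hasDerivAt t (hline t)
  have := eq_zero_of_abs_deriv_le_mul_abs_self_of_eq_zero_right
    (f := fun t : ℝ ↦ W (x₀ + t • (x - x₀))) (a := 0) (b := 1)
    (K := (‖b x₀‖ + 1) * ‖x - x₀‖)
    (fun t ht ↦ (hder t ht).continuousAt.continuousWithinAt)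
    (fun t ht ↦ (hder t (Ico_subset_Icc_self ht)).hasDerivWithinAt) (by simpa using h0)
    (fun t ht ↦ by
      have hy := hseg t (Ico_subset_Icc_self ht)
      rw [hWb _ hy, norm_neg]
      refine ((b _ _).le_opNorm _).trans ?_
      gcongr
      exact ((b _).le_opNorm _).trans (by gcongr; exact (h _ hy).2.le))
    1 (by simp)
  simpa using this

end LinearPDE

/-! ### Local frames of parallel twistors -/

namespace NTwistor

open Set Filter
open scoped Topology

section Chart

variable {V : Type*} [TopologicalSpace V] [ChartedSpace E4 V] [IsManifold 𝓘(ℝ, E4) ∞ V]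
  {F : Type*} [NormedAddCommGroup F] [NormedSpace ℝ F] {u₀ u : V}

theorem hasMFDerivAt_comp_extChartAt {W : E4 → F} {W' : E4 →L[ℝ] F}
    (hu : u ∈ (chartAt E4 u₀).source)
    (hW : HasFDerivAt W W' (extChartAt 𝓘(ℝ, E4) u₀ u)) :
    HasMFDerivAt 𝓘(ℝ, E4) 𝓘(ℝ, F) (fun v ↦ W (extChartAt 𝓘(ℝ, E4) u₀ v)) u
      (W'.comp (mfderiv 𝓘(ℝ, E4) 𝓘(ℝ, E4) (extChartAt 𝓘(ℝ, E4) u₀) u)) :=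
  HasMFDerivAt.comp u hW.hasMFDerivAt (mdifferentiableAt_extChartAt hu).hasMFDerivAt

theorem mvfderiv_comp_extChartAt {W : E4 → F} {W' : E4 →L[ℝ] F}
    (hu : u ∈ (chartAt E4 u₀).source)
    (hW : HasFDerivAt W W' (extChartAt 𝓘(ℝ, E4) u₀ u)) (t : TangentSpace 𝓘(ℝ, E4) u) :
    mvfderiv 𝓘(ℝ, E4) (fun v ↦ W (extChartAt 𝓘(ℝ, E4) u₀ v)) u t
      = W' (mfderiv 𝓘(ℝ, E4) 𝓘(ℝ, E4) (extChartAt 𝓘(ℝ, E4) u₀) u t) :=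
  congrArg (fun A ↦ A t) (hasMFDerivAt_comp_extChartAt hu hW).mfderiv

/-- The derivative of the coordinate representation of a function. -/
theorem hasFDerivAt_comp_extChartAt_symm {z : V → F} (hu : u ∈ (chartAt E4 u₀).source)
    (hz : MDifferentiableAt 𝓘(ℝ, E4) 𝓘(ℝ, F) z u) :
    ∃ W' : E4 →L[ℝ] F, HasFDerivAt (fun x ↦ z ((extChartAt 𝓘(ℝ, E4) u₀).symm x)) W'
      (extChartAt 𝓘(ℝ, E4) u₀ u) ∧ ∀ c, W' c = mvfderiv 𝓘(ℝ, E4) z u (coordField u₀ c u) := by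
  have hus : u ∈ (extChartAt 𝓘(ℝ, E4) u₀).source := by rwa [extChartAt_source]
  set φ := extChartAt 𝓘(ℝ, E4) u₀ with hφ
  have hsymm : MDifferentiableAt 𝓘(ℝ, E4) 𝓘(ℝ, E4) φ.symm (φ u) :=
    ((contMDiffOn_extChartAt_symm (I := 𝓘(ℝ, E4)) (n := ∞) u₀).contMDiffAt
      (extChartAt_target_mem_nhds' (φ.map_source hus))).mdifferentiableAt (by simp)
  have hd : MDifferentiableAt 𝓘(ℝ, E4) 𝓘(ℝ, F) (fun x ↦ z (φ.symm x)) (φ u) := by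
    refine MDifferentiableAt.comp (φ u) ?_ hsymm
    rwa [φ.left_inv hus]
  have hd' := hd.differentiableAt.hasFDerivAt
  refine ⟨_, hd', fun c ↦ ?_⟩
  have hcg : z =ᶠ[𝓝 u] fun v ↦ z (φ.symm (φ v)) := by
    filter_upwards [(chartAt E4 u₀).open_source.mem_nhds hu] with v hv
    rw [φ.left_inv (by rwa [hφ, extChartAt_source])]
  rw [mvfderiv_congr hcg]
  have h := mvfderiv_comp_extChartAt hu hd' (coordField u₀ c u)
  rw [mfderiv_extChartAt_coordField u₀ c hu] at h
  exact h.symm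

end Chart

namespace SpinStructure

variable {V : Type*} [TopologicalSpace V] [ChartedSpace E4 V] [IsManifold 𝓘(ℝ, E4) ∞ V]
  {g : Metric V} {ι : Type*} (S : SpinStructure g ι) {D : LinConn V} {i : ι} {u u₀ : V}

section Smooth

variable [T2Space V] (hD : CovariantDerivative.ContMDiffCovariantDerivative D ∞)
include hD

theorem contMDiffAt_ricci (hu : u ∈ S.dom i) (l m : Fin 4) :
    ContMDiffAt 𝓘(ℝ, E4) 𝓘(ℝ, ℝ) ∞ (fun v ↦ S.ricci D i v l m) u := by
  simp only [ricci]
  refine contMDiffAt_finsetSum fun k _ ↦ contMDiffAt_const.mul ?_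
  exact (SmoothFieldOn.contMDiffOn_metric g
    ((S.tetrad_smooth i k).curv hD (S.dom i).isOpen (S.tetrad_smooth i m) (S.tetrad_smooth i l))
    (S.tetrad_smooth i k)).contMDiffAt ((S.dom i).isOpen.mem_nhds hu)

theorem contMDiffAt_schouten (hu : u ∈ S.dom i) (l m : Fin 4) :
    ContMDiffAt 𝓘(ℝ, E4) 𝓘(ℝ, ℝ) ∞ (fun v ↦ S.schouten D i v l m) u := by
  simp only [schouten, scalarCurv]
  refine contMDiffAt_const.mul ((S.contMDiffAt_ricci hD hu l m).sub ?_)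
  refine (contMDiffAt_const.mul ?_).mul ?_
  · exact contMDiffAt_finsetSum fun k _ ↦ contMDiffAt_const.mul (S.contMDiffAt_ricci hD hu k k)
  · exact (SmoothFieldOn.contMDiffOn_metric g (S.tetrad_smooth i l)
      (S.tetrad_smooth i m)).contMDiffAt ((S.dom i).isOpen.mem_nhds hu)

theorem contMDiffAt_twistorForm {X : VField V} {s : Set V} (hs : IsOpen s)
    (hsi : s ⊆ S.dom i) (hX : SmoothFieldOn X s) (hu : u ∈ s) (z : TwComp) :
    ContMDiffAt 𝓘(ℝ, E4) 𝓘(ℝ, TwComp) ∞ (fun v ↦ S.twistorForm D i v (X v) z) u := by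
  have he := fun k ↦ (S.tetrad_smooth i k).mono hsi
  have hA : ∀ A B, ContMDiffAt 𝓘(ℝ, E4) 𝓘(ℝ, ℂ) ∞ (fun v ↦ S.spinConn D i v (X v) A B) u :=
    fun A B ↦ (spinMatrixEntry A B).contMDiff.contMDiffAt.comp u <|
      contMDiffAt_pi_space.2 fun k ↦ contMDiffAt_pi_space.2 fun l ↦
        ((hX.covariantDerivative hD hs (he k)).contMDiffOn_metric g (he l)).contMDiffAt
          (hs.mem_nhds hu)
  have hr : ∀ k, ContMDiffAt 𝓘(ℝ, E4) 𝓘(ℝ, ℝ) ∞ (fun v ↦ g.val v (X v) (S.tetrad i k v)) u :=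
    fun k ↦ (hX.contMDiffOn_metric g (he k)).contMDiffAt (hs.mem_nhds hu)
  have hH : ∀ A B, ContMDiffAt 𝓘(ℝ, E4) 𝓘(ℝ, ℂ) ∞ (fun v ↦ S.herm i v (X v) A B) u :=
    fun A B ↦ (vecMatrixEntry A B).contMDiff.contMDiffAt.comp u <| contMDiffAt_pi_space.2 hr
  have hP : ∀ A B, ContMDiffAt 𝓘(ℝ, E4) 𝓘(ℝ, ℂ) ∞ (fun v ↦ S.schoutenSpin D i v (X v) A B) u := by
    intro A B
    simp only [schoutenSpin_eq_vecMatrix]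
    refine (vecMatrixEntry A B).contMDiff.contMDiffAt.comp u <| contMDiffAt_pi_space.2 fun m ↦ ?_
    exact contMDiffAt_const.mul <| contMDiffAt_finsetSum fun l _ ↦
      (contMDiffAt_const.mul (hr l)).mul (S.contMDiffAt_schouten hD (hsi hu) l m)
  have hAH : ∀ A B, ContMDiffAt 𝓘(ℝ, E4) 𝓘(ℝ, ℂ) ∞ (fun v ↦ (S.spinConn D i v (X v))ᴴ A B) u :=
    fun A B ↦ Complex.conjCLE.toContinuousLinearMap.contMDiff.contMDiffAt.comp u (hA B A)
  have hI : ∀ w : V → Fin 2 → ℂ, ContMDiffAt 𝓘(ℝ, E4) 𝓘(ℝ, Fin 2 → ℂ) ∞ w u →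
      ContMDiffAt 𝓘(ℝ, E4) 𝓘(ℝ, Fin 2 → ℂ) ∞ (fun v ↦ Complex.I • w v) u := fun w hw ↦
    (contDiff_const_smul Complex.I).contMDiff.contMDiffAt.comp u hw
  exact ((contMDiffAt_matrix_mulVec hA contMDiffAt_const).add
    (hI _ (contMDiffAt_matrix_mulVec hH contMDiffAt_const))).prodMk_space
    ((contMDiffAt_matrix_mulVec hAH contMDiffAt_const).neg.add
    (hI _ (contMDiffAt_matrix_mulVec hP contMDiffAt_const)))

end Smooth

variable (D i u₀) in
/-- The connection form of local twistor transport in coordinates around `u₀`. -/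
noncomputable def coordForm (v : V) : E4 →L[ℝ] TwComp →L[ℝ] TwComp :=
  LinearMap.toContinuousLinearMap
    ((LinearMap.toContinuousLinearMap (𝕜 := ℝ) (E := TwComp) (F' := TwComp)).toLinearMap ∘ₗ
      S.twistorForm D i v ∘ₗ
      (mfderiv 𝓘(ℝ, E4) 𝓘(ℝ, E4) (extChartAt 𝓘(ℝ, E4) u₀) v).inverse.toLinearMap)

theorem coordForm_apply (v : V) (c : E4) (z : TwComp) :
    S.coordForm D i u₀ v c z = S.twistorForm D i v (coordField u₀ c v) z := rfl

theorem coordForm_mfderiv (hu : u ∈ (chartAt E4 u₀).source) (t : TangentSpace 𝓘(ℝ, E4) u)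
    (z : TwComp) :
    S.coordForm D i u₀ u (mfderiv 𝓘(ℝ, E4) 𝓘(ℝ, E4) (extChartAt 𝓘(ℝ, E4) u₀) u t) z
      = S.twistorForm D i u t z :=
  congrArg (fun x ↦ S.twistorForm D i u x z) (coordField_mfderiv_extChartAt u₀ hu t)

variable [T2Space V]

theorem exists_contDiffOn_coordForm
    (hD : CovariantDerivative.ContMDiffCovariantDerivative D ∞) (hu₀ : u₀ ∈ S.dom i) :
    ∃ s : Set E4, IsOpen s ∧ extChartAt 𝓘(ℝ, E4) u₀ u₀ ∈ s ∧
      (∀ x ∈ s, ∃ v ∈ (chartAt E4 u₀).source, v ∈ S.dom i ∧ extChartAt 𝓘(ℝ, E4) u₀ v = x) ∧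
      ContDiffOn ℝ ∞ (fun x ↦ S.coordForm D i u₀ ((extChartAt 𝓘(ℝ, E4) u₀).symm x)) s := by
  set φ := extChartAt 𝓘(ℝ, E4) u₀ with hφ
  refine ⟨φ.target ∩ φ.symm ⁻¹' (S.dom i), ?_, ?_, ?_, ?_⟩
  · exact (continuousOn_extChartAt_symm u₀).isOpen_inter_preimage (isOpen_extChartAt_target u₀)
      (S.dom i).isOpen
  · refine ⟨mem_extChartAt_target u₀, ?_⟩
    rw [mem_preimage, φ.left_inv (mem_extChartAt_source u₀)]
    exact hu₀
  · rintro x ⟨hx, hxi⟩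
    refine ⟨φ.symm x, ?_, hxi, φ.right_inv hx⟩
    have := φ.map_target hx
    rwa [hφ, extChartAt_source] at this
  · rw [contDiffOn_clm_apply]
    intro c
    rw [contDiffOn_clm_apply]
    intro z
    have h : ContMDiffOn 𝓘(ℝ, E4) 𝓘(ℝ, TwComp) ∞
        (fun v ↦ S.twistorForm D i v (coordField u₀ c v) z)
        ((chartAt E4 u₀).source ∩ S.dom i) := fun v hv ↦
      (S.contMDiffAt_twistorForm hD ((chartAt E4 u₀).open_source.inter (S.dom i).isOpen)
        inter_subset_right ((smoothFieldOn_coordField u₀ c).mono inter_subset_left) hv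
        z).contMDiffWithinAt
    have hmaps : MapsTo φ.symm (φ.target ∩ φ.symm ⁻¹' (S.dom i))
        ((chartAt E4 u₀).source ∩ S.dom i) := by
      rintro x ⟨hx, hxi⟩
      refine ⟨?_, hxi⟩
      have := φ.map_target hx
      rwa [hφ, extChartAt_source] at this
    have hsymm : ContMDiffOn 𝓘(ℝ, E4) 𝓘(ℝ, E4) ∞ φ.symm (φ.target ∩ φ.symm ⁻¹' (S.dom i)) :=
      (contMDiffOn_extChartAt_symm u₀).mono inter_subset_left
    have hcomp := ContMDiffOn.comp h hsymm hmaps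
    exact contMDiffOn_iff_contDiffOn.1 hcomp

/-- The vanishing of the local twistor curvature, in coordinates. -/
theorem flat_coordForm (hK : S.TwistorCurvatureVanishes D)
    (hus : u ∈ (chartAt E4 u₀).source) (hu : u ∈ S.dom i)
    (hb : DifferentiableAt ℝ
      (fun x ↦ S.coordForm D i u₀ ((extChartAt 𝓘(ℝ, E4) u₀).symm x)) (extChartAt 𝓘(ℝ, E4) u₀ u))
    (c d : E4) :
    fderiv ℝ (fun x ↦ S.coordForm D i u₀ ((extChartAt 𝓘(ℝ, E4) u₀).symm x))
        (extChartAt 𝓘(ℝ, E4) u₀ u) c d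
      - fderiv ℝ (fun x ↦ S.coordForm D i u₀ ((extChartAt 𝓘(ℝ, E4) u₀).symm x))
        (extChartAt 𝓘(ℝ, E4) u₀ u) d c
      + (S.coordForm D i u₀ u c * S.coordForm D i u₀ u d
        - S.coordForm D i u₀ u d * S.coordForm D i u₀ u c) = 0 := by
  refine ContinuousLinearMap.ext fun z ↦ ?_
  obtain ⟨X, hX, hXc⟩ := exists_smoothField_eventuallyEq_coordField u₀ c hus
  obtain ⟨Y, hY, hYd⟩ := exists_smoothField_eventuallyEq_coordField u₀ d hus
  set φ := extChartAt 𝓘(ℝ, E4) u₀ with hφ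
  set b : E4 → E4 →L[ℝ] TwComp →L[ℝ] TwComp := fun x ↦ S.coordForm D i u₀ (φ.symm x) with hbdef
  have hinner : ∀ {W : VField V} {e : E4}, (∀ᶠ v in 𝓝 u, W v = coordField u₀ e v) →
      (fun v ↦ S.twistorD D i (fun _ ↦ z) v (W v)) =ᶠ[𝓝 u] fun v ↦ b (φ v) e z := by
    intro W e hW
    filter_upwards [hW, (chartAt E4 u₀).open_source.mem_nhds hus] with v hv hvs
    rw [S.twistorD_eq mdifferentiableAt_const, mvfderiv_const, hv, hbdef]
    simp only
    rw [hφ, (extChartAt 𝓘(ℝ, E4) u₀).left_inv (by rwa [extChartAt_source]), coordForm_apply]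
    exact zero_add _
  have hbu : b (φ u) = S.coordForm D i u₀ u := by
    rw [hbdef]
    simp only
    rw [hφ, (extChartAt 𝓘(ℝ, E4) u₀).left_inv (by rwa [extChartAt_source])]
  have houter : ∀ {W : VField V} {e : E4} (c : E4), (∀ᶠ v in 𝓝 u, W v = coordField u₀ e v) →
      S.twistorD D i (fun v ↦ S.twistorD D i (fun _ ↦ z) v (W v)) u (coordField u₀ c u)
        = fderiv ℝ b (φ u) c e z + b (φ u) c (b (φ u) e z) := by
    intro W e c hW
    obtain ⟨L, hder, hL⟩ := hb.hasFDerivAt.apply_apply e z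
    rw [S.twistorD_congr (hinner hW), S.twistorD_eq
      (hasMFDerivAt_comp_extChartAt hus hder).mdifferentiableAt,
      mvfderiv_comp_extChartAt hus hder, mfderiv_extChartAt_coordField u₀ c hus, hL, hbu,
      coordForm_apply (v := u) (c := c)]
  -- the curvature on constant components, along coordinate fields with vanishing bracket
  have hKu := hK i X Y (fun _ ↦ z) hX hY contMDiff_const u hu
  rw [twistorK] at hKu
  have h1 := (smul_eq_zero.1 hKu).resolve_left Complex.I_ne_zero
  rw [hXc.self_of_nhds, hYd.self_of_nhds, houter c hYd, houter d hXc,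
    Filter.EventuallyEq.mlieBracket_vectorField_eq hXc hYd, mlieBracket_coordField u₀ c d hus,
    S.twistorD_eq mdifferentiableAt_const, map_zero, map_zero, LinearMap.zero_apply, add_zero,
    sub_zero, hbu] at h1
  refine Eq.trans ?_ h1
  change fderiv ℝ b (φ u) c d z - fderiv ℝ b (φ u) d c z
    + (S.coordForm D i u₀ u c (S.coordForm D i u₀ u d z)
      - S.coordForm D i u₀ u d (S.coordForm D i u₀ u c z)) = _
  abel

/-- Around every point there is a frame of parallel local twistors, given by a gauge in which the
flat connection form vanishes. -/
theorem exists_parallel_frame (hD : CovariantDerivative.ContMDiffCovariantDerivative D ∞)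
    (hK : S.TwistorCurvatureVanishes D) (hu₀ : u₀ ∈ S.dom i) :
    ∃ Ψ : V → TwComp →L[ℝ] TwComp, ∀ᶠ v in 𝓝 u₀, v ∈ S.dom i ∧ IsUnit (Ψ v) ∧
      ∀ c, ContMDiffAt 𝓘(ℝ, E4) 𝓘(ℝ, TwComp) ∞ (fun v ↦ Ψ v c) v ∧
        ∀ t : TangentSpace 𝓘(ℝ, E4) v, S.twistorD D i (fun v ↦ Ψ v c) v t = 0 := by
  obtain ⟨s, hs, hu₀s, hsv, hb⟩ := S.exists_contDiffOn_coordForm hD hu₀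
  set φ := extChartAt 𝓘(ℝ, E4) u₀ with hφ
  set b : E4 → E4 →L[ℝ] TwComp →L[ℝ] TwComp := fun x ↦ S.coordForm D i u₀ (φ.symm x) with hbdef
  have hφu : ∀ v ∈ (chartAt E4 u₀).source, φ.symm (φ v) = v := fun v hv ↦
    φ.left_inv (by rwa [hφ, extChartAt_source])
  obtain ⟨Φ, hΦ1, hΦ⟩ := exists_gauge_of_flat (b := b) (x₀ := φ u₀)
    ((hb.contDiffAt (hs.mem_nhds hu₀s)).of_le ENat.LEInfty.out) (by
      filter_upwards [hs.mem_nhds hu₀s] with x hx c d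
      obtain ⟨v, hv, hvi, rfl⟩ := hsv x hx
      have := S.flat_coordForm hK hv hvi
        ((hb.contDiffAt (hs.mem_nhds hx)).differentiableAt (by simp)) c d
      have hbv : b (φ v) = S.coordForm D i u₀ v := by
        rw [hbdef]
        simp only
        rw [hφu v hv]
      rw [hbv]
      exact this)
  obtain ⟨r, hr, hro, hur⟩ := eventually_nhds_iff.1 (hΦ.and (hs.mem_nhds hu₀s))
  have hΦs : ContDiffOn ℝ ∞ Φ r := contDiffOn_of_hasFDerivAt_mul hro
    (hb.mono fun x hx ↦ (hr x hx).2) fun x hx ↦ (hr x hx).1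
  have hunit : ∀ᶠ x in 𝓝 (φ u₀), IsUnit (Φ x) :=
    (hΦs.continuousOn.continuousAt (hro.mem_nhds hur)).eventually
      (Units.isOpen.mem_nhds (by rw [mem_ofPred_eq, hΦ1]; exact isUnit_one))
  have hcont : ContinuousAt φ u₀ := continuousAt_extChartAt u₀
  refine ⟨fun v ↦ Φ (φ v), ?_⟩
  filter_upwards [hcont.eventually hunit, hcont.eventually (hro.mem_nhds hur),
    (chartAt E4 u₀).open_source.mem_nhds (mem_chart_source E4 u₀),
    (S.dom i).isOpen.mem_nhds hu₀] with v hvu hvr hvs hvi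
  refine ⟨hvi, hvu, fun c ↦ ⟨?_, fun t ↦ ?_⟩⟩
  · have h1 : ContDiffAt ℝ ∞ (fun x ↦ Φ x c) (φ v) :=
      (hΦs.contDiffAt (hro.mem_nhds hvr)).clm_apply contDiffAt_const
    exact h1.contMDiffAt.comp v (contMDiffAt_extChartAt' hvs)
  · obtain ⟨Φ', hΦ', hΦb⟩ := (hr _ hvr).1
    have hder : HasFDerivAt (fun x ↦ Φ x c)
        ((ContinuousLinearMap.apply ℝ TwComp c).comp Φ') (φ v) :=
      (ContinuousLinearMap.apply ℝ TwComp c).hasFDerivAt.comp (φ v) hΦ'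
    rw [S.twistorD_eq (hasMFDerivAt_comp_extChartAt hvs hder).mdifferentiableAt,
      mvfderiv_comp_extChartAt hvs hder, ← S.coordForm_mfderiv hvs]
    have hbv : b (φ v) = S.coordForm D i u₀ v := by
      rw [hbdef]
      simp only
      rw [hφu v hvs]
    rw [hbv] at hΦb
    refine (congrArg (· + _) (congrArg (fun T : TwComp →L[ℝ] TwComp ↦ T c) (hΦb _))).trans ?_
    exact neg_add_cancel _

variable {S}

/-- Parallel local twistors which agree at a point agree near that point. -/
theorem IsParallelNear.eventually_eq
    (hD : CovariantDerivative.ContMDiffCovariantDerivative D ∞) {z z' : V → TwComp}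
    (h : S.IsParallelNear D i z u) (h' : S.IsParallelNear D i z' u) (hu : z u = z' u) :
    z =ᶠ[𝓝 u] z' := by
  obtain ⟨s, hs, hus, hsv, hb⟩ := S.exists_contDiffOn_coordForm hD h.self_of_nhds.1
  set φ := extChartAt 𝓘(ℝ, E4) u with hφ
  have hφu : ∀ v ∈ (chartAt E4 u).source, φ.symm (φ v) = v := fun v hv ↦
    φ.left_inv (by rwa [hφ, extChartAt_source])
  have hsymm : ContinuousAt φ.symm (φ u) := continuousAt_extChartAt_symm u
  have huu : φ.symm (φ u) = u := hφu u (mem_chart_source E4 u)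
  have hev : ∀ᶠ x in 𝓝 (φ u), _ := hsymm.eventually (by rw [huu]; exact h.and h')
  have hz := eventually_eq_zero_of_total_linear
    (W := fun x ↦ z (φ.symm x) - z' (φ.symm x)) (x₀ := φ u)
    (hb.continuousOn.continuousAt (hs.mem_nhds hus)) (by
      filter_upwards [hev, hs.mem_nhds hus] with x hx hxs
      obtain ⟨v, hv, hvi, rfl⟩ := hsv x hxs
      rw [hφu v hv] at hx
      have m1 := hx.1.2.1.mdifferentiableAt (n := ∞) (by simp)
      have m2 := hx.2.2.1.mdifferentiableAt (n := ∞) (by simp)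
      obtain ⟨W1, hW1, hW1c⟩ := hasFDerivAt_comp_extChartAt_symm hv m1
      obtain ⟨W2, hW2, hW2c⟩ := hasFDerivAt_comp_extChartAt_symm hv m2
      refine ⟨W1 - W2, hW1.sub hW2, fun c ↦ ?_⟩
      have e1 := hx.1.2.2 (coordField u c v)
      have e2 := hx.2.2.2 (coordField u c v)
      rw [S.twistorD_eq m1, ← hW1c, ← coordForm_apply] at e1
      rw [S.twistorD_eq m2, ← hW2c, ← coordForm_apply] at e2
      rw [hφu v hv, map_sub, _root_.sub_apply, eq_neg_of_add_eq_zero_left e1,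
        eq_neg_of_add_eq_zero_left e2]
      abel)
    (by rw [huu, hu, sub_self])
  filter_upwards [(continuousAt_extChartAt (I := 𝓘(ℝ, E4)) u).eventually hz,
    (chartAt E4 u).open_source.mem_nhds (mem_chart_source E4 u)] with v hv hvs
  rw [hφu v hvs] at hv
  exact sub_eq_zero.1 hv

end SpinStructure

end NTwistor

/-! ### The twistor equation as part of parallelism -/

namespace NTwistor

open Set Filter
open scoped Topology

/-- The components `D_{AA'} ω^B` of the covariant derivative with components `s k` along the
tetrad. -/
noncomputable def spinorGrad (s : Fin 4 → Fin 2 → ℂ) (A A' B : Fin 2) : ℂ :=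
  nrm * ∑ k, pauli k A' A * s k B

/-- The Pauli matrices being a basis, the covariant derivative is recovered from its spinor
components. -/
theorem eq_sum_spinorGrad (s : Fin 4 → Fin 2 → ℂ) (k : Fin 4) (B : Fin 2) :
    s k B = nrm * ∑ A, ∑ A', pauli k A A' * spinorGrad s A A' B := by
  have h : ∀ A A', pauli k A A' * spinorGrad s A A' B
      = nrm * ∑ l, pauli k A A' * pauli l A' A * s l B := by
    intro A A'
    rw [spinorGrad, mul_left_comm, Finset.mul_sum]
    simp only [mul_assoc]
  simp only [h, ← Finset.mul_sum]
  rw [← mul_assoc, nrm_mul_nrm]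
  have h2 : ∑ A, ∑ A', ∑ l, pauli k A A' * pauli l A' A * s l B
      = ∑ l, (∑ A, ∑ A', pauli k A A' * pauli l A' A) * s l B := by
    simp only [Finset.sum_mul]
    rw [Finset.sum_comm' (t' := Finset.univ) (s' := fun _ ↦ Finset.univ) (by simp)]
    simp only [Fin.sum_univ_two, Finset.sum_add_distrib]
    ring
  rw [h2]
  simp only [sum_sum_pauli_mul_pauli, ite_mul, zero_mul, Finset.sum_ite_eq, Finset.mem_univ,
    if_true]
  ring

/-- The derivative along the tetrad is `-i σ_k π / √2` if and only if the symmetrized spinor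
derivative vanishes and `π` is the trace part. -/
theorem forall_add_pauli_mulVec_eq_zero_iff (s : Fin 4 → Fin 2 → ℂ) (p : Fin 2 → ℂ) :
    (∀ k, s k + Complex.I • (nrm • (pauli k *ᵥ p)) = 0) ↔
      (∀ A' A B : Fin 2, (1 / 2 : ℂ) * ((∑ C, eps A C * spinorGrad s C A' B)
        + ∑ C, eps B C * spinorGrad s C A' A) = 0) ∧
      ∀ A' : Fin 2, p A' = (1 / 2 : ℂ) * Complex.I * ∑ A, spinorGrad s A A' A := by
  have hI := Complex.I_mul_I
  -- both sides say that the spinor derivative is pure trace with trace part given by `p`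
  trans ∀ A A' B, spinorGrad s A A' B = if A = B then -Complex.I * p A' else 0
  · constructor
    · intro h A A' B
      have hs : ∀ k, s k B = -Complex.I * nrm * ∑ C, pauli k B C * p C := fun k ↦ by
        have := congrFun (eq_neg_of_add_eq_zero_left (h k)) B
        rw [this]
        change -(Complex.I * (nrm * ∑ C, pauli k B C * p C)) = _
        ring
      have e : spinorGrad s A A' B
          = -Complex.I * (nrm * nrm) * ∑ C, (∑ k, pauli k A' A * pauli k B C) * p C := by
        simp only [spinorGrad, hs, Finset.mul_sum, Finset.sum_mul]
        rw [Finset.sum_comm]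
        refine Finset.sum_congr rfl fun C _ ↦ Finset.sum_congr rfl fun k _ ↦ by ring
      rw [e, nrm_mul_nrm]
      simp only [sum_pauli_mul_pauli]
      fin_cases A <;> fin_cases A' <;> fin_cases B <;> simp <;> ring
    · intro h k
      ext B
      have hn : nrm * (2 * nrm) = 1 := by linear_combination 2 * nrm_mul_nrm
      rw [Pi.add_apply, eq_sum_spinorGrad s k B]
      simp only [h]
      fin_cases B <;> simp [Fin.sum_univ_two] <;> ring
  · constructor
    · intro h
      refine ⟨fun A' A B ↦ ?_, fun A' ↦ ?_⟩
      · simp only [h]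
        fin_cases A <;> fin_cases B <;> simp [eps]
      · simp only [h, if_true, Fin.sum_univ_two]
        linear_combination p A' * hI
    · rintro ⟨h1, h2⟩ A A' B
      have e00 := h1 A' 0 0
      have e01 := h1 A' 0 1
      have e11 := h1 A' 1 1
      have e := h2 A'
      simp [eps, Fin.sum_univ_two] at e00 e01 e11 e
      rw [e]
      fin_cases A <;> fin_cases B <;> simp
      · linear_combination -(1 / 2) * e01
          + 1 / 2 * (spinorGrad s 0 A' 0 + spinorGrad s 1 A' 1) * hI
      · linear_combination e11
      · linear_combination e00
      · linear_combination 1 / 2 * e01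
          + 1 / 2 * (spinorGrad s 0 A' 0 + spinorGrad s 1 A' 1) * hI

namespace SpinStructure

variable {V : Type*} [TopologicalSpace V] [ChartedSpace E4 V] [IsManifold 𝓘(ℝ, E4) ∞ V]
  {g : Metric V} {ι : Type*} (S : SpinStructure g ι) {D D' : LinConn V} {i : ι} {u : V}
  {z : V → TwComp}

theorem spinDAA_eq_spinorGrad (D : LinConn V) (i : ι) (w : V → Fin 2 → ℂ) (u : V)
    (A A' B : Fin 2) : S.spinDAA D i w u A A' B
      = spinorGrad (fun k ↦ S.spinD D i w u (S.tetrad i k u)) A A' B := rfl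

/-- The unprimed part of the local twistor derivative vanishes if and only if the twistor equation
holds and the primed part is the divergence of the unprimed part. -/
theorem twistorD_fst_eq_zero_iff (hu : u ∈ S.dom i)
    (hz : MDifferentiableAt 𝓘(ℝ, E4) 𝓘(ℝ, TwComp) z u) :
    (∀ t : TangentSpace 𝓘(ℝ, E4) u, (S.twistorD D i z u t).1 = 0) ↔
      (∀ A' A B : Fin 2,
        (1 / 2 : ℂ) * ((∑ C, eps A C * S.spinDAA D i (fun v ↦ (z v).1) u C A' B)
          + ∑ C, eps B C * S.spinDAA D i (fun v ↦ (z v).1) u C A' A) = 0) ∧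
      ∀ A' : Fin 2, (z u).2 A' =
        (1 / 2 : ℂ) * Complex.I * ∑ A, S.spinDAA D i (fun v ↦ (z v).1) u A A' A := by
  simp only [spinDAA_eq_spinorGrad]
  rw [← forall_add_pauli_mulVec_eq_zero_iff]
  have hk : ∀ k, (S.twistorD D i z u (S.tetrad i k u)).1
      = S.spinD D i (fun v ↦ (z v).1) u (S.tetrad i k u)
        + Complex.I • (nrm • (pauli k *ᵥ (z u).2)) := by
    intro k
    rw [← Matrix.smul_mulVec, ← S.herm_tetrad hu]
    rfl
  simp only [← hk]
  refine ⟨fun h k ↦ h _, fun h t ↦ ?_⟩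
  have h0 : (S.twistorD D i z u 0).1 = 0 := by
    rw [S.twistorD_eq hz]
    simp
  rw [← S.sum_tetrad hu t]
  refine Finset.sum_induction _ (fun x ↦ (S.twistorD D i z u x).1 = 0) (fun x y hx hy ↦ ?_) h0
    fun k _ ↦ ?_
  · have := congrArg Prod.fst (S.twistorD_add_smul (D := D) (i := i) 1 x y hz)
    rwa [one_smul, one_smul, Prod.fst_add, hx, hy, add_zero] at this
  · have := congrArg Prod.fst (S.twistorD_add_smul (D := D) (i := i)
      (eta k * g.val u t (S.tetrad i k u)) (S.tetrad i k u) 0 hz)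
    rwa [add_zero, Prod.fst_add, Prod.smul_fst, h, h0, smul_zero, add_zero] at this

section Congr

variable (h : ∀ (Y : VField V) (u : V), MDifferentiableAt 𝓘(ℝ, E4) 𝓘(ℝ, E4).tangent
  (fun v ↦ (⟨v, Y v⟩ : TangentBundle 𝓘(ℝ, E4) V)) u → D Y u = D' Y u)
include h

theorem spinConn_congr (hu : u ∈ S.dom i) (t : TangentSpace 𝓘(ℝ, E4) u) :
    S.spinConn D i u t = S.spinConn D' i u t := by
  simp only [spinConn, h _ u ((S.tetrad_smooth i _).mdifferentiableAt (S.dom i).isOpen hu)]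

theorem spinDAA_congr (hu : u ∈ S.dom i) (w : V → Fin 2 → ℂ) (A A' B : Fin 2) :
    S.spinDAA D i w u A A' B = S.spinDAA D' i w u A A' B := by
  simp only [spinDAA, spinD, S.spinConn_congr h hu]

theorem twistorD_congr_linConn [T2Space V]
    (hD : CovariantDerivative.ContMDiffCovariantDerivative D ∞) (hu : u ∈ S.dom i)
    (t : TangentSpace 𝓘(ℝ, E4) u) : S.twistorD D i z u t = S.twistorD D' i z u t := by
  have hric : ∀ l m, S.ricci D i u l m = S.ricci D' i u l m := fun l m ↦ by
    simp only [ricci]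
    refine Finset.sum_congr rfl fun k _ ↦ ?_
    rw [curv_congr hD h (S.dom i).isOpen (S.tetrad_smooth i k) (S.tetrad_smooth i m)
      (S.tetrad_smooth i l) hu]
  have hP : ∀ l m, S.schouten D i u l m = S.schouten D' i u l m := fun l m ↦ by
    simp only [schouten, scalarCurv, hric]
  simp only [twistorD, spinD, cospinD, schoutenSpin, S.spinConn_congr h hu, hP]

end Congr

end SpinStructure

end NTwistor

/-! ### The space of global twistors -/

namespace NTwistor

open Set Filter
open scoped Topology

namespace SpinStructure

variable {V : Type*} [TopologicalSpace V] [ChartedSpace E4 V] [IsManifold 𝓘(ℝ, E4) ∞ V]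
  {g : Metric V} {ι : Type*} (S : SpinStructure g ι) {D : LinConn V} {i j : ι} {u : V}

theorem trans_self (hi : u ∈ S.dom i) : S.trans i i u = 1 := by
  rw [← S.trans_mul_trans hi hi, S.trans_cocycle i i i u hi hi hi]

/-- A local twistor at `u` is given by its components in any spin frame defined at `u`. -/
noncomputable def localTwistorEquiv (hi : u ∈ S.dom i) : S.LocalTwistor u ≃ₗ[ℂ] TwComp where
  toFun Z := Z.1 ⟨i, hi⟩
  map_add' _ _ := rfl
  map_smul' _ _ := rfl
  invFun c := ⟨fun j ↦ S.frameChange j i u c, fun j k ↦ by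
    simp only [frameChange, Matrix.mulVec_mulVec]
    rw [S.trans_cocycle j k i u j.2 k.2 hi, ← Matrix.conjTranspose_mul,
      S.trans_cocycle i j k u hi j.2 k.2]
    exact ⟨rfl, rfl⟩⟩
  left_inv Z := by
    ext1
    funext j
    exact Prod.ext (Z.2 j ⟨i, hi⟩).1.symm (Z.2 ⟨i, hi⟩ j).2.symm
  right_inv c := by
    simp only [frameChange, S.trans_self hi, Matrix.conjTranspose_one, Matrix.one_mulVec]

theorem localTwistorEquiv_symm_apply (hi : u ∈ S.dom i) (hj : u ∈ S.dom j) (c : TwComp) :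
    S.localTwistorEquiv hi ((S.localTwistorEquiv hj).symm c) = S.frameChange i j u c := rfl

theorem finrank_localTwistor (u : V) : Module.finrank ℂ (S.LocalTwistor u) = 4 := by
  obtain ⟨i, hi⟩ := S.covers u
  rw [(S.localTwistorEquiv hi).finrank_eq]
  simp

variable {S} {U : Opens V} {Z Z' : S.TwField U}

theorem TwField.comp_of_mem (Z : S.TwField U) (hU : u ∈ U) (hi : u ∈ S.dom i) :
    Z.comp i u = S.localTwistorEquiv hi (Z ⟨u, hU⟩) :=
  dif_pos ⟨hU, hi⟩

theorem TwField.comp_add (Z Z' : S.TwField U) (i : ι) :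
    (Z + Z').comp i = fun v ↦ Z.comp i v + Z'.comp i v := by
  funext v
  simp only [TwField.comp]
  split_ifs
  · rfl
  · rw [add_zero]

theorem TwField.comp_smul (c : ℂ) (Z : S.TwField U) (i : ι) :
    (c • Z).comp i = fun v ↦ c • Z.comp i v := by
  funext v
  simp only [TwField.comp]
  split_ifs
  · rfl
  · rw [smul_zero]

theorem TwField.comp_zero (i : ι) : (0 : S.TwField U).comp i = fun _ ↦ 0 := by
  funext v
  simp only [TwField.comp]
  split_ifs
  · rfl
  · rfl

theorem TwField.contMDiffAt_comp (hZ : Z.IsSmooth) (hU : u ∈ U) (hi : u ∈ S.dom i) :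
    ContMDiffAt 𝓘(ℝ, E4) 𝓘(ℝ, TwComp) ∞ (Z.comp i) u :=
  (hZ i).contMDiffAt ((U.isOpen.inter (S.dom i).isOpen).mem_nhds ⟨hU, hi⟩)

theorem TwField.isParallel_iff :
    Z.IsParallel D ↔ ∀ i, ∀ u ∈ U, u ∈ S.dom i → S.IsParallelNear D i (Z.comp i) u := by
  constructor
  · rintro ⟨hs, h⟩ i u hU hi
    filter_upwards [(U.isOpen.inter (S.dom i).isOpen).mem_nhds ⟨hU, hi⟩] with v hv
    exact ⟨hv.2, TwField.contMDiffAt_comp hs hv.1 hv.2, h i v hv.1 hv.2⟩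
  · intro h
    exact ⟨fun i u hu ↦ (h i u hu.1 hu.2).self_of_nhds.2.1.contMDiffWithinAt,
      fun i u hU hi ↦ (h i u hU hi).self_of_nhds.2.2⟩

theorem TwField.isTwistor_iff :
    Z.IsTwistor D ↔ ∀ i, ∀ u ∈ U, u ∈ S.dom i → S.IsTwistorNear D i (Z.comp i) u := by
  constructor
  · rintro ⟨hs, h⟩ i u hU hi
    filter_upwards [(U.isOpen.inter (S.dom i).isOpen).mem_nhds ⟨hU, hi⟩] with v hv
    have hz := TwField.contMDiffAt_comp hs hv.1 hv.2
    exact ⟨hv.2, hz, (S.twistorD_fst_eq_zero_iff hv.2 (hz.mdifferentiableAt (by simp))).2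
      (h i v hv.1 hv.2)⟩
  · intro h
    refine ⟨fun i u hu ↦ (h i u hu.1 hu.2).self_of_nhds.2.1.contMDiffWithinAt,
      fun i u hU hi ↦ ?_⟩
    obtain ⟨-, hz, h0⟩ := (h i u hU hi).self_of_nhds
    exact (S.twistorD_fst_eq_zero_iff hi (hz.mdifferentiableAt (by simp))).1 h0

theorem IsParallelNear.add {z z' : V → TwComp} (h : S.IsParallelNear D i z u)
    (h' : S.IsParallelNear D i z' u) : S.IsParallelNear D i (fun v ↦ z v + z' v) u := by
  filter_upwards [h, h'] with v ⟨hi, hz, h⟩ ⟨_, hz', h'⟩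
  refine ⟨hi, hz.add hz', fun t ↦ ?_⟩
  have m := hz.mdifferentiableAt (n := ∞) (by simp)
  have m' := hz'.mdifferentiableAt (n := ∞) (by simp)
  have madd : MDifferentiableAt 𝓘(ℝ, E4) 𝓘(ℝ, TwComp) (fun v ↦ z v + z' v) v := m.add m'
  have e := h t
  have e' := h' t
  rw [S.twistorD_eq m] at e
  rw [S.twistorD_eq m'] at e'
  rw [S.twistorD_eq madd, mvfderiv_add_apply m m', map_add, add_add_add_comm, e, e', add_zero]

theorem twistorForm_complex_smul (c : ℂ) (t : TangentSpace 𝓘(ℝ, E4) u) (w : TwComp) :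
    S.twistorForm D i u t (c • w) = c • S.twistorForm D i u t w := by
  change (S.spinConn D i u t *ᵥ (c • w.1) + Complex.I • (S.herm i u t *ᵥ (c • w.2)),
      -((S.spinConn D i u t)ᴴ *ᵥ (c • w.2)) + Complex.I • (S.schoutenSpin D i u t *ᵥ (c • w.1))) = _
  simp only [Matrix.mulVec_smul, smul_comm Complex.I c, ← smul_neg, ← smul_add]
  rfl

theorem IsParallelNear.smul (c : ℂ) {z : V → TwComp} (h : S.IsParallelNear D i z u) :
    S.IsParallelNear D i (fun v ↦ c • z v) u := by
  filter_upwards [h] with v ⟨hi, hz, h⟩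
  refine ⟨hi, (contDiff_const_smul c).contMDiff.contMDiffAt.comp v hz, fun t ↦ ?_⟩
  have m := hz.mdifferentiableAt (n := ∞) (by simp)
  have hc := mvfderiv_clm_comp ((c • ContinuousLinearMap.id ℂ TwComp).restrictScalars ℝ) m t
  have e := h t
  rw [S.twistorD_eq m] at e
  have msmul : MDifferentiableAt 𝓘(ℝ, E4) 𝓘(ℝ, TwComp) (fun v ↦ c • z v) v :=
    ((contDiff_const_smul c).contMDiff.contMDiffAt.comp v hz).mdifferentiableAt (n := ∞) (by simp)
  rw [S.twistorD_eq msmul, twistorForm_complex_smul]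
  refine (congrArg (· + _) hc).trans ?_
  change c • mvfderiv 𝓘(ℝ, E4) z v t + _ = _
  rw [← smul_add, e, smul_zero]

theorem isParallelNear_zero (hi : u ∈ S.dom i) : S.IsParallelNear D i (fun _ ↦ 0) u := by
  filter_upwards [(S.dom i).isOpen.mem_nhds hi] with v hv
  refine ⟨hv, contMDiffAt_const, fun t ↦ ?_⟩
  rw [S.twistorD_eq mdifferentiableAt_const, mvfderiv_const, map_zero, add_zero]
  rfl

variable (S D U) in
/-- The complex vector space of the parallel fields of local twistors on `U`. -/
def parallelTwistors : Submodule ℂ (S.TwField U) where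
  carrier := {Z | Z.IsParallel D}
  add_mem' {Z Z'} hZ hZ' := by
    simp only [mem_ofPred_eq, TwField.isParallel_iff, TwField.comp_add] at hZ hZ' ⊢
    exact fun i u hU hi ↦ (hZ i u hU hi).add (hZ' i u hU hi)
  zero_mem' := by
    simp only [mem_ofPred_eq, TwField.isParallel_iff, TwField.comp_zero]
    exact fun i u hU hi ↦ isParallelNear_zero hi
  smul_mem' c Z hZ := by
    simp only [mem_ofPred_eq, TwField.isParallel_iff, TwField.comp_smul] at hZ ⊢
    exact fun i u hU hi ↦ (hZ i u hU hi).smul c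

theorem mem_parallelTwistors : Z ∈ S.parallelTwistors D U ↔ Z.IsParallel D := Iff.rfl

variable [T2Space V]

theorem TwField.isTwistor_iff_isParallel (hK : S.TwistorCurvatureVanishes D) :
    Z.IsTwistor D ↔ Z.IsParallel D := by
  rw [TwField.isTwistor_iff, TwField.isParallel_iff]
  exact ⟨fun h i u hU hi ↦ (h i u hU hi).isParallelNear hK,
    fun h i u hU hi ↦ (h i u hU hi).isTwistorNear⟩

/-- A parallel field on a connected set is determined by its value at a point: the set where two
such fields agree is open and closed. -/
theorem TwField.IsParallel.eq_of_apply_eq [PreconnectedSpace U]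
    (hD : CovariantDerivative.ContMDiffCovariantDerivative D ∞) (hZ : Z.IsParallel D)
    (hZ' : Z'.IsParallel D) {b₀ : U} (h : Z b₀ = Z' b₀) : Z = Z' := by
  have hiff : ∀ (i : ι) (b : U), (b : V) ∈ S.dom i →
      (Z b = Z' b ↔ Z.comp i b = Z'.comp i b) := by
    intro i b hi
    rw [TwField.comp_of_mem Z b.2 hi, TwField.comp_of_mem Z' b.2 hi]
    exact (S.localTwistorEquiv hi).injective.eq_iff.symm
  have hdom : ∀ (i : ι) (b : U), (b : V) ∈ S.dom i → ∀ᶠ b' : U in 𝓝 b, (b' : V) ∈ S.dom i :=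
    fun i b hi ↦ continuous_subtype_val.continuousAt.eventually ((S.dom i).isOpen.mem_nhds hi)
  have hclopen : IsClopen {b : U | Z b = Z' b} := by
    constructor
    · rw [← isOpen_compl_iff, isOpen_iff_mem_nhds]
      intro b hb
      obtain ⟨i, hi⟩ := S.covers b
      have hne : Z.comp i b ≠ Z'.comp i b := fun h ↦ hb ((hiff i b hi).2 h)
      have hev := ((TwField.contMDiffAt_comp hZ.1 b.2 hi).continuousAt.prodMk
        (TwField.contMDiffAt_comp hZ'.1 b.2 hi).continuousAt).eventually
        ((isOpen_ne_fun continuous_fst continuous_snd).mem_nhds hne)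
      filter_upwards [hdom i b hi, continuous_subtype_val.continuousAt.eventually hev]
        with b' hb' hne' heq
      exact hne' ((hiff i b' hb').1 heq)
    · rw [isOpen_iff_mem_nhds]
      intro b hb
      obtain ⟨i, hi⟩ := S.covers b
      have hev := (TwField.isParallel_iff.1 hZ i b b.2 hi).eventually_eq hD
        (TwField.isParallel_iff.1 hZ' i b b.2 hi) ((hiff i b hi).1 hb)
      filter_upwards [hdom i b hi, continuous_subtype_val.continuousAt.eventually hev]
        with b' hb' heq
      exact (hiff i b' hb').2 heq
  have huniv := hclopen.eq_univ ⟨b₀, h⟩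
  funext b
  have hb := mem_univ b
  rw [← huniv] at hb
  exact hb

/-- On a simply connected open set, parallel frames are continued along paths to global parallel
fields with a prescribed value at a point. -/
theorem exists_isParallel [SimplyConnectedSpace U] (hg : IsMetricCompatible g D)
    (hD : CovariantDerivative.ContMDiffCovariantDerivative D ∞)
    (hK : S.TwistorCurvatureVanishes D) (b₀ : U) (e₀ : S.LocalTwistor (b₀ : V)) :
    ∃ Z : S.TwField U, Z.IsParallel D ∧ Z b₀ = e₀ := by
  have : LocallyPathConnectedSpace V := ChartedSpace.locallyPathConnectedSpace E4 V
  have : LocallyPathConnectedSpace U := U.isOpen.locallyPathConnectedSpace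
  choose idx hidx using S.covers
  choose Ψ hΨ using fun k : V ↦ S.exists_parallel_frame (u₀ := k) hD hK (hidx k)
  choose O hO hOo hkO using fun k : V ↦ eventually_nhds_iff.1 (hΨ k)
  have hpar : ∀ (k v : V) (c : TwComp), v ∈ O k →
      S.IsParallelNear D (idx k) (fun v ↦ Ψ k v c) v := fun k v c hv ↦ by
    filter_upwards [(hOo k).mem_nhds hv] with v' hv'
    exact ⟨(hO k v' hv').1, (hO k v' hv').2.2 c⟩
  classical
  let f : ∀ (_ : U) (b : U), TwComp → S.LocalTwistor (b : V) := fun k b c ↦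
    if h : (b : V) ∈ S.dom (idx k) then (S.localTwistorEquiv h).symm (Ψ k b c) else 0
  have hf : ∀ (k b : U) (c : TwComp) (h : (b : V) ∈ S.dom (idx k)),
      f k b c = (S.localTwistorEquiv h).symm (Ψ k b c) := fun k b c h ↦ dif_pos h
  have hcont : ∀ {b : U} {p : V → Prop}, (∀ᶠ v in 𝓝 (b : V), p v) → ∀ᶠ b' : U in 𝓝 b, p b' :=
    fun h ↦ continuous_subtype_val.continuousAt.eventually h
  obtain ⟨s, hs₀, hs⟩ := exists_locallyConstant_section (B := U) (X := TwComp)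
    (W := fun k : U ↦ Subtype.val ⁻¹' O k) (f := f)
    (fun k ↦ (hOo k).preimage continuous_subtype_val) (fun b ↦ ⟨b, hkO b⟩)
    (fun k b hb ↦ by
      obtain ⟨hi, ⟨Λ, hΛ⟩, -⟩ := hO k b hb
      have hfun : f k b = (S.localTwistorEquiv hi).symm ∘ fun c ↦ Ψ k b c := by
        funext c
        exact hf k b c hi
      rw [hfun]
      refine (S.localTwistorEquiv hi).symm.bijective.comp ?_
      rw [← hΛ]
      refine Function.bijective_iff_has_inverse.2
        ⟨fun c ↦ (↑Λ⁻¹ : TwComp →L[ℝ] TwComp) c, fun c ↦ ?_, fun c ↦ ?_⟩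
      · exact congrArg (fun T : TwComp →L[ℝ] TwComp ↦ T c) Λ.inv_mul
      · exact congrArg (fun T : TwComp →L[ℝ] TwComp ↦ T c) Λ.mul_inv)
    (fun k l b hk hl v w hvw ↦ by
      have hik := (hO k b hk).1
      have hil := (hO l b hl).1
      have h1 := hpar k b v hk
      -- the twistor equation, unlike parallelism, is known to be independent of the frame
      have h2 := ((hpar l b w hl).isTwistorNear.frameChange hg hik).isParallelNear hK
      have h0 : Ψ k b v = S.frameChange (idx k) (idx l) b (Ψ l b w) := by
        rw [hf k b v hik, hf l b w hil] at hvw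
        rw [← S.localTwistorEquiv_symm_apply hik hil, ← hvw, LinearEquiv.apply_symm_apply]
      filter_upwards [hcont (h1.eventually_eq hD h2 h0), hcont ((S.dom (idx k)).isOpen.mem_nhds hik),
        hcont ((S.dom (idx l)).isOpen.mem_nhds hil)] with b' hb' hik' hil'
      rw [hf k b' v hik', hf l b' w hil', LinearEquiv.symm_apply_eq,
        S.localTwistorEquiv_symm_apply hik' hil']
      exact hb') b₀ e₀
  refine ⟨s, TwField.isParallel_iff.2 fun j u hU hj ↦ ?_, hs₀⟩
  obtain ⟨c, hc⟩ := hs ⟨u, hU⟩ ⟨u, hU⟩ (hkO u)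
  have hi := hidx u
  refine IsTwistorNear.isParallelNear hK
    (((hpar u u c (hkO u)).isTwistorNear.frameChange hg hj).congr ?_)
  have hc' : ∀ᶠ v in 𝓝 u, ∀ hv : v ∈ U, s ⟨v, hv⟩ = f ⟨u, hU⟩ ⟨v, hv⟩ c := by
    have hmap := U.isOpen.isOpenEmbedding_subtypeVal.map_nhds_eq ⟨u, hU⟩
    rw [← hmap, eventually_map]
    filter_upwards [hc] with b hb hv
    exact hb
  filter_upwards [hc', U.isOpen.mem_nhds hU, (S.dom j).isOpen.mem_nhds hj,
    (S.dom (idx u)).isOpen.mem_nhds hi] with v hv hvU hvj hvi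
  rw [TwField.comp_of_mem _ hvU hvj, hv hvU, hf ⟨u, hU⟩ ⟨v, hvU⟩ c hvi,
    S.localTwistorEquiv_symm_apply hvj hvi]

theorem bijective_parallelTwistors_apply [SimplyConnectedSpace U] (hg : IsMetricCompatible g D)
    (hD : CovariantDerivative.ContMDiffCovariantDerivative D ∞)
    (hK : S.TwistorCurvatureVanishes D) (b : U) :
    Function.Bijective fun Z : S.parallelTwistors D U ↦ (Z : S.TwField U) b := by
  constructor
  · intro Z Z' h
    exact Subtype.ext (TwField.IsParallel.eq_of_apply_eq hD Z.2 Z'.2 h)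
  · intro e
    obtain ⟨Z, hZ, hZe⟩ := exists_isParallel hg hD hK b e
    exact ⟨⟨Z, hZ⟩, hZe⟩

theorem finrank_parallelTwistors [SimplyConnectedSpace U] (hg : IsMetricCompatible g D)
    (hD : CovariantDerivative.ContMDiffCovariantDerivative D ∞)
    (hK : S.TwistorCurvatureVanishes D) : Module.finrank ℂ (S.parallelTwistors D U) = 4 := by
  obtain ⟨b⟩ : Nonempty U := inferInstance
  -- evaluation at a point is a linear isomorphism
  let ev : S.parallelTwistors D U →ₗ[ℂ] S.LocalTwistor (b : V) :=
    (LinearMap.proj b).comp (S.parallelTwistors D U).subtype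
  rw [(LinearEquiv.ofBijective ev (bijective_parallelTwistors_apply hg hD hK b)).finrank_eq,
    S.finrank_localTwistor]

end SpinStructure

end NTwistor

open scoped Manifold ContDiff in
theorem mainTheorem1 {V : Type*} [TopologicalSpace V] [T2Space V] [ChartedSpace NTwistor.E4 V]
    [IsManifold 𝓘(ℝ, NTwistor.E4) ∞ V]
    (g : NTwistor.Metric V) (nabla : NTwistor.LinConn V) (hnabla : NTwistor.IsLeviCivita g nabla)
    {ι : Type*} (S : NTwistor.SpinStructure g ι)
    (N : NTwistor.NConnection V) (hN : NTwistor.IsDMetric g N)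
    (D : NTwistor.LinConn V) (hD : NTwistor.IsCanonicalDConnection g N D)
    (hK : S.TwistorCurvatureVanishes D) (hΔ : NTwistor.DCommutatorVanishes D) :
    (∀ (Y : NTwistor.VField V) (u : V),
      MDifferentiableAt 𝓘(ℝ, NTwistor.E4) 𝓘(ℝ, NTwistor.E4).tangent
        (fun v ↦ (⟨v, Y v⟩ : TangentBundle 𝓘(ℝ, NTwistor.E4) V)) u → D Y u = nabla Y u) ∧
    ∀ U : TopologicalSpace.Opens V, SimplyConnectedSpace U →
      ∃ T : Submodule ℂ (S.TwField U),
        (∀ Z : S.TwField U, Z ∈ T ↔ Z.IsTwistor D) ∧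
        (∀ Z : S.TwField U, Z ∈ T ↔ Z.IsParallel D) ∧
        (∀ Z : S.TwField U, Z ∈ T ↔ Z.IsTwistor nabla) ∧
        (∀ Z : S.TwField U, Z ∈ T ↔ Z.IsParallel nabla) ∧
        Module.finrank ℂ T = 4 ∧
        ∀ u : U, Function.Bijective (fun Z : T ↦ (Z : S.TwField U) u) := by
  have hDN : ∀ (Y : NTwistor.VField V) (u : V),
      MDifferentiableAt 𝓘(ℝ, NTwistor.E4) 𝓘(ℝ, NTwistor.E4).tangent
        (fun v ↦ (⟨v, Y v⟩ : TangentBundle 𝓘(ℝ, NTwistor.E4) V)) u → D Y u = nabla Y u :=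
    fun Y u hY ↦ NTwistor.eq_of_isMetricCompatible_of_torsion_eq_zero hD.metric hnabla.metric
      (NTwistor.torsion_eq_zero_of_dCommutatorVanishes hΔ) hnabla.torsion_free hY
  refine ⟨hDN, fun U _ ↦ ⟨S.parallelTwistors D U, fun Z ↦ ?_, fun Z ↦ Iff.rfl, fun Z ↦ ?_,
    fun Z ↦ ?_, NTwistor.SpinStructure.finrank_parallelTwistors hD.metric hD.smooth hK,
    NTwistor.SpinStructure.bijective_parallelTwistors_apply hD.metric hD.smooth hK⟩⟩
  · rw [NTwistor.SpinStructure.mem_parallelTwistors,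
      NTwistor.SpinStructure.TwField.isTwistor_iff_isParallel hK]
  · rw [NTwistor.SpinStructure.mem_parallelTwistors,
      ← NTwistor.SpinStructure.TwField.isTwistor_iff_isParallel hK]
    refine and_congr_right fun _ ↦ forall_congr' fun i ↦ forall_congr' fun u ↦
      forall_congr' fun _ ↦ forall_congr' fun hi ↦ ?_
    simp only [S.spinDAA_congr hDN hi]
  · refine and_congr_right fun _ ↦ forall_congr' fun i ↦ forall_congr' fun u ↦
      forall_congr' fun _ ↦ forall_congr' fun hi ↦ forall_congr' fun t ↦ ?_
    rw [S.twistorD_congr_linConn hDN hD.smooth hi]
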